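/- **Notation.** For $s=(s_1,\dots,s_k)$ and $\sigma=(\sigma_1,\dots,\sigma_k)$ with positive entries, $\mathcal S_{s_1,\dots,s_k}^{\sigma_1,\dots,\sigma_k}(\mathbf R^{kd})$ is the space of all $F\in C^\infty(\mathbf R^{kd})$ such that, for some $h,C>0$ and all multi-indices $\alpha_j,\beta_j\in\mathbf N^d$, $$\sup\bigl|x_1^{\alpha_1}\cdots x_k^{\alpha_k}\,\partial_{x_1}^{\beta_1}\cdots\partial_{x_k}^{\beta_k}F\bigr|\le C\,h^{|\alpha_1+\beta_1+\dots+\alpha_k+\beta_k|}\prod_{j=1}^k\alpha_j!^{\,s_j}\,\beta_j!^{\,\sigma_j}.$$ It carries the inductive limit topology over $h>0$, and a prime denotes the dual space. For $r,t\in[0,1]$ with $r+t\le1$ and a symbol $a$ on $\mathbf R^{3d}$, the bilinear operator $\operatorname{Op}_{r,t}(a)$ is $$\operatorname{Op}_{r,t}(a)(f,g)(x)=(2\pi)^{-2d}\iiiint e^{i(\langle x-y,\xi\rangle+\langle x-z,\eta\rangle)}\,a\bigl(x+r(y-x)+t(z-x),\xi,\eta\bigr)f(y)g(z)\,dy\,dz\,d\xi\,d\eta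 .$$ It is understood in the sense of distributions: $\langle\operatorname{Op}_{r,t}(a)(f,g),\varphi\rangle=\langle a,W_{r,t}(\varphi\otimes f\otimes g)\rangle$, where, for a function $\Phi$ of $(x,y,z)\in\mathbf R^{3d}$, $$(W_{r,t}\Phi)(u,\xi,\eta)=(2\pi)^{-2d}\iint e^{i(\langle v,\xi\rangle+\langle w,\eta\rangle)}\,\Phi(x,\,x-v,\,x-w)\big|_{x=u+rv+tw}\,dv\,dw .$$ The distribution kernel of $\operatorname{Op}_{r,t}(a)$ is the functional $\Phi\mapsto\langle a,W_{r,t}\Phi\rangle$. The operator $e^{i\langle rD_\xi+tD_\eta,D_x\rangle}$, with $D=-i\partial$, is the Fourier multiplier on functions of $(x,\xi,\eta)$ whose symbol is $e^{i\langle ry+tz,\zeta\rangle}$ in the variables $(\zeta,y,z)$ dual to $(x,\xi,\eta)$. It acts on distributions by transposition: $\langle e^{i\langle rD_\xi+tD_\eta,D_x\rangle}a,\varphi\rangle=\langle a,e^{i\langle rD_\xi+tD_\eta,D_x\rangle}\varphi\rangle$. Two of these kernels, or two of these transformed symbols, are called equal if they take the same value at every $\varphi\in\mathscr S(\mathbf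 R^{3d})$ at which both are defined, that is, for which both of the functions to be paired with the symbols lie in the test space of the symbols. **Statement.** Let $s_j,\sigma_j>0$ with $s_j+\sigma_j\ge1$ for $j=1,2,3$. Let $r_1,t_1,r_2,t_2\in[0,1]$ with $r_1+t_1\le1$ and $r_2+t_2\le1$. Let $a,b\in(\mathcal S_{s_1,\sigma_2,\sigma_3}^{\sigma_1,s_2,s_3})'(\mathbf R^{3d})$. 1. The distribution kernels of $\operatorname{Op}_{r_1,t_1}(a)$ and $\operatorname{Op}_{r_2,t_2}(b)$ are equal if and only if $$e^{i\langle r_1D_\xi+t_1D_\eta,D_x\rangle}a=e^{i\langle r_2D_\xi+t_2D_\eta,D_x\rangle}b.\qquad(*)$$ 2. Suppose in addition that $s_i+\sigma_j\ge1$ for all $i,j\in\{1,2,3\}$, and put $s=\min_js_j$ and $\sigma=\min_j\sigma_j$. Then $W_{r_1,t_1}(\varphi\otimes f\otimes g)$ and $W_{r_2,t_2}(\varphi\otimes f\otimes g)$ lie in $\mathcal S_{s_1,\sigma_2,\sigma_3}^{\sigma_1,s_2,s_3}(\mathbf R^{3d})$ for all $f,g,\varphi\in\mathcal S_s^\sigma(\mathbf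 R^d)$, so both bilinear operators are defined on $\mathcal S_s^\sigma(\mathbf R^d)\times\mathcal S_s^\sigma(\mathbf R^d)$ with values in linear forms on $\mathcal S_s^\sigma(\mathbf R^d)$. Moreover, $$\operatorname{Op}_{r_1,t_1}(a)(f,g)=\operatorname{Op}_{r_2,t_2}(b)(f,g)\ \text{ for all } f,g\in\mathcal S_s^\sigma(\mathbf R^d)\quad\Longleftrightarrow\quad(*).$$ -/

import Mathlib

open MeasureTheory
open scoped FourierTransform SchwartzMap ContDiff

namespace GelfandShilov

/-- `F` belongs to the Banach space of step `h`, with norm at most `C`.  The coordinate `i` has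
decay exponent `s i` and regularity exponent `σ i`:
`|X ^ α * ∂ ^ β F (X)| ≤ C * h ^ |α + β| * ∏ i, (α i)! ^ (s i) * (β i)! ^ (σ i)`.
A derivative `∂ ^ β` is given by the list `m` of the directions of differentiation, so that
`β i` is the number of positions `j` with `m j = i` and `|β| = k`. -/
def HasBound {ι : Type} [Fintype ι] [DecidableEq ι] (s σ : ι → ℝ) (h C : ℝ)
    (F : EuclideanSpace ℝ ι → ℂ) : Prop :=
  ContDiff ℝ ∞ F ∧
    ∀ (α : ι → ℕ) (k : ℕ) (m : Fin k → ι) (X : EuclideanSpace ℝ ι),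
      |∏ i, X i ^ α i| * ‖iteratedFDeriv ℝ k F X (fun j => EuclideanSpace.single (m j) 1)‖
        ≤ C * h ^ ((∑ i, α i) + k) *
          ∏ i, (((α i).factorial : ℝ) ^ s i *
            (((Finset.univ.filter (fun j => m j = i)).card.factorial : ℕ) : ℝ) ^ σ i)

theorem HasBound.nonneg {ι : Type} [Fintype ι] [DecidableEq ι] {s σ : ι → ℝ} {h C : ℝ}
    {F : EuclideanSpace ℝ ι → ℂ} (hF : HasBound s σ h C F) : 0 ≤ C := by
  have := hF.2 0 0 Fin.elim0 0
  simp at this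
  exact (norm_nonneg _).trans this

theorem HasBound.mono {ι : Type} [Fintype ι] [DecidableEq ι] {s σ : ι → ℝ} {h h' C : ℝ}
    {F : EuclideanSpace ℝ ι → ℂ} (hF : HasBound s σ h C F) (h0 : 0 < h) (hh : h ≤ h') :
    HasBound s σ h' C F := by
  refine ⟨hF.1, fun α k m X => (hF.2 α k m X).trans ?_⟩
  have hC := hF.nonneg
  gcongr

/-- The Gelfand-Shilov space (of Roumieu type) with decay exponents `s` and regularity
exponents `σ`: the union over `h > 0` of the Banach spaces of step `h`. -/
def testSpace {ι : Type} [Fintype ι] [DecidableEq ι] (s σ : ι → ℝ) :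
    Submodule ℂ (EuclideanSpace ℝ ι → ℂ) where
  carrier := {F | ∃ h C : ℝ, 0 < h ∧ HasBound s σ h C F}
  zero_mem' := by
    refine ⟨1, 0, one_pos, contDiff_const, fun α k m X => ?_⟩
    have : iteratedFDeriv ℝ k (0 : EuclideanSpace ℝ ι → ℂ) = 0 := iteratedFDeriv_fun_zero
    simp [this]
  add_mem' := by
    rintro F G ⟨h₁, C₁, h₁0, hF⟩ ⟨h₂, C₂, h₂0, hG⟩
    have hF' := hF.mono h₁0 (le_max_left h₁ h₂)
    have hG' := hG.mono h₂0 (le_max_right h₁ h₂)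
    refine ⟨max h₁ h₂, C₁ + C₂, lt_max_of_lt_left h₁0, hF.1.add hG.1, fun α k m X => ?_⟩
    have e : iteratedFDeriv ℝ k (F + G) X = iteratedFDeriv ℝ k F X + iteratedFDeriv ℝ k G X :=
      iteratedFDeriv_add_apply (hF.1.contDiffAt.of_le (by exact_mod_cast le_top))
        (hG.1.contDiffAt.of_le (by exact_mod_cast le_top))
    rw [e, add_apply, add_mul, add_mul]
    refine (mul_le_mul_of_nonneg_left (norm_add_le _ _) (abs_nonneg _)).trans ?_
    rw [mul_add]
    exact add_le_add (hF'.2 α k m X) (hG'.2 α k m X)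
  smul_mem' := by
    rintro c F ⟨h, C, h0, hF⟩
    refine ⟨h, ‖c‖ * C, h0, contDiff_const.smul hF.1, fun α k m X => ?_⟩
    have e : iteratedFDeriv ℝ k (c • F) X = c • iteratedFDeriv ℝ k F X :=
      iteratedFDeriv_const_smul_apply (hF.1.contDiffAt.of_le (by exact_mod_cast le_top))
    rw [e, smul_apply, norm_smul, mul_left_comm, mul_assoc ‖c‖,
      mul_assoc ‖c‖]
    exact mul_le_mul_of_nonneg_left (hF.2 α k m X) (norm_nonneg _)

/-- A Gelfand-Shilov distribution: a linear form on the test space that is continuous for the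
inductive limit topology, that is, bounded on the Banach space of every step `h > 0`. -/
structure Distribution {ι : Type} [Fintype ι] [DecidableEq ι] (s σ : ι → ℝ) where
  toLinearMap : testSpace s σ →ₗ[ℂ] ℂ
  bounded : ∀ h : ℝ, 0 < h → ∃ K : ℝ, ∀ (C : ℝ) (φ : testSpace s σ),
    HasBound s σ h C (φ : EuclideanSpace ℝ ι → ℂ) → ‖toLinearMap φ‖ ≤ K * C

open Classical in
/-- The value `⟨a, φ⟩` for `φ` in the test space of `a` (and `0` for every other function `φ`). -/
noncomputable def Distribution.pair {ι : Type} [Fintype ι] [DecidableEq ι] {s σ : ι → ℝ}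
    (a : Distribution s σ) (φ : EuclideanSpace ℝ ι → ℂ) : ℂ :=
  if hφ : φ ∈ testSpace s σ then a.toLinearMap ⟨φ, hφ⟩ else 0

/-- `ℝᵈ`. -/
abbrev Vec (d : ℕ) : Type := EuclideanSpace ℝ (Fin d)

/-- `ℝ³ᵈ`, as three blocks of length `d`. -/
abbrev Vec3 (d : ℕ) : Type := EuclideanSpace ℝ (Fin 3 × Fin d)

/-- The block with number `j` of a vector of `ℝ³ᵈ`. -/
noncomputable def block {d : ℕ} (X : Vec3 d) (j : Fin 3) : Vec d :=
  WithLp.toLp 2 (fun i => X (j, i))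

/-- The vector `(x, y, z)` of `ℝ³ᵈ`. -/
noncomputable def triple {d : ℕ} (x y z : Vec d) : Vec3 d :=
  WithLp.toLp 2 (fun p => (![x, y, z] p.1) p.2)

/-- The decay exponents `(s₁, σ₂, σ₃)` of the symbol test functions, in `(x, ξ, η)`. -/
def symbolDecay (d : ℕ) (s σ : Fin 3 → ℝ) : Fin 3 × Fin d → ℝ :=
  fun p => ![s 0, σ 1, σ 2] p.1

/-- The regularity exponents `(σ₁, s₂, s₃)` of the symbol test functions, in `(x, ξ, η)`. -/
def symbolReg (d : ℕ) (s σ : Fin 3 → ℝ) : Fin 3 × Fin d → ℝ :=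
  fun p => ![σ 0, s 1, s 2] p.1

/-- The space of symbol test functions on `ℝ³ᵈ`, with decay exponents `(s₁, σ₂, σ₃)` and
regularity exponents `(σ₁, s₂, s₃)`. -/
abbrev SymbolTest (d : ℕ) (s σ : Fin 3 → ℝ) : Submodule ℂ (Vec3 d → ℂ) :=
  testSpace (symbolDecay d s σ) (symbolReg d s σ)

/-- The Gelfand-Shilov distributions on `ℝ³ᵈ` that serve as symbols: the dual of `SymbolTest`. -/
abbrev SymbolDist (d : ℕ) (s σ : Fin 3 → ℝ) : Type :=
  Distribution (symbolDecay d s σ) (symbolReg d s σ)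

/-- The Gelfand-Shilov space on `ℝᵈ` with one decay exponent `s` and one regularity
exponent `σ`. -/
abbrev VecTest (d : ℕ) (s σ : ℝ) : Submodule ℂ (Vec d → ℂ) :=
  testSpace (fun _ : Fin d => s) (fun _ : Fin d => σ)

/-- The transpose of the map that sends a symbol `a` to the distribution kernel
`(2π)⁻²ᵈ ∬ exp (-i(⟨y - x, ξ⟩ + ⟨z - x, η⟩)) a (x + r (y - x) + t (z - x), ξ, η) dξ dη`
of its bilinear operator.  It is applied to a function `Φ` of `(x, y, z)`, and the variables of
the result are `(u, ξ, η)`.  The substitution is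
`u = x + r (y - x) + t (z - x)`, `v = x - y`, `w = x - z`, which has Jacobian `±1`. -/
noncomputable def kernelTranspose {d : ℕ} (r t : ℝ) (Φ : Vec3 d → ℂ) : Vec3 d → ℂ :=
  fun Y => (((2 * Real.pi) ^ (2 * d) : ℝ) : ℂ)⁻¹ *
    ∫ v : Vec d, ∫ w : Vec d,
      Complex.exp (Complex.I * ((inner ℝ v (block Y 1) + inner ℝ w (block Y 2) : ℝ) : ℂ)) *
        Φ (triple (block Y 0 + r • v + t • w)
          (block Y 0 + r • v + t • w - v) (block Y 0 + r • v + t • w - w))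

/-- The number `⟨Op_{r,t}(a)(f, g), φ⟩`, that is, the iterated integral of
`(2π)⁻²ᵈ exp (-i(⟨y - x, ξ⟩ + ⟨z - x, η⟩)) a (x + r (y - x) + t (z - x), ξ, η) f(y) g(z) φ(x)`
in the sense of distributions. -/
noncomputable def bilinearOp {d : ℕ} {s σ : Fin 3 → ℝ} (r t : ℝ) (a : SymbolDist d s σ)
    (f g φ : Vec d → ℂ) : ℂ :=
  a.pair (kernelTranspose r t (fun X => φ (block X 0) * f (block X 1) * g (block X 2)))

/-- The operator `exp (i⟨r D_ξ + t D_η, D_x⟩)` on functions of `(x, ξ, η)`, as a Fourier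
multiplier.  For the Fourier transform of Mathlib, `D = -i∂` is multiplication by `2π` times the
frequency, whose three blocks are dual to `x`, `ξ` and `η`. -/
noncomputable def expOp {d : ℕ} (r t : ℝ) (φ : Vec3 d → ℂ) : Vec3 d → ℂ :=
  𝓕⁻ (fun Y : Vec3 d =>
    Complex.exp (Complex.I * (((2 * Real.pi) ^ 2 *
      inner ℝ (r • block Y 1 + t • block Y 2) (block Y 0) : ℝ) : ℂ)) * (𝓕 φ : Vec3 d → ℂ) Y)

/-- Equality of the distribution kernels of `Op_{r₁,t₁}(a)` and `Op_{r₂,t₂}(b)`, as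
distributions on `ℝ³ᵈ`: they have the same value at each test function at which both are
defined. -/
def SameKernel {d : ℕ} {s σ : Fin 3 → ℝ} (r₁ t₁ r₂ t₂ : ℝ) (a b : SymbolDist d s σ) : Prop :=
  ∀ Φ : 𝓢(Vec3 d, ℂ),
    kernelTranspose r₁ t₁ Φ ∈ SymbolTest d s σ → kernelTranspose r₂ t₂ Φ ∈ SymbolTest d s σ →
      a.pair (kernelTranspose r₁ t₁ Φ) = b.pair (kernelTranspose r₂ t₂ Φ)

/-- Equality of `exp (i⟨r₁ D_ξ + t₁ D_η, D_x⟩) a` and `exp (i⟨r₂ D_ξ + t₂ D_η, D_x⟩) b`, as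
distributions on `ℝ³ᵈ`: they have the same value at each test function at which both are
defined.  The operators act on distributions by transposition; the multiplier is an even
function, so each operator is its own transpose. -/
def SameExp {d : ℕ} {s σ : Fin 3 → ℝ} (r₁ t₁ r₂ t₂ : ℝ) (a b : SymbolDist d s σ) : Prop :=
  ∀ φ : 𝓢(Vec3 d, ℂ),
    expOp r₁ t₁ φ ∈ SymbolTest d s σ → expOp r₂ t₂ φ ∈ SymbolTest d s σ →
      a.pair (expOp r₁ t₁ φ) = b.pair (expOp r₂ t₂ φ)

end GelfandShilov

/-!
The map `kernelTranspose r t` is a linear change of variables (`shear`), followed by the partial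
Fourier transform in the last two blocks (`pf₂`); on Schwartz functions it is the bijection
`wigner r t`.

**Kernels and transformed symbols.** The Fourier transform on `ℝ³ᵈ` undoes `pf₂`, and in
the variables `(u, v, w)` of `shear` the parameters `r` and `t` only translate `u` by `r v + t w`.
On the Fourier side in `u` this is the multiplication by a character, so that
`expOp r t (wigner 0 0 Φ) = wigner r t Φ` (`expOp_wigner`).
Since `wigner 0 0` is onto the Schwartz functions, the equality of the kernels at all `Φ` and the
equality of the transformed symbols at all `φ = wigner 0 0 Φ` are the same condition
(`sameKernel_iff_sameExp`).

**The operators are defined on test functions.** When `s + σ ≥ 1`, the defining bounds of the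
Gelfand-Shilov space also hold for words in the operators `x_i` and `∂_i`, in any order
(`word_bound`): a commutator removes one `x_i` and one `∂_i`, and the weights pay for the factor
that it produces.  Partial Fourier transforms exchange the two kinds of letters, and linear
changes of variables replace letters by linear combinations, whence `partialFourier_mem`,
`compEquiv_mem` and `wigner_mem`.

**The operators determine the kernels.** The partial Fourier transform `pf₂` maps the test space
with exponents `(s_j, σ_j)` in the three blocks onto the test space of the symbols, so a symbol `a`
gives a continuous linear form `U` on the former space, and `⟨a, wigner r t Φ⟩` is a constant times
`U (Φ ∘ shear)`.  Here `Φ` is only known to lie in the domain of this form after the change of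
variables, and the changes of variables for `a` and `b` differ, so a density argument in one fixed
space is not available.  Instead, `Φ` is convolved with the dilates of a tensor product
`g = γ ⊗ γ ⊗ γ` with non-zero integral.  Convolutions are compatible with linear changes of
variables, a continuous form may be moved under the integral that defines a convolution
(`IsForm.exists_conv`), and so the values of both forms on `Φ * g` are integrals of `Φ` against
values on translates of dilates of `g`.  These translates are tensor products again, on which the
two operators agree.  Letting the dilates concentrate at the origin gives `eq_of_eq_on_translates`.

**A window with non-zero integral.** It remains to find `γ` in the space with exponents `s` and
`σ`, where `s + σ ≥ 1` (`exists_window`).  Up to a Fourier transform one may take `σ = 1 - s` and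
`1 / 2 ≤ s < 1`.  By Cauchy's estimates it suffices to have an entire function, non-negative on
the real axis, with `|F (x + i y)| ≤ C exp (-c |x| ^ p + b |y| ^ p)` and `p = 1 / s`.  For `p = 2`
this is a Gaussian, and for `1 < p < 2` the product `∏ cos (z / 2 ^ j) ^ (2 n_j)`, where `n_j` is
about `2 ^ (p j)`, has this property (`isEntireWindow_dyadicProd`).
-/

open LineDeriv
open scoped ENNReal

set_option linter.unusedSectionVars false

namespace GelfandShilov

variable {ι κ : Type} [Fintype ι] [DecidableEq ι] [Fintype κ] [DecidableEq κ]
  {d : ℕ}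

/-! ### Partial derivatives in the coordinate directions -/

/-- Schwartz functions on `ℝ^ι`. -/
abbrev Sch (ι : Type) [Fintype ι] : Type := 𝓢(EuclideanSpace ℝ ι, ℂ)

/-- The partial derivative in the coordinate direction `i`. -/
noncomputable def pderiv (i : ι) : Sch ι →L[ℂ] Sch ι :=
  lineDerivOpCLM ℂ (Sch ι) (EuclideanSpace.single i (1 : ℝ))

/-- Multiplication by the coordinate `i`. -/
noncomputable def coordMul (i : ι) : Sch ι →L[ℂ] Sch ι :=
  SchwartzMap.smulLeftCLM ℂ (fun X : EuclideanSpace ℝ ι => ((X i : ℝ) : ℂ))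

theorem hasTemperateGrowth_coord (i : ι) :
    (fun X : EuclideanSpace ℝ ι => ((X i : ℝ) : ℂ)).HasTemperateGrowth :=
  (Complex.ofRealCLM.comp (EuclideanSpace.proj i : EuclideanSpace ℝ ι →L[ℝ] ℝ)).hasTemperateGrowth

@[simp] theorem coordMul_apply (i : ι) (F : Sch ι) (X : EuclideanSpace ℝ ι) :
    coordMul i F X = X i * F X := by
  rw [coordMul, SchwartzMap.smulLeftCLM_apply_apply (hasTemperateGrowth_coord i), smul_eq_mul]

theorem pderiv_apply (i : ι) (F : Sch ι) (X : EuclideanSpace ℝ ι) :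
    pderiv i F X = fderiv ℝ F X (EuclideanSpace.single i 1) := rfl

theorem eq_sum_single (X : EuclideanSpace ℝ ι) :
    X = ∑ i, X i • EuclideanSpace.single i (1 : ℝ) := by
  ext j
  simp [Pi.single_apply]

theorem clm_eq_sum_proj {V : Type*} [NormedAddCommGroup V] [NormedSpace ℝ V]
    (A : EuclideanSpace ℝ ι →L[ℝ] V) :
    A = ∑ i, (EuclideanSpace.proj i : EuclideanSpace ℝ ι →L[ℝ] ℝ).smulRight
      (A (EuclideanSpace.single i 1)) := by
  ext X
  conv_lhs => rw [eq_sum_single X]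
  simp

theorem hasFDerivAt_sch (F : Sch ι) (X : EuclideanSpace ℝ ι) :
    HasFDerivAt F (∑ i, (EuclideanSpace.proj i : EuclideanSpace ℝ ι →L[ℝ] ℝ).smulRight
      (pderiv i F X)) X := by
  have h := F.hasFDerivAt X
  rw [clm_eq_sum_proj (fderiv ℝ F X)] at h
  exact h

theorem pderiv_eq_of_hasFDerivAt {F : Sch ι} {X : EuclideanSpace ℝ ι}
    {A : EuclideanSpace ℝ ι →L[ℝ] ℂ} (h : HasFDerivAt F A X) (i : ι) :
    pderiv i F X = A (EuclideanSpace.single i 1) := by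
  rw [pderiv_apply, h.fderiv]

theorem pderiv_coordMul (i j : ι) (F : Sch ι) :
    pderiv i (coordMul j F) = (if i = j then F else 0) + coordMul j (pderiv i F) := by
  ext X
  have h1 : HasFDerivAt (fun X : EuclideanSpace ℝ ι => ((X j : ℝ) : ℂ))
      (Complex.ofRealCLM.comp (EuclideanSpace.proj j : EuclideanSpace ℝ ι →L[ℝ] ℝ)) X :=
    (Complex.ofRealCLM.comp (EuclideanSpace.proj j : EuclideanSpace ℝ ι →L[ℝ] ℝ)).hasFDerivAt
  have h2 := h1.mul (F.hasFDerivAt X)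
  have h3 : HasFDerivAt (coordMul j F) _ X :=
    h2.congr_of_eventuallyEq (Filter.Eventually.of_forall fun Y => coordMul_apply j F Y)
  rw [pderiv_eq_of_hasFDerivAt h3]
  have : j = i ↔ i = j := eq_comm
  by_cases hij : i = j
  · simp [pderiv_apply, hij]; ring
  · simp [pderiv_apply, hij, this]

/-- The iterated partial derivative in the directions of the list `l`, the head being the
outermost one. -/
noncomputable def derivs (l : List ι) (F : Sch ι) : Sch ι := l.foldr (fun i G => pderiv i G) F

@[simp] theorem derivs_nil (F : Sch ι) : derivs [] F = F := rfl

theorem derivs_cons (i : ι) (l : List ι) (F : Sch ι) :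
    derivs (i :: l) F = pderiv i (derivs l F) := rfl

theorem derivs_append (l l' : List ι) (F : Sch ι) :
    derivs (l ++ l') F = derivs l (derivs l' F) := by
  simp [derivs, List.foldr_append]

theorem derivs_add (l : List ι) (F G : Sch ι) : derivs l (F + G) = derivs l F + derivs l G := by
  induction l with
  | nil => rfl
  | cons j l ih => simp [derivs_cons, ih]

theorem derivs_smul (l : List ι) (c : ℂ) (F : Sch ι) : derivs l (c • F) = c • derivs l F := by
  induction l with
  | nil => rfl
  | cons j l ih => simp [derivs_cons, ih]

theorem derivs_ofFn {k : ℕ} (m : Fin k → ι) (F : Sch ι) (X : EuclideanSpace ℝ ι) :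
    derivs (List.ofFn m) F X =
      iteratedFDeriv ℝ k F X (fun j => EuclideanSpace.single (m j) 1) := by
  rw [← SchwartzMap.iteratedLineDerivOp_eq_iteratedFDeriv]
  congr 1
  induction k with
  | zero => simp
  | succ k ih =>
    rw [List.ofFn_succ, derivs_cons, iteratedLineDerivOp_succ_left, ih]
    rfl

/-! ### Families of iterated derivatives -/

/-- `𝒢 l` is the iterated derivative of `𝒢 []` in the directions of the list `l`.  This is stated as
a condition on first derivatives, so that it can be verified one derivative at a time. -/
def IsDerivFamily (𝒢 : List ι → EuclideanSpace ℝ ι → ℂ) : Prop :=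
  ∀ l X, HasFDerivAt (𝒢 l) (∑ i, (EuclideanSpace.proj i : EuclideanSpace ℝ ι →L[ℝ] ℝ).smulRight
    (𝒢 (i :: l) X)) X

theorem IsDerivFamily.contDiff {𝒢 : List ι → EuclideanSpace ℝ ι → ℂ} (h : IsDerivFamily 𝒢)
    (l : List ι) : ContDiff ℝ ∞ (𝒢 l) := by
  rw [contDiff_infty]
  intro n
  induction n generalizing l with
  | zero =>
    simp only [Nat.cast_zero, contDiff_zero]
    exact continuous_iff_continuousAt.2 fun X => (h l X).continuousAt
  | succ n ih =>
    rw [Nat.cast_succ, contDiff_succ_iff_fderiv]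
    refine ⟨fun X => (h l X).differentiableAt, by simp, ?_⟩
    have : fderiv ℝ (𝒢 l) = fun X => ∑ i,
        (EuclideanSpace.proj i : EuclideanSpace ℝ ι →L[ℝ] ℝ).smulRight (𝒢 (i :: l) X) :=
      funext fun X => (h l X).fderiv
    rw [this]
    refine ContDiff.sum fun i _ => ?_
    exact contDiff_const.smulRight (ih (i :: l))

theorem IsDerivFamily.iteratedFDeriv {𝒢 : List ι → EuclideanSpace ℝ ι → ℂ}
    (h : IsDerivFamily 𝒢) {k : ℕ} (m : Fin k → ι) (l : List ι) (X : EuclideanSpace ℝ ι) :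
    iteratedFDeriv ℝ k (𝒢 l) X (fun j => EuclideanSpace.single (m j) 1)
      = 𝒢 (List.ofFn m ++ l) X := by
  induction k generalizing X with
  | zero => simp
  | succ k ih =>
    rw [iteratedFDeriv_succ_apply_left, ← fderiv_continuousMultilinear_apply_const_apply]
    · have : (fun Y => (_root_.iteratedFDeriv ℝ k (𝒢 l) Y)
          (Fin.tail fun j => EuclideanSpace.single (m j) (1 : ℝ)))
          = 𝒢 (List.ofFn (fun j : Fin k => m j.succ) ++ l) :=
        funext fun Y => ih (fun j => m j.succ) Y
      rw [this, (h _ X).fderiv, List.ofFn_succ]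
      simp [ite_smul]
    · exact ((h.contDiff l).differentiable_iteratedFDeriv (mod_cast ENat.natCast_lt_top k)) X

/-! ### Schwartz functions in terms of coordinates -/

theorem abs_le_norm_coord (X : EuclideanSpace ℝ ι) (i : ι) : |X i| ≤ ‖X‖ := by
  simpa using PiLp.norm_apply_le X i

theorem norm_le_sum_abs (X : EuclideanSpace ℝ ι) : ‖X‖ ≤ ∑ i, |X i| := by
  calc ‖X‖ = ‖∑ i, X i • EuclideanSpace.single i (1 : ℝ)‖ := by rw [← eq_sum_single X]
    _ ≤ ∑ i, ‖X i • EuclideanSpace.single i (1 : ℝ)‖ := norm_sum_le _ _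
    _ = ∑ i, |X i| := by simp [norm_smul]

/-- A power of the norm is controlled by the powers of the coordinates. -/
theorem one_add_norm_pow_le (r : ℕ) : ∃ M : ℝ, 0 < M ∧ ∀ X : EuclideanSpace ℝ ι,
    (1 + ‖X‖) ^ r ≤ M * (1 + ∑ i, |X i| ^ r) := by
  refine ⟨((Fintype.card ι : ℝ) + 1) ^ r, by positivity, fun X => ?_⟩
  have h1 : (1 + ‖X‖) ^ r ≤ (1 + ∑ i, |X i|) ^ r := by
    gcongr
    exact norm_le_sum_abs X
  refine h1.trans ?_
  -- the largest of the numbers `1, |X i|` dominates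
  rcases isEmpty_or_nonempty ι with hι | hι
  · simp
  obtain ⟨i, hi⟩ := Finite.exists_max (fun i => |X i|)
  set t := max 1 |X i|
  have ht0 : (1 : ℝ) ≤ t := le_max_left _ _
  have h2 : 1 + ∑ i, |X i| ≤ ((Fintype.card ι : ℝ) + 1) * t := by
    have : ∑ j, |X j| ≤ ∑ _j : ι, t := Finset.sum_le_sum fun j _ => (hi j).trans (le_max_right _ _)
    simp only [Finset.sum_const, nsmul_eq_mul, Finset.card_univ] at this
    nlinarith
  have h3 : t ^ r ≤ 1 + ∑ i, |X i| ^ r := by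
    have h4 : |X i| ^ r ≤ ∑ j, |X j| ^ r :=
      Finset.single_le_sum (f := fun j => |X j| ^ r) (fun j _ => by positivity) (Finset.mem_univ i)
    have h5 : 0 ≤ ∑ j, |X j| ^ r := Finset.sum_nonneg fun j _ => by positivity
    rcases max_cases (1 : ℝ) |X i| with h | h
    · simp only [t, h.1, one_pow]; linarith
    · simp only [t, h.1]; linarith
  calc (1 + ∑ i, |X i|) ^ r ≤ (((Fintype.card ι : ℝ) + 1) * t) ^ r := by gcongr
    _ = ((Fintype.card ι : ℝ) + 1) ^ r * t ^ r := mul_pow _ _ _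
    _ ≤ _ := by gcongr

theorem norm_multilinear_le {k : ℕ}
    (A : ContinuousMultilinearMap ℝ (fun _ : Fin k => EuclideanSpace ℝ ι) ℂ) :
    ‖A‖ ≤ ∑ m : Fin k → ι, ‖A (fun j => EuclideanSpace.single (m j) 1)‖ := by
  refine A.opNorm_le_bound (Finset.sum_nonneg fun _ _ => norm_nonneg _) fun v => ?_
  have h : v = fun j => ∑ i, v j i • EuclideanSpace.single i (1 : ℝ) :=
    funext fun j => eq_sum_single (v j)
  conv_lhs => rw [h]
  rw [A.map_sum, Finset.sum_mul]
  refine (norm_sum_le _ _).trans (Finset.sum_le_sum fun m _ => ?_)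
  rw [A.map_smul_univ, norm_smul, mul_comm, norm_prod]
  gcongr with j
  exact PiLp.norm_apply_le (v j) (m j)

/-- A smooth function all of whose derivatives are rapidly decreasing, in terms of coordinates,
is a Schwartz function. -/
theorem exists_sch {F : EuclideanSpace ℝ ι → ℂ} (hF : ContDiff ℝ ∞ F)
    (hb : ∀ (α : ι → ℕ) (k : ℕ) (m : Fin k → ι), ∃ C : ℝ, ∀ X : EuclideanSpace ℝ ι,
      |∏ i, X i ^ α i| * ‖iteratedFDeriv ℝ k F X (fun j => EuclideanSpace.single (m j) 1)‖ ≤ C) :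
    ∃ G : Sch ι, ⇑G = F := by
  refine ⟨⟨F, hF, fun k n => ?_⟩, rfl⟩
  obtain ⟨M, hM, hMX⟩ := one_add_norm_pow_le (ι := ι) k
  choose C hC using fun m : Fin n → ι => hb 0 n m
  choose D hD using fun (i : ι) (m : Fin n → ι) => hb (Pi.single i k) n m
  refine ⟨M * ∑ m, (C m + ∑ i, D i m), fun X => ?_⟩
  have h0 : ‖X‖ ^ k ≤ M * (1 + ∑ i, |X i| ^ k) := by
    refine le_trans ?_ (hMX X)
    gcongr
    linarith
  have hD' : ∀ i m, |X i| ^ k * ‖iteratedFDeriv ℝ n F X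
      (fun j => EuclideanSpace.single (m j) 1)‖ ≤ D i m := by
    intro i m
    have := hD i m X
    rw [Finset.prod_eq_single i] at this
    · simpa using this
    · intro j _ hj
      simp [hj]
    · simp
  have hC' : ∀ m, ‖iteratedFDeriv ℝ n F X (fun j => EuclideanSpace.single (m j) 1)‖ ≤ C m := by
    intro m
    simpa using hC m X
  calc ‖X‖ ^ k * ‖iteratedFDeriv ℝ n F X‖
      ≤ (M * (1 + ∑ i, |X i| ^ k)) *
        ∑ m : Fin n → ι, ‖iteratedFDeriv ℝ n F X (fun j => EuclideanSpace.single (m j) 1)‖ := by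
        gcongr
        exact norm_multilinear_le _
    _ = M * ∑ m : Fin n → ι, (‖iteratedFDeriv ℝ n F X (fun j => EuclideanSpace.single (m j) 1)‖ +
        ∑ i, |X i| ^ k * ‖iteratedFDeriv ℝ n F X (fun j => EuclideanSpace.single (m j) 1)‖) := by
        rw [mul_assoc, Finset.mul_sum]
        congr 2
        ext m
        rw [add_mul, one_mul, Finset.sum_mul]
    _ ≤ _ := by
        gcongr with m _ i
        · exact hC' m
        · exact hD' i m

/-! ### Factorial weights -/

/-- The weight `∏ i, (α i)! ^ (s i)`. -/
noncomputable def facPow (s : ι → ℝ) (α : ι → ℕ) : ℝ := ∏ i, ((α i).factorial : ℝ) ^ s i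

theorem facPow_pos (s : ι → ℝ) (α : ι → ℕ) : 0 < facPow s α :=
  Finset.prod_pos fun i _ => Real.rpow_pos_of_pos (by exact_mod_cast (α i).factorial_pos) _

theorem one_le_factorial (n : ℕ) : (1 : ℝ) ≤ n.factorial := by exact_mod_cast n.factorial_pos

@[simp] theorem facPow_zero (s : ι → ℝ) : facPow s 0 = 1 := by simp [facPow]

theorem facPow_mul_le {s : ι → ℝ} (hs : ∀ i, 0 ≤ s i) (α β : ι → ℕ) :
    facPow s α * facPow s β ≤ facPow s (α + β) := by
  unfold facPow
  rw [← Finset.prod_mul_distrib]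
  refine Finset.prod_le_prod (fun i _ => by positivity) fun i _ => ?_
  rw [← Real.mul_rpow (by positivity) (by positivity)]
  refine Real.rpow_le_rpow (by positivity) ?_ (hs i)
  exact_mod_cast Nat.le_of_dvd (Nat.factorial_pos _)
    (Nat.factorial_mul_factorial_dvd_factorial_add _ _)

theorem factorial_add_le (a b : ℕ) :
    ((a + b).factorial : ℝ) ≤ 2 ^ (a + b) * (a.factorial * b.factorial) := by
  have h := Nat.add_choose_mul_factorial_mul_factorial a b
  have h2 : (a + b).choose b ≤ 2 ^ (a + b) := Nat.choose_le_two_pow _ _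
  rw [← h, mul_assoc]
  push_cast
  gcongr
  exact_mod_cast h2

theorem facPow_add_le {s : ι → ℝ} (hs : ∀ i, 0 ≤ s i) (α β : ι → ℕ) :
    facPow s (α + β) ≤ ((2 : ℝ) ^ (∑ i, s i)) ^ (∑ i, (α i + β i)) * (facPow s α * facPow s β) := by
  have h1 : ∀ i, ((α i + β i).factorial : ℝ) ^ s i ≤
      ((2 : ℝ) ^ (∑ i, s i)) ^ (α i + β i) *
        (((α i).factorial : ℝ) ^ s i * ((β i).factorial : ℝ) ^ s i) := by
    intro i
    calc ((α i + β i).factorial : ℝ) ^ s i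
        ≤ (2 ^ (α i + β i) * ((α i).factorial * (β i).factorial)) ^ s i :=
          Real.rpow_le_rpow (by positivity) (factorial_add_le _ _) (hs i)
      _ = ((2 : ℝ) ^ s i) ^ (α i + β i) *
          (((α i).factorial : ℝ) ^ s i * ((β i).factorial : ℝ) ^ s i) := by
          rw [Real.mul_rpow (by positivity) (by positivity),
            Real.mul_rpow (by positivity) (by positivity), ← Real.rpow_natCast, ← Real.rpow_natCast,
            ← Real.rpow_mul (by norm_num), ← Real.rpow_mul (by norm_num), mul_comm (s i)]
      _ ≤ _ := by
          gcongr
          · norm_num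
          · exact Finset.single_le_sum (fun j _ => hs j) (Finset.mem_univ i)
  unfold facPow
  calc ∏ i, (((α + β) i).factorial : ℝ) ^ s i
      ≤ ∏ i, ((2 : ℝ) ^ (∑ i, s i)) ^ (α i + β i) *
        (((α i).factorial : ℝ) ^ s i * ((β i).factorial : ℝ) ^ s i) :=
        Finset.prod_le_prod (fun i _ => by positivity) fun i _ => h1 i
    _ = _ := by
        rw [Finset.prod_mul_distrib, Finset.prod_mul_distrib, Finset.prod_pow_eq_pow_sum]

/-! ### Seminorms in terms of lists of directions -/

/-- The multi-index of a list of directions. -/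
def cnt (l : List ι) : ι → ℕ := fun i => l.count i

@[simp] theorem cnt_nil : cnt ([] : List ι) = 0 := by ext i; simp [cnt]

theorem cnt_cons (i : ι) (l : List ι) : cnt (i :: l) = cnt l + Pi.single i 1 := by
  ext j
  by_cases h : i = j
  · subst h; simp [cnt]
  · simp [cnt, h, Ne.symm h]

theorem sum_cnt (l : List ι) : ∑ i, cnt l i = l.length := by
  induction l with
  | nil => simp
  | cons i l ih => simp [cnt_cons, Finset.sum_add_distrib, ih]

theorem card_filter_eq_cnt {k : ℕ} (m : Fin k → ι) (i : ι) :
    (Finset.univ.filter (fun j => m j = i)).card = cnt (List.ofFn m) i := by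
  induction k with
  | zero => simp
  | succ k ih =>
    rw [Fin.card_filter_univ_succ, List.ofFn_succ, cnt_cons, Pi.add_apply, ← ih (fun j => m j.succ)]
    by_cases h : m 0 = i
    · simp [h]
    · simp [h, Ne.symm h]

/-- The Gelfand-Shilov bounds may be verified on any family of iterated derivatives. -/
theorem hasBound_of_family {𝒢 : List ι → EuclideanSpace ℝ ι → ℂ} (hG : IsDerivFamily 𝒢)
    {s σ : ι → ℝ} {h C : ℝ}
    (hb : ∀ (α : ι → ℕ) (l : List ι) (X : EuclideanSpace ℝ ι), |∏ i, X i ^ α i| * ‖𝒢 l X‖ ≤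
      C * h ^ ((∑ i, α i) + l.length) * (facPow s α * facPow σ (cnt l))) :
    HasBound s σ h C (𝒢 []) := by
  refine ⟨hG.contDiff [], fun α k m X => ?_⟩
  rw [hG.iteratedFDeriv, List.append_nil]
  refine (hb α (List.ofFn m) X).trans (le_of_eq ?_)
  rw [facPow, facPow, ← Finset.prod_mul_distrib, List.length_ofFn]
  congr 1
  refine Finset.prod_congr rfl fun i _ => ?_
  rw [card_filter_eq_cnt]

theorem isDerivFamily_derivs (F : Sch ι) : IsDerivFamily fun l => (derivs l F : Sch ι) :=
  fun l X => hasFDerivAt_sch (derivs l F) X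

/-- For a Schwartz function, smoothness is automatic, and the bounds are stated for `derivs`. -/
theorem hasBound_iff {F : Sch ι} {s σ : ι → ℝ} {h C : ℝ} :
    HasBound s σ h C F ↔ ∀ (α : ι → ℕ) (l : List ι) (X : EuclideanSpace ℝ ι),
      |∏ i, X i ^ α i| * ‖derivs l F X‖ ≤
        C * h ^ ((∑ i, α i) + l.length) * (facPow s α * facPow σ (cnt l)) := by
  refine ⟨fun hF α l X => ?_, fun hb => hasBound_of_family (isDerivFamily_derivs F) hb⟩
  obtain ⟨k, m, rfl⟩ : ∃ (k : ℕ) (m : Fin k → ι), l = List.ofFn m :=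
    ⟨l.length, l.get, (List.ofFn_get l).symm⟩
  have := hF.2 α k m X
  rw [← derivs_ofFn] at this
  refine this.trans (le_of_eq ?_)
  rw [facPow, facPow, ← Finset.prod_mul_distrib, List.length_ofFn]
  congr 1
  refine Finset.prod_congr rfl fun i _ => ?_
  rw [card_filter_eq_cnt]

theorem HasBound.exists_sch {s σ : ι → ℝ} {h C : ℝ} {F : EuclideanSpace ℝ ι → ℂ}
    (hF : HasBound s σ h C F) : ∃ G : Sch ι, ⇑G = F :=
  GelfandShilov.exists_sch hF.1 fun α k m => ⟨_, fun X => hF.2 α k m X⟩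

theorem HasBound.mono_exp {s σ s' σ' : ι → ℝ} {h C : ℝ} {F : EuclideanSpace ℝ ι → ℂ}
    (hF : HasBound s σ h C F) (h0 : 0 < h) (hs : ∀ i, s i ≤ s' i) (hσ : ∀ i, σ i ≤ σ' i) :
    HasBound s' σ' h C F := by
  refine ⟨hF.1, fun α k m X => (hF.2 α k m X).trans ?_⟩
  have hC := hF.nonneg
  gcongr with i
  · exact one_le_factorial _
  · exact hs i
  · exact one_le_factorial _
  · exact hσ i

theorem HasBound.const_smul {s σ : ι → ℝ} {h C : ℝ} {F : Sch ι}
    (hF : HasBound s σ h C F) (c : ℂ) : HasBound s σ h (‖c‖ * C) (c • F : Sch ι) := by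
  rw [hasBound_iff] at hF ⊢
  intro α l X
  have := mul_le_mul_of_nonneg_left (hF α l X) (norm_nonneg c)
  rw [derivs_smul, smul_apply, norm_smul]
  calc _ = ‖c‖ * (|∏ i, X i ^ α i| * ‖derivs l F X‖) := by ring
    _ ≤ _ := this
    _ = _ := by ring

theorem HasBound.add {s σ : ι → ℝ} {h C C' : ℝ} {F G : Sch ι}
    (hF : HasBound s σ h C F) (hG : HasBound s σ h C' G) :
    HasBound s σ h (C + C') (F + G : Sch ι) := by
  rw [hasBound_iff] at hF hG ⊢
  intro α l X
  rw [derivs_add, add_apply, add_mul, add_mul]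
  refine (mul_le_mul_of_nonneg_left (norm_add_le _ _) (abs_nonneg _)).trans ?_
  rw [mul_add]
  exact add_le_add (hF α l X) (hG α l X)

/-- In the definition of the test space one may take `h ≥ 1`. -/
theorem exists_hasBound_one_le {s σ : ι → ℝ} {F : EuclideanSpace ℝ ι → ℂ}
    (hF : F ∈ testSpace s σ) : ∃ h C : ℝ, 1 ≤ h ∧ HasBound s σ h C F := by
  obtain ⟨h, C, h0, hF⟩ := hF
  exact ⟨max h 1, C, le_max_right _ _, hF.mono h0 (le_max_left _ _)⟩

theorem testSpace_mono {s σ s' σ' : ι → ℝ} (hs : ∀ i, s i ≤ s' i) (hσ : ∀ i, σ i ≤ σ' i) :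
    testSpace s σ ≤ testSpace s' σ' := by
  rintro F ⟨h, C, h0, hF⟩
  exact ⟨h, C, h0, hF.mono_exp h0 hs hσ⟩

/-- The seminorms absorb every power of `1 + ‖X‖`, at the cost of a larger step. -/
theorem shift_bound {s : ι → ℝ} (hs : ∀ i, 0 ≤ s i) (h : ℝ) (hh : 1 ≤ h) (r : ℕ) :
    ∃ K H : ℝ, 0 < K ∧ 1 ≤ H ∧ ∀ (σ : ι → ℝ) (F : Sch ι) (C : ℝ), HasBound s σ h C F →
      ∀ (α : ι → ℕ) (l : List ι) (X : EuclideanSpace ℝ ι),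
        (1 + ‖X‖) ^ r * (|∏ i, X i ^ α i| * ‖derivs l F X‖) ≤
          K * C * H ^ ((∑ i, α i) + l.length) * (facPow s α * facPow σ (cnt l)) := by
  obtain ⟨M, hM, hMX⟩ := one_add_norm_pow_le (ι := ι) r
  set B : ℝ := (2 : ℝ) ^ (∑ i, s i) with hB
  have hB1 : 1 ≤ B := Real.one_le_rpow (by norm_num) (Finset.sum_nonneg fun i _ => hs i)
  refine ⟨M * (1 + ∑ i : ι, (h * B) ^ r * facPow s (Pi.single i r)), h * B, ?_, ?_, ?_⟩
  · have : 0 ≤ ∑ i : ι, (h * B) ^ r * facPow s (Pi.single i r) :=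
      Finset.sum_nonneg fun i _ => mul_nonneg (by positivity) (facPow_pos _ _).le
    positivity
  · nlinarith
  intro σ F C hF α l X
  have hC : 0 ≤ C := hF.nonneg
  rw [hasBound_iff] at hF
  set W := (facPow s α * facPow σ (cnt l)) with hW
  have hW0 : 0 < W := mul_pos (facPow_pos _ _) (facPow_pos _ _)
  have h1 : |∏ i, X i ^ α i| * ‖derivs l F X‖ ≤ C * (h * B) ^ ((∑ i, α i) + l.length) * W := by
    refine (hF α l X).trans ?_
    gcongr
    nlinarith
  -- a factor `|X i| ^ r` is an additional monomial of order `r`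
  have h2 : ∀ i, |X i| ^ r * (|∏ i, X i ^ α i| * ‖derivs l F X‖) ≤
      (h * B) ^ r * facPow s (Pi.single i r) * (C * (h * B) ^ ((∑ i, α i) + l.length) * W) := by
    intro i
    have e1 : |X i| ^ r * |∏ j, X j ^ α j| = |∏ j, X j ^ (α + Pi.single i r : ι → ℕ) j| := by
      simp only [Pi.add_apply, pow_add, Finset.prod_mul_distrib, abs_mul]
      rw [mul_comm]
      congr 1
      rw [Finset.prod_eq_single i]
      · simp
      · intro j _ hj; simp [hj]
      · simp
    have e2 : ∑ j, (α + Pi.single i r : ι → ℕ) j = (∑ j, α j) + r := by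
      simp [Finset.sum_add_distrib]
    have e3 := hF (α + Pi.single i r) l X
    rw [← e1, e2] at e3
    rw [← mul_assoc]
    refine e3.trans ?_
    have e4 := facPow_add_le hs α (Pi.single i r)
    have e5 : ∑ j, (α j + (Pi.single i r : ι → ℕ) j) = (∑ j, α j) + r := e2
    rw [← hB, e5] at e4
    calc C * h ^ ((∑ j, α j) + r + l.length) * (facPow s (α + Pi.single i r) * facPow σ (cnt l))
        ≤ C * h ^ ((∑ j, α j) + r + l.length) *
          (B ^ ((∑ j, α j) + r + l.length) * (facPow s α * facPow s (Pi.single i r))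
            * facPow σ (cnt l)) := by
          have := facPow_pos σ (cnt l)
          have := facPow_pos s α
          have := facPow_pos s (Pi.single i r)
          gcongr
          refine e4.trans (mul_le_mul_of_nonneg_right ?_ (by positivity))
          exact pow_le_pow_right₀ hB1 (Nat.le_add_right _ _)
      _ = _ := by rw [hW, mul_pow, mul_pow]; ring
  calc (1 + ‖X‖) ^ r * (|∏ i, X i ^ α i| * ‖derivs l F X‖)
      ≤ (M * (1 + ∑ i, |X i| ^ r)) * (|∏ i, X i ^ α i| * ‖derivs l F X‖) := by
        gcongr
        exact hMX X
    _ = M * (|∏ i, X i ^ α i| * ‖derivs l F X‖ +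
        ∑ i, |X i| ^ r * (|∏ i, X i ^ α i| * ‖derivs l F X‖)) := by
        rw [mul_assoc, add_mul, one_mul, Finset.sum_mul]
    _ ≤ M * (C * (h * B) ^ ((∑ i, α i) + l.length) * W + ∑ i : ι,
        (h * B) ^ r * facPow s (Pi.single i r) * (C * (h * B) ^ ((∑ i, α i) + l.length) * W)) := by
        refine mul_le_mul_of_nonneg_left (add_le_add h1 (Finset.sum_le_sum fun i _ => h2 i)) hM.le
    _ = _ := by rw [← Finset.sum_mul]; ring

/-! ### Words in the multiplication and differentiation operators -/

/-- The operator attached to a letter: `inl i` is multiplication by the coordinate `i`, and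
`inr i` is the partial derivative in the direction `i`. -/
noncomputable def op : ι ⊕ ι → Sch ι →L[ℂ] Sch ι := Sum.elim coordMul pderiv

/-- The operator attached to a word; the head of the list acts first. -/
noncomputable def word (w : List (ι ⊕ ι)) (F : Sch ι) : Sch ι := w.foldl (fun G o => op o G) F

@[simp] theorem word_nil (F : Sch ι) : word [] F = F := rfl

theorem word_cons (o : ι ⊕ ι) (w : List (ι ⊕ ι)) (F : Sch ι) :
    word (o :: w) F = word w (op o F) := rfl

theorem word_append (w w' : List (ι ⊕ ι)) (F : Sch ι) :
    word (w ++ w') F = word w' (word w F) := by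
  simp [word, List.foldl_append]

theorem word_add (w : List (ι ⊕ ι)) (F G : Sch ι) : word w (F + G) = word w F + word w G := by
  induction w generalizing F G with
  | nil => rfl
  | cons o w ih => rw [word_cons, word_cons, word_cons, map_add, ih]

theorem word_smul (w : List (ι ⊕ ι)) (c : ℂ) (F : Sch ι) : word w (c • F) = c • word w F := by
  induction w generalizing F with
  | nil => rfl
  | cons o w ih => rw [word_cons, word_cons, map_smul, ih]

/-- The exponents of the coordinates in a word. -/
def mulCnt (w : List (ι ⊕ ι)) : ι → ℕ := fun i => w.countP (fun o => decide (o = Sum.inl i))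

/-- The orders of the partial derivatives in a word. -/
def derCnt (w : List (ι ⊕ ι)) : ι → ℕ := fun i => w.countP (fun o => decide (o = Sum.inr i))

@[simp] theorem mulCnt_nil : mulCnt ([] : List (ι ⊕ ι)) = 0 := by ext i; simp [mulCnt]

@[simp] theorem derCnt_nil : derCnt ([] : List (ι ⊕ ι)) = 0 := by ext i; simp [derCnt]

theorem mulCnt_cons_inl (i : ι) (w : List (ι ⊕ ι)) :
    mulCnt (Sum.inl i :: w) = mulCnt w + Pi.single i 1 := by
  ext j
  by_cases h : i = j
  · subst h; simp [mulCnt]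
  · simp [mulCnt, h, Ne.symm h]

theorem mulCnt_cons_inr (i : ι) (w : List (ι ⊕ ι)) : mulCnt (Sum.inr i :: w) = mulCnt w := by
  ext j; simp [mulCnt]

theorem derCnt_cons_inl (i : ι) (w : List (ι ⊕ ι)) : derCnt (Sum.inl i :: w) = derCnt w := by
  ext j; simp [derCnt]

theorem derCnt_cons_inr (i : ι) (w : List (ι ⊕ ι)) :
    derCnt (Sum.inr i :: w) = derCnt w + Pi.single i 1 := by
  ext j
  by_cases h : i = j
  · subst h; simp [derCnt]
  · simp [derCnt, h, Ne.symm h]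

theorem mulCnt_append (w w' : List (ι ⊕ ι)) : mulCnt (w ++ w') = mulCnt w + mulCnt w' := by
  ext j; simp [mulCnt]

theorem derCnt_append (w w' : List (ι ⊕ ι)) : derCnt (w ++ w') = derCnt w + derCnt w' := by
  ext j; simp [derCnt]

theorem sum_mulCnt_add_derCnt (w : List (ι ⊕ ι)) :
    ∑ i, (mulCnt w i + derCnt w i) = w.length := by
  induction w with
  | nil => simp
  | cons o w ih =>
    rcases o with i | i
    · rw [mulCnt_cons_inl, derCnt_cons_inl, List.length_cons, ← ih]
      simp only [Pi.add_apply, Finset.sum_add_distrib, Finset.sum_pi_single', Finset.mem_univ,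
        if_true]
      omega
    · rw [mulCnt_cons_inr, derCnt_cons_inr, List.length_cons, ← ih]
      simp only [Pi.add_apply, Finset.sum_add_distrib, Finset.sum_pi_single', Finset.mem_univ,
        if_true]
      omega

/-- Multiplication by the coordinates of the list `p`. -/
noncomputable def muls (p : List ι) (F : Sch ι) : Sch ι := p.foldr (fun i G => coordMul i G) F

@[simp] theorem muls_nil (F : Sch ι) : muls [] F = F := rfl

theorem muls_cons (i : ι) (p : List ι) (F : Sch ι) :
    muls (i :: p) F = coordMul i (muls p F) := rfl

theorem muls_apply (p : List ι) (F : Sch ι) (X : EuclideanSpace ℝ ι) :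
    muls p F X = ((∏ i, X i ^ cnt p i : ℝ) : ℂ) * F X := by
  induction p with
  | nil => simp
  | cons j p ih =>
    rw [muls_cons, coordMul_apply, ih, cnt_cons]
    simp only [Pi.add_apply, pow_add, Finset.prod_mul_distrib]
    rw [Finset.prod_eq_single (f := fun i => X i ^ (Pi.single j 1 : ι → ℕ) i) j]
    · simp; ring
    · intro b _ hb; simp [hb]
    · simp

theorem pderiv_muls (i : ι) (p : List ι) (F : Sch ι) :
    pderiv i (muls p F) = ((cnt p i : ℕ) : ℂ) • muls (p.erase i) F + muls p (pderiv i F) := by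
  induction p with
  | nil => simp
  | cons j p ih =>
    rw [muls_cons, pderiv_coordMul, ih, map_add, map_smul, muls_cons, ← add_assoc]
    congr 1
    by_cases hij : i = j
    · subst hij
      rw [if_pos rfl, List.erase_cons_head, cnt_cons]
      have : ((cnt p i : ℕ) : ℂ) • coordMul i (muls (p.erase i) F)
          = ((cnt p i : ℕ) : ℂ) • muls p F := by
        by_cases hp : i ∈ p
        · congr 1
          ext X
          rw [← muls_cons, muls_apply, muls_apply]
          have h2 : cnt (i :: p.erase i) = cnt p :=
            funext fun j => ((List.perm_cons_erase hp).count_eq j).symm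
          rw [h2]
        · have : cnt p i = 0 := List.count_eq_zero_of_not_mem hp
          simp [this]
      rw [this]
      ext X
      simp
      ring
    · rw [if_neg hij, zero_add, cnt_cons, List.erase_cons_tail (by simpa using Ne.symm hij),
        muls_cons]
      simp [hij]

/-- The weight `∏ (A i)! ^ (s i - σ i) * (A i + N i)! ^ (σ i)`.  It is comparable with
`∏ (A i)! ^ (s i) * (N i)! ^ (σ i)`, and unlike the latter it absorbs, without a constant, the
factor that arises when a multiplication and a derivative in the same direction are commuted. -/
noncomputable def commWeight (s σ : ι → ℝ) (A N : ι → ℕ) : ℝ :=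
  facPow (fun i => s i - σ i) A * facPow σ (A + N)

theorem commWeight_pos (s σ : ι → ℝ) (A N : ι → ℕ) : 0 < commWeight s σ A N :=
  mul_pos (facPow_pos _ _) (facPow_pos _ _)

theorem le_commWeight {s σ : ι → ℝ} (hσ : ∀ i, 0 ≤ σ i) (A N : ι → ℕ) :
    facPow s A * facPow σ N ≤ commWeight s σ A N := by
  have h1 : facPow s A = facPow (fun i => s i - σ i) A * facPow σ A := by
    unfold facPow
    rw [← Finset.prod_mul_distrib]
    refine Finset.prod_congr rfl fun i _ => ?_
    rw [← Real.rpow_add (by exact_mod_cast Nat.factorial_pos _)]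
    simp
  rw [h1, mul_assoc, commWeight]
  exact mul_le_mul_of_nonneg_left (facPow_mul_le hσ A N) (facPow_pos _ _).le

theorem commWeight_le {s σ : ι → ℝ} (hσ : ∀ i, 0 ≤ σ i) (A N : ι → ℕ) :
    commWeight s σ A N ≤
      ((2 : ℝ) ^ (∑ i, σ i)) ^ (∑ i, (A i + N i)) * (facPow s A * facPow σ N) := by
  have h1 : facPow s A = facPow (fun i => s i - σ i) A * facPow σ A := by
    unfold facPow
    rw [← Finset.prod_mul_distrib]
    refine Finset.prod_congr rfl fun i _ => ?_
    rw [← Real.rpow_add (by exact_mod_cast Nat.factorial_pos _)]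
    simp
  have := mul_le_mul_of_nonneg_left (facPow_add_le hσ A N)
    (facPow_pos (fun i => s i - σ i) A).le
  rw [commWeight]
  refine this.trans (le_of_eq ?_)
  rw [h1]
  ring

/-- Raising both `a` and `n` by one multiplies `a! ^ (s - σ)` by `(a + 1) ^ (s - σ)`, and
`(a + n)! ^ σ` by at least `(a + 1) ^ (2 σ)`; the product is at least `a + 1`, as `s + σ ≥ 1`. -/
theorem succ_mul_commFactor_le {s σ : ℝ} (hσ : 0 ≤ σ) (hsσ : 1 ≤ s + σ) (a n : ℕ) :
    ((a + 1 : ℕ) : ℝ) * ((a.factorial : ℝ) ^ (s - σ) * ((a + n).factorial : ℝ) ^ σ) ≤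
      ((a + 1).factorial : ℝ) ^ (s - σ) * ((a + 1 + (n + 1)).factorial : ℝ) ^ σ := by
  have ha : (1 : ℝ) ≤ ((a + 1 : ℕ) : ℝ) := by exact_mod_cast Nat.succ_le_succ (Nat.zero_le a)
  have ha0 : (0 : ℝ) < ((a + 1 : ℕ) : ℝ) := by linarith
  have h1 : (((a + 1 : ℕ) : ℝ) * ((a + 1 : ℕ) : ℝ)) * ((a + n).factorial : ℝ) ≤
      ((a + 1 + (n + 1)).factorial : ℝ) := by
    have : (a + 1 + (n + 1)).factorial = (a + n + 2) * ((a + n + 1) * (a + n).factorial) := by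
      rw [show a + 1 + (n + 1) = (a + n + 1) + 1 by ring, Nat.factorial_succ, Nat.factorial_succ]
    rw [this]
    have h : (a + 1) * (a + 1) * (a + n).factorial ≤
        (a + n + 2) * ((a + n + 1) * (a + n).factorial) := by
      rw [← mul_assoc]
      gcongr <;> omega
    exact_mod_cast h
  have h2 : ((a + 1 : ℕ) : ℝ) ^ σ * ((a + 1 : ℕ) : ℝ) ^ σ * ((a + n).factorial : ℝ) ^ σ ≤
      ((a + 1 + (n + 1)).factorial : ℝ) ^ σ := by
    rw [← Real.mul_rpow ha0.le ha0.le, ← Real.mul_rpow (by positivity) (by positivity)]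
    exact Real.rpow_le_rpow (by positivity) h1 hσ
  have h3 : ((a + 1).factorial : ℝ) ^ (s - σ) =
      ((a + 1 : ℕ) : ℝ) ^ (s - σ) * (a.factorial : ℝ) ^ (s - σ) := by
    rw [Nat.factorial_succ, Nat.cast_mul, Real.mul_rpow (by positivity) (by positivity)]
  have h4 : ((a + 1 : ℕ) : ℝ) ≤ ((a + 1 : ℕ) : ℝ) ^ (s - σ) *
      (((a + 1 : ℕ) : ℝ) ^ σ * ((a + 1 : ℕ) : ℝ) ^ σ) := by
    rw [← Real.rpow_add ha0, ← Real.rpow_add ha0]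
    calc ((a + 1 : ℕ) : ℝ) = ((a + 1 : ℕ) : ℝ) ^ (1 : ℝ) := (Real.rpow_one _).symm
      _ ≤ _ := Real.rpow_le_rpow_of_exponent_le ha (by linarith)
  calc ((a + 1 : ℕ) : ℝ) * ((a.factorial : ℝ) ^ (s - σ) * ((a + n).factorial : ℝ) ^ σ)
      ≤ (((a + 1 : ℕ) : ℝ) ^ (s - σ) * (((a + 1 : ℕ) : ℝ) ^ σ * ((a + 1 : ℕ) : ℝ) ^ σ)) *
        ((a.factorial : ℝ) ^ (s - σ) * ((a + n).factorial : ℝ) ^ σ) := by gcongr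
    _ = ((a + 1 : ℕ) : ℝ) ^ (s - σ) * (a.factorial : ℝ) ^ (s - σ) *
        (((a + 1 : ℕ) : ℝ) ^ σ * ((a + 1 : ℕ) : ℝ) ^ σ * ((a + n).factorial : ℝ) ^ σ) := by ring
    _ ≤ _ := by
      rw [h3]
      gcongr

theorem succ_mul_commWeight_le {s σ : ι → ℝ} (hσ : ∀ i, 0 ≤ σ i) (hsσ : ∀ i, 1 ≤ s i + σ i)
    (A N : ι → ℕ) (i : ι) : ((A i + 1 : ℕ) : ℝ) * commWeight s σ A N ≤
      commWeight s σ (A + Pi.single i 1) (N + Pi.single i 1) := by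
  unfold commWeight facPow
  rw [← Finset.prod_mul_distrib, ← Finset.prod_mul_distrib,
    ← Finset.mul_prod_erase _ _ (Finset.mem_univ i), ← mul_assoc,
    ← Finset.mul_prod_erase _ _ (Finset.mem_univ i)]
  refine mul_le_mul ?_ (le_of_eq ?_) (Finset.prod_nonneg fun _ _ => by positivity) (by positivity)
  · simpa using succ_mul_commFactor_le (hσ i) (hsσ i) (A i) (N i)
  · refine Finset.prod_congr rfl fun j hj => ?_
    have : j ≠ i := Finset.ne_of_mem_erase hj
    simp [this]

/-- The induction that moves the letters of `w` to the normal form "monomial times derivative": a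
multiplication joins the monomial, and a derivative either passes it or removes one of its
factors.  Each letter makes at most two terms, whence the factor `2 ^ w.length`. -/
theorem word_muls_derivs_bound {s σ : ι → ℝ} (hσ : ∀ i, 0 ≤ σ i) (hsσ : ∀ i, 1 ≤ s i + σ i)
    {h C : ℝ} (hh : 1 ≤ h) {F : Sch ι} (hF : HasBound s σ h C F) (w : List (ι ⊕ ι))
    (p l : List ι) (X : EuclideanSpace ℝ ι) :
    ‖word w (muls p (derivs l F)) X‖ ≤ C * 2 ^ w.length * h ^ (p.length + l.length + w.length) *
      commWeight s σ (cnt p + mulCnt w) (cnt l + derCnt w) := by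
  have hC : 0 ≤ C := hF.nonneg
  induction w generalizing p l with
  | nil =>
    have h1 := hasBound_iff.1 hF (cnt p) l X
    rw [sum_cnt] at h1
    rw [word_nil, muls_apply, norm_mul, Complex.norm_real, Real.norm_eq_abs]
    refine h1.trans ?_
    simp only [List.length_nil, pow_zero, mul_one, add_zero, mulCnt_nil, derCnt_nil]
    gcongr
    exact le_commWeight hσ _ _
  | cons o w ih =>
    rcases o with i | i
    · have h1 := ih (i :: p) l
      rw [word_cons]
      refine h1.trans ?_
      rw [mulCnt_cons_inl, derCnt_cons_inl, cnt_cons, List.length_cons, List.length_cons]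
      have e1 : cnt p + Pi.single i 1 + mulCnt w = cnt p + (mulCnt w + Pi.single i 1) := by abel
      have e2 : p.length + 1 + l.length + w.length = p.length + l.length + (w.length + 1) := by ring
      rw [e1, e2]
      have := commWeight_pos s σ (cnt p + (mulCnt w + Pi.single i 1)) (cnt l + derCnt w)
      gcongr
      · norm_num
      · omega
    · have e0 : op (Sum.inr i) (muls p (derivs l F)) =
          ((cnt p i : ℕ) : ℂ) • muls (p.erase i) (derivs l F) + muls p (derivs (i :: l) F) :=
        pderiv_muls i p (derivs l F)
      rw [word_cons, e0, word_add, word_smul, add_apply, smul_apply]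
      refine (norm_add_le _ _).trans ?_
      set R := C * 2 ^ w.length * h ^ (p.length + l.length + (w.length + 1)) *
        commWeight s σ (cnt p + mulCnt w) (cnt l + (derCnt w + Pi.single i 1)) with hR
      -- the term in which the derivative passes the monomial
      have hR2 : ‖word w (muls p (derivs (i :: l) F)) X‖ ≤ R := by
        refine (ih p (i :: l)).trans (le_of_eq ?_)
        rw [cnt_cons, List.length_cons, hR]
        have e1 : cnt l + Pi.single i 1 + derCnt w = cnt l + (derCnt w + Pi.single i 1) := by abel
        have e2 : p.length + (l.length + 1) + w.length = p.length + l.length + (w.length + 1) := by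
          ring
        rw [e1, e2]
      -- the commutator term, with one factor `X i` less
      have hR1 : ‖((cnt p i : ℕ) : ℂ) • word w (muls (p.erase i) (derivs l F)) X‖ ≤ R := by
        rw [norm_smul, Complex.norm_natCast]
        by_cases hp : i ∈ p
        · have e3 : cnt p = cnt (p.erase i) + Pi.single i 1 := by
            rw [← cnt_cons]
            exact funext fun j => (List.perm_cons_erase hp).count_eq j
          set q := p.erase i with hq
          have e4 : p.length = q.length + 1 := by
            rw [hq, List.length_erase_of_mem hp]
            have := List.length_pos_of_mem hp
            omega
          have e5 : (cnt p i : ℝ) ≤ (((cnt q + mulCnt w) i + 1 : ℕ) : ℝ) := by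
            rw [e3]
            simp
          have e6 := succ_mul_commWeight_le hσ hsσ (cnt q + mulCnt w) (cnt l + derCnt w) i
          have e7 : cnt p + mulCnt w = cnt q + mulCnt w + Pi.single i 1 := by rw [e3]; abel
          have e8 : cnt l + (derCnt w + Pi.single i 1) = cnt l + derCnt w + Pi.single i 1 := by abel
          have e9 := commWeight_pos s σ (cnt q + mulCnt w) (cnt l + derCnt w)
          calc (cnt p i : ℝ) * ‖word w (muls q (derivs l F)) X‖
              ≤ (((cnt q + mulCnt w) i + 1 : ℕ) : ℝ) * (C * 2 ^ w.length *
                h ^ (q.length + l.length + w.length) *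
                commWeight s σ (cnt q + mulCnt w) (cnt l + derCnt w)) := by
                gcongr
                exact ih q l
            _ = C * 2 ^ w.length * h ^ (q.length + l.length + w.length) *
                ((((cnt q + mulCnt w) i + 1 : ℕ) : ℝ) *
                commWeight s σ (cnt q + mulCnt w) (cnt l + derCnt w)) := by ring
            _ ≤ R := by
                rw [hR, e7, e8]
                refine mul_le_mul ?_ e6 (by positivity) (by positivity)
                refine mul_le_mul_of_nonneg_left ?_ (by positivity)
                exact pow_le_pow_right₀ hh (by omega)
        · have : cnt p i = 0 := List.count_eq_zero_of_not_mem hp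
          rw [this, Nat.cast_zero, zero_mul]
          have := commWeight_pos s σ (cnt p + mulCnt w) (cnt l + (derCnt w + Pi.single i 1))
          positivity
      refine (add_le_add hR1 hR2).trans (le_of_eq ?_)
      rw [hR, mulCnt_cons_inr, derCnt_cons_inr, List.length_cons, pow_succ]
      ring

/-- All words in the multiplications and derivatives obey the Gelfand-Shilov bounds, whatever
the order of the letters.  This uses `s + σ ≥ 1`. -/
theorem word_bound {s σ : ι → ℝ} (hσ : ∀ i, 0 ≤ σ i) (hsσ : ∀ i, 1 ≤ s i + σ i)
    {h C : ℝ} (hh : 1 ≤ h) {F : Sch ι} (hF : HasBound s σ h C F) (w : List (ι ⊕ ι))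
    (X : EuclideanSpace ℝ ι) :
    ‖word w F X‖ ≤ C * (2 * h * (2 : ℝ) ^ (∑ i, σ i)) ^ w.length *
      (facPow s (mulCnt w) * facPow σ (derCnt w)) := by
  have h1 := word_muls_derivs_bound hσ hsσ hh hF w [] [] X
  have hC : 0 ≤ C := hF.nonneg
  simp only [muls_nil, derivs_nil, List.length_nil, zero_add, cnt_nil] at h1
  have h2 := commWeight_le (s := s) hσ (mulCnt w) (derCnt w)
  rw [sum_mulCnt_add_derCnt] at h2
  refine h1.trans ((mul_le_mul_of_nonneg_left h2 (by positivity)).trans (le_of_eq ?_))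
  rw [mul_pow, mul_pow]
  ring

/-! ### Integrability from decay -/

section Decay

variable {V : Type*} [NormedAddCommGroup V] [NormedSpace ℝ V] [FiniteDimensional ℝ V]
  [MeasurableSpace V] [BorelSpace V] (μ : Measure V) [μ.IsAddHaarMeasure]

theorem integrable_decay :
    Integrable (fun v : V => ((1 + ‖v‖) ^ (Module.finrank ℝ V + 1))⁻¹) μ := by
  have h := integrable_one_add_norm (E := V) (μ := μ) (r := ((Module.finrank ℝ V + 1 : ℕ) : ℝ))
    (by push_cast; linarith)
  refine h.congr (Filter.Eventually.of_forall fun v => ?_)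
  simp only
  rw [Real.rpow_neg (by positivity), Real.rpow_natCast]

theorem integrable_of_decay {W : Type*} [NormedAddCommGroup W] {f : V → W}
    (hf : AEStronglyMeasurable f μ) {D : ℝ}
    (hD : ∀ v, (1 + ‖v‖) ^ (Module.finrank ℝ V + 1) * ‖f v‖ ≤ D) : Integrable f μ := by
  refine ((integrable_decay μ).const_mul D).mono' hf (Filter.Eventually.of_forall fun v => ?_)
  rw [← div_eq_mul_inv, le_div_iff₀ (by positivity), mul_comm]
  exact hD v

theorem norm_integral_le_of_decay {W : Type*} [NormedAddCommGroup W] [NormedSpace ℝ W] {f : V → W}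
    {D : ℝ} (hD : ∀ v, (1 + ‖v‖) ^ (Module.finrank ℝ V + 1) * ‖f v‖ ≤ D) :
    ‖∫ v, f v ∂μ‖ ≤ D * ∫ v, ((1 + ‖v‖) ^ (Module.finrank ℝ V + 1))⁻¹ ∂μ := by
  rw [← integral_const_mul]
  refine norm_integral_le_of_norm_le ((integrable_decay μ).const_mul D)
    (Filter.Eventually.of_forall fun v => ?_)
  rw [← div_eq_mul_inv, le_div_iff₀ (by positivity), mul_comm]
  exact hD v

end Decay

theorem exists_decay (F : Sch ι) (r : ℕ) :
    ∃ D : ℝ, 0 ≤ D ∧ ∀ X, (1 + ‖X‖) ^ r * ‖F X‖ ≤ D := by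
  have h := fun X => SchwartzMap.one_add_le_sup_seminorm_apply (𝕜 := ℝ) (m := (r, 0)) le_rfl le_rfl
    F X
  simp only [norm_iteratedFDeriv_zero] at h
  exact ⟨_, (by positivity : (0 : ℝ) ≤ (1 + ‖(0 : EuclideanSpace ℝ ι)‖) ^ r * ‖F 0‖).trans (h 0), h⟩

/-! ### Partial Fourier transforms -/

/-- The coordinates of `Y` along `e`. -/
noncomputable def res (e : κ → ι) : EuclideanSpace ℝ ι →L[ℝ] EuclideanSpace ℝ κ :=
  LinearMap.toContinuousLinearMap
    { toFun := fun Y => WithLp.toLp 2 fun k => Y (e k)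
      map_add' := fun _ _ => rfl
      map_smul' := fun _ _ => rfl }

@[simp] theorem res_apply (e : κ → ι) (Y : EuclideanSpace ℝ ι) (k : κ) : res e Y k = Y (e k) := rfl

/-- The vector with coordinates `v` along `e`, and `0` elsewhere. -/
noncomputable def emb (e : κ → ι) : EuclideanSpace ℝ κ →L[ℝ] EuclideanSpace ℝ ι :=
  ∑ k, (EuclideanSpace.proj k : EuclideanSpace ℝ κ →L[ℝ] ℝ).smulRight
    (EuclideanSpace.single (e k) (1 : ℝ))

theorem emb_apply_self {e : κ → ι} (he : Function.Injective e) (v : EuclideanSpace ℝ κ) (k : κ) :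
    emb e v (e k) = v k := by
  simp [emb, Pi.single_apply, he.eq_iff]

theorem emb_apply_of_notMem {e : κ → ι} (v : EuclideanSpace ℝ κ) {i : ι} (hi : i ∉ Set.range e) :
    emb e v i = 0 := by
  have : ∀ k, i ≠ e k := fun k h => hi ⟨k, h.symm⟩
  simp [emb, this]

/-- Replace the coordinates of `Y` along `e` by `v`. -/
noncomputable def upd (e : κ → ι) (Y : EuclideanSpace ℝ ι) (v : EuclideanSpace ℝ κ) :
    EuclideanSpace ℝ ι := Y - emb e (res e Y) + emb e v

theorem upd_apply_self {e : κ → ι} (he : Function.Injective e) (Y : EuclideanSpace ℝ ι)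
    (v : EuclideanSpace ℝ κ) (k : κ) : upd e Y v (e k) = v k := by
  simp [upd, emb_apply_self he]

theorem upd_apply_of_notMem {e : κ → ι} (Y : EuclideanSpace ℝ ι) (v : EuclideanSpace ℝ κ) {i : ι}
    (hi : i ∉ Set.range e) : upd e Y v i = Y i := by
  simp [upd, emb_apply_of_notMem _ hi]

theorem res_upd {e : κ → ι} (he : Function.Injective e) (Y : EuclideanSpace ℝ ι)
    (v : EuclideanSpace ℝ κ) : res e (upd e Y v) = v := by
  ext k; simp [upd_apply_self he]

theorem upd_upd {e : κ → ι} (he : Function.Injective e) (Y : EuclideanSpace ℝ ι)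
    (v w : EuclideanSpace ℝ κ) : upd e (upd e Y v) w = upd e Y w := by
  rw [upd, res_upd he]; simp [upd]

theorem upd_res (e : κ → ι) (Y : EuclideanSpace ℝ ι) : upd e Y (res e Y) = Y := by
  simp [upd]

theorem one_add_norm_le_upd {e : κ → ι} (he : Function.Injective e) (Y : EuclideanSpace ℝ ι)
    (v : EuclideanSpace ℝ κ) : 1 + ‖v‖ ≤ (1 + ‖res e‖) * (1 + ‖upd e Y v‖) := by
  have h := (res e).le_opNorm (upd e Y v)
  rw [res_upd he] at h
  nlinarith [norm_nonneg (res e), norm_nonneg (upd e Y v)]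

/-- The integrand of the partial Fourier transform, with the kernel `exp (i ⟨v, η⟩)` (no factor
`2π`, positive sign) that occurs in `kernelTranspose`. -/
noncomputable def pfIntegrand (e : κ → ι) (G : Sch ι) (Y : EuclideanSpace ℝ ι)
    (v : EuclideanSpace ℝ κ) : ℂ :=
  Complex.exp (Complex.I * ((inner ℝ v (res e Y) : ℝ) : ℂ)) * G (upd e Y v)

/-- The partial Fourier transform along the coordinates `e`, as a function: the coordinates of `Y`
along `e` are the frequencies. -/
noncomputable def pf (e : κ → ι) (G : Sch ι) (Y : EuclideanSpace ℝ ι) : ℂ :=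
  ∫ v, pfIntegrand e G Y v

theorem norm_exp_I_mul (t : ℝ) : ‖Complex.exp (Complex.I * (t : ℂ))‖ = 1 := by
  rw [mul_comm, Complex.norm_exp_ofReal_mul_I]

theorem continuous_pfIntegrand (e : κ → ι) (G : Sch ι) (Y : EuclideanSpace ℝ ι) :
    Continuous (pfIntegrand e G Y) := by
  unfold pfIntegrand upd
  have := G.continuous
  fun_prop

/-- The decay of a Schwartz function is inherited by the integrand, uniformly in `Y`. -/
theorem pfIntegrand_decay {e : κ → ι} (he : Function.Injective e) (G : Sch ι) {r : ℕ} {D : ℝ}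
    (hD : ∀ X, (1 + ‖X‖) ^ r * ‖G X‖ ≤ D) (Y : EuclideanSpace ℝ ι) (v : EuclideanSpace ℝ κ) :
    (1 + ‖v‖) ^ r * ‖pfIntegrand e G Y v‖ ≤ (1 + ‖res e‖) ^ r * D := by
  rw [pfIntegrand, norm_mul, norm_exp_I_mul, one_mul]
  calc (1 + ‖v‖) ^ r * ‖G (upd e Y v)‖
      ≤ ((1 + ‖res e‖) * (1 + ‖upd e Y v‖)) ^ r * ‖G (upd e Y v)‖ := by
        gcongr
        exact one_add_norm_le_upd he Y v
    _ = (1 + ‖res e‖) ^ r * ((1 + ‖upd e Y v‖) ^ r * ‖G (upd e Y v)‖) := by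
        rw [mul_pow]; ring
    _ ≤ _ := by
        gcongr
        exact hD _

theorem integrable_pfIntegrand {e : κ → ι} (he : Function.Injective e) (G : Sch ι)
    (Y : EuclideanSpace ℝ ι) : Integrable (pfIntegrand e G Y) := by
  obtain ⟨D, -, hD⟩ := exists_decay G (Module.finrank ℝ (EuclideanSpace ℝ κ) + 1)
  exact integrable_of_decay volume (continuous_pfIntegrand e G Y).aestronglyMeasurable
    (pfIntegrand_decay he G hD Y)

theorem exists_norm_pf_le {e : κ → ι} (he : Function.Injective e) :
    ∃ K : ℝ, 0 ≤ K ∧ ∀ (G : Sch ι) (D : ℝ),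
      (∀ X, (1 + ‖X‖) ^ (Module.finrank ℝ (EuclideanSpace ℝ κ) + 1) * ‖G X‖ ≤ D) →
        ∀ Y, ‖pf e G Y‖ ≤ K * D := by
  refine ⟨(1 + ‖res e‖) ^ (Module.finrank ℝ (EuclideanSpace ℝ κ) + 1) *
    ∫ v : EuclideanSpace ℝ κ, ((1 + ‖v‖) ^ (Module.finrank ℝ (EuclideanSpace ℝ κ) + 1))⁻¹,
    ?_, fun G D hD Y => ?_⟩
  · have : 0 ≤ ∫ v : EuclideanSpace ℝ κ,
        ((1 + ‖v‖) ^ (Module.finrank ℝ (EuclideanSpace ℝ κ) + 1))⁻¹ :=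
      integral_nonneg fun v => by positivity
    positivity
  · refine (norm_integral_le_of_decay volume (pfIntegrand_decay he G hD Y)).trans (le_of_eq ?_)
    ring

open Classical in
/-- The letter that corresponds to `o` under the partial Fourier transform along `e`. -/
noncomputable def swapLetter (e : κ → ι) : ι ⊕ ι → ι ⊕ ι :=
  Sum.elim (fun i => if i ∈ Set.range e then Sum.inr i else Sum.inl i)
    (fun i => if i ∈ Set.range e then Sum.inl i else Sum.inr i)

open Classical in
/-- The factor `i` that accompanies the exchange of multiplication and differentiation. -/
noncomputable def swapPhase (e : κ → ι) (o : ι ⊕ ι) : ℂ :=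
  if Sum.elim id id o ∈ Set.range e then Complex.I else 1

theorem norm_swapPhase (e : κ → ι) (o : ι ⊕ ι) : ‖swapPhase e o‖ = 1 := by
  unfold swapPhase; split_ifs <;> simp

/-- The operator that corresponds to `op o` under the partial Fourier transform along `e`. -/
noncomputable def conjOp (e : κ → ι) (o : ι ⊕ ι) (G : Sch ι) : Sch ι :=
  swapPhase e o • op (swapLetter e o) G

theorem hasFDerivAt_pfIntegrand {e : κ → ι} (he : Function.Injective e) (G : Sch ι)
    (Y : EuclideanSpace ℝ ι) (v : EuclideanSpace ℝ κ) :
    HasFDerivAt (fun Y => pfIntegrand e G Y v)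
      (∑ i, (EuclideanSpace.proj i : EuclideanSpace ℝ ι →L[ℝ] ℝ).smulRight
        (pfIntegrand e (conjOp e (Sum.inr i) G) Y v)) Y := by
  have h1 : HasFDerivAt (fun Y : EuclideanSpace ℝ ι => ((inner ℝ v (res e Y) : ℝ) : ℂ))
      (Complex.ofRealCLM.comp ((innerSL ℝ v).comp (res e))) Y :=
    (Complex.ofRealCLM.comp ((innerSL ℝ v).comp (res e))).hasFDerivAt
  have h2 := (h1.const_mul Complex.I).cexp
  have h3 : HasFDerivAt (fun Y => upd e Y v)
      (ContinuousLinearMap.id ℝ _ - (emb e).comp (res e)) Y :=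
    ((ContinuousLinearMap.id ℝ _ - (emb e).comp (res e)).hasFDerivAt).add_const _
  have h4 := (G.hasFDerivAt (upd e Y v)).comp Y h3
  have h5 := h2.mul h4
  rw [clm_eq_sum_proj (_ + _)] at h5
  refine h5.congr_fderiv ?_
  refine Finset.sum_congr rfl fun i _ => ?_
  congr 1
  by_cases hi : i ∈ Set.range e
  · obtain ⟨k, rfl⟩ := hi
    have e1 : res e (EuclideanSpace.single (e k) (1 : ℝ)) = EuclideanSpace.single k 1 := by
      ext j; simp [he.eq_iff]
    have e2 : emb e (EuclideanSpace.single k (1 : ℝ)) = EuclideanSpace.single (e k) 1 := by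
      simp [emb]
    simp [e1, e2, pfIntegrand, conjOp, swapPhase, swapLetter, op, upd_apply_self he,
      EuclideanSpace.inner_single_right]
    ring
  · have e1 : res e (EuclideanSpace.single i (1 : ℝ)) = 0 := by
      ext j
      have : i ≠ e j := fun h => hi ⟨j, h.symm⟩
      simp [this.symm]
    simp only [Set.mem_range] at hi
    simp [e1, pfIntegrand, conjOp, swapPhase, swapLetter, op, pderiv_apply, hi]

/-- The linear map that sends `c` to the `ℂ`-valued linear form `X ↦ X i * c`. -/
noncomputable def coordForm (i : ι) : ℂ →L[ℝ] (EuclideanSpace ℝ ι →L[ℝ] ℂ) :=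
  ContinuousLinearMap.smulRightL ℝ (EuclideanSpace ℝ ι) ℂ
    (EuclideanSpace.proj i : EuclideanSpace ℝ ι →L[ℝ] ℝ)

theorem norm_sum_coordForm_le {e : κ → ι} (he : Function.Injective e) (G : ι → Sch ι) {r : ℕ}
    {D : ι → ℝ} (hD : ∀ i X, (1 + ‖X‖) ^ r * ‖G i X‖ ≤ D i) (Y : EuclideanSpace ℝ ι)
    (v : EuclideanSpace ℝ κ) :
    ‖∑ i, coordForm i (pfIntegrand e (G i) Y v)‖ ≤
      (∑ i, ‖(coordForm i : ℂ →L[ℝ] (EuclideanSpace ℝ ι →L[ℝ] ℂ))‖ *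
        ((1 + ‖res e‖) ^ r * D i)) * ((1 + ‖v‖) ^ r)⁻¹ := by
  refine (norm_sum_le _ _).trans ?_
  rw [Finset.sum_mul]
  refine Finset.sum_le_sum fun i _ => ?_
  refine ((coordForm i).le_opNorm _).trans ?_
  rw [mul_assoc]
  refine mul_le_mul_of_nonneg_left ?_ (norm_nonneg _)
  rw [← div_eq_mul_inv, le_div_iff₀ (by positivity), mul_comm]
  exact pfIntegrand_decay he _ (hD i) Y v

theorem hasFDerivAt_pf {e : κ → ι} (he : Function.Injective e) (G : Sch ι)
    (Y : EuclideanSpace ℝ ι) :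
    HasFDerivAt (pf e G) (∑ i, (EuclideanSpace.proj i : EuclideanSpace ℝ ι →L[ℝ] ℝ).smulRight
      (pf e (conjOp e (Sum.inr i) G) Y)) Y := by
  have hint : ∀ i, Integrable (fun v =>
      coordForm i (pfIntegrand e (conjOp e (Sum.inr i) G) Y v)) := fun i =>
    (coordForm i).integrable_comp (integrable_pfIntegrand he _ Y)
  have e1 : (∑ i, coordForm i (pf e (conjOp e (Sum.inr i) G) Y)) =
      ∫ v, ∑ i, coordForm i (pfIntegrand e (conjOp e (Sum.inr i) G) Y v) := by
    rw [integral_finsetSum _ fun i _ => hint i]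
    refine Finset.sum_congr rfl fun i _ => ?_
    exact ((coordForm i).integral_comp_comm (integrable_pfIntegrand he _ Y)).symm
  change HasFDerivAt (pf e G) (∑ i, coordForm i (pf e (conjOp e (Sum.inr i) G) Y)) Y
  rw [e1]
  choose D hD0 hD using fun i => exists_decay (conjOp e (Sum.inr i) G)
    (Module.finrank ℝ (EuclideanSpace ℝ κ) + 1)
  have hcont : Continuous (fun v =>
      ∑ i, coordForm i (pfIntegrand e (conjOp e (Sum.inr i) G) Y v)) :=
    continuous_finsetSum _ fun i _ =>
      (coordForm i).continuous.comp (continuous_pfIntegrand e _ Y)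
  exact hasFDerivAt_integral_of_dominated_of_fderiv_le (s := Set.univ) Filter.univ_mem
    (Filter.Eventually.of_forall fun Y => (continuous_pfIntegrand e G Y).aestronglyMeasurable)
    (integrable_pfIntegrand he G Y) hcont.aestronglyMeasurable
    (Filter.Eventually.of_forall fun v Y _ => norm_sum_coordForm_le he _ hD Y v)
    ((integrable_decay volume).const_mul _)
    (Filter.Eventually.of_forall fun v Y _ => hasFDerivAt_pfIntegrand he G Y v)

/-- For a coordinate along `e`, this is integration by parts. -/
theorem coord_mul_pf {e : κ → ι} (he : Function.Injective e) (G : Sch ι) (i : ι)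
    (Y : EuclideanSpace ℝ ι) : (Y i : ℂ) * pf e G Y = pf e (conjOp e (Sum.inl i) G) Y := by
  by_cases hi : i ∈ Set.range e
  · obtain ⟨k, rfl⟩ := hi
    -- integration by parts in the variable `v k`
    set f : EuclideanSpace ℝ κ → ℂ :=
      fun v => Complex.exp (Complex.I * ((inner ℝ v (res e Y) : ℝ) : ℂ)) with hf
    set g : EuclideanSpace ℝ κ → ℂ := fun v => G (upd e Y v) with hg
    have hfd : ∀ v, HasFDerivAt f (Complex.exp (Complex.I * ((inner ℝ v (res e Y) : ℝ) : ℂ)) •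
        (Complex.I • (Complex.ofRealCLM.comp (innerSL ℝ (res e Y))))) v := by
      intro v
      have h1 : HasFDerivAt (fun v : EuclideanSpace ℝ κ => ((inner ℝ v (res e Y) : ℝ) : ℂ))
          (Complex.ofRealCLM.comp (innerSL ℝ (res e Y))) v := by
        have := (Complex.ofRealCLM.comp (innerSL ℝ (res e Y))).hasFDerivAt (x := v)
        refine this.congr_of_eventuallyEq (Filter.Eventually.of_forall fun w => ?_)
        simp [real_inner_comm]
      exact (h1.const_mul Complex.I).cexp
    have hgd : ∀ v, HasFDerivAt g ((fderiv ℝ G (upd e Y v)).comp (emb e)) v := by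
      intro v
      have h3 : HasFDerivAt (fun v => upd e Y v) (emb e) v := ((emb e).hasFDerivAt).const_add _
      exact (G.hasFDerivAt (upd e Y v)).comp v h3
    have e2 : emb e (EuclideanSpace.single k (1 : ℝ)) = EuclideanSpace.single (e k) 1 := by
      simp [emb]
    have hf1 : ∀ v, fderiv ℝ f v (EuclideanSpace.single k 1) * g v =
        (Complex.I * Y (e k)) * pfIntegrand e G Y v := by
      intro v
      rw [(hfd v).fderiv]
      simp [pfIntegrand, hg, EuclideanSpace.inner_single_right]
      ring
    have hg1 : ∀ v, f v * fderiv ℝ g v (EuclideanSpace.single k 1) =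
        pfIntegrand e (pderiv (e k) G) Y v := by
      intro v
      rw [(hgd v).fderiv]
      simp [pfIntegrand, hf, e2, pderiv_apply]
    have key := integral_mul_fderiv_eq_neg_fderiv_mul_of_integrable (𝕜 := ℂ)
      (μ := (volume : Measure (EuclideanSpace ℝ κ))) (f := f) (g := g)
      (v := EuclideanSpace.single k 1)
      (by simp_rw [hf1]; exact (integrable_pfIntegrand he G Y).const_mul _)
      (by simp_rw [hg1]; exact integrable_pfIntegrand he _ Y)
      (integrable_pfIntegrand he G Y) (fun v _ => (hfd v).differentiableAt)
      (fun v _ => (hgd v).differentiableAt)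
    simp_rw [hf1, hg1] at key
    rw [integral_const_mul] at key
    have e3 : conjOp e (Sum.inl (e k)) G = Complex.I • pderiv (e k) G := by
      simp [conjOp, swapPhase, swapLetter, op]
    have e4 : pf e (Complex.I • pderiv (e k) G) Y =
        Complex.I * ∫ v, pfIntegrand e (pderiv (e k) G) Y v := by
      rw [pf, ← integral_const_mul]
      congr 1
      ext v
      simp [pfIntegrand]
      ring
    rw [e3, e4, key, pf]
    linear_combination ((Y (e k) : ℂ) * ∫ v, pfIntegrand e G Y v) * Complex.I_mul_I
  · rw [pf, pf, ← integral_const_mul]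
    congr 1
    ext v
    have := upd_apply_of_notMem Y v hi
    simp only [Set.mem_range] at hi
    simp [pfIntegrand, conjOp, swapPhase, swapLetter, op, hi, this]
    ring

theorem isDerivFamily_pf {e : κ → ι} (he : Function.Injective e) (G : Sch ι) :
    IsDerivFamily fun l => pf e (l.foldr (fun i H => conjOp e (Sum.inr i) H) G) :=
  fun _ Y => hasFDerivAt_pf he _ Y

theorem exists_monomial_mul_pf {e : κ → ι} (he : Function.Injective e) (α : ι → ℕ) (G : Sch ι) :
    ∃ H : Sch ι, ∀ Y, ((∏ i, Y i ^ α i : ℝ) : ℂ) * pf e G Y = pf e H Y := by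
  have key : ∀ s : Finset ι, ∃ H : Sch ι,
      ∀ Y, ((∏ i ∈ s, Y i ^ α i : ℝ) : ℂ) * pf e G Y = pf e H Y := by
    intro s
    induction s using Finset.induction_on with
    | empty => exact ⟨G, fun Y => by simp⟩
    | insert a s ha ih =>
      obtain ⟨H, hH⟩ := ih
      have pw : ∀ n : ℕ, ∃ H' : Sch ι, ∀ Y, (Y a : ℂ) ^ n * pf e H Y = pf e H' Y := by
        intro n
        induction n with
        | zero => exact ⟨H, fun Y => by simp⟩
        | succ n ih =>
          obtain ⟨H', hH'⟩ := ih
          exact ⟨conjOp e (Sum.inl a) H', fun Y => by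
            rw [← coord_mul_pf he, ← hH', pow_succ]; ring⟩
      obtain ⟨H', hH'⟩ := pw (α a)
      refine ⟨H', fun Y => ?_⟩
      rw [← hH', ← hH, Finset.prod_insert ha]
      push_cast
      ring
  exact key Finset.univ

/-- The partial Fourier transform of a Schwartz function is a Schwartz function: its derivatives,
multiplied by monomials, are partial Fourier transforms and therefore bounded. -/
theorem exists_partialFourier {e : κ → ι} (he : Function.Injective e) (G : Sch ι) :
    ∃ H : Sch ι, ⇑H = pf e G := by
  have hfam := isDerivFamily_pf he G
  refine exists_sch (hfam.contDiff []) fun α k m => ?_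
  obtain ⟨K, -, hK⟩ := exists_norm_pf_le he
  set G' := (List.ofFn m).foldr (fun i H => conjOp e (Sum.inr i) H) G with hG'
  obtain ⟨H, hH⟩ := exists_monomial_mul_pf he α G'
  obtain ⟨D, -, hD⟩ := exists_decay H (Module.finrank ℝ (EuclideanSpace ℝ κ) + 1)
  refine ⟨K * D, fun X => ?_⟩
  have h1 := hfam.iteratedFDeriv m [] X
  simp only [List.foldr_nil] at h1
  rw [h1, List.append_nil, ← Real.norm_eq_abs, ← Complex.norm_real,
    ← norm_mul, ← hG', hH]
  exact hK H D hD X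

/-- The partial Fourier transform along the coordinates `e`, on Schwartz functions. -/
noncomputable def partialFourier {e : κ → ι} (he : Function.Injective e) (G : Sch ι) : Sch ι :=
  (exists_partialFourier he G).choose

theorem partialFourier_apply {e : κ → ι} (he : Function.Injective e) (G : Sch ι)
    (Y : EuclideanSpace ℝ ι) : partialFourier he G Y = pf e G Y :=
  congrFun (exists_partialFourier he G).choose_spec Y

/-- Multiplication by a coordinate along `e` becomes a derivative and conversely, up to the
factor `i`; the other letters are not changed. -/
theorem op_partialFourier {e : κ → ι} (he : Function.Injective e) (o : ι ⊕ ι) (G : Sch ι) :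
    op o (partialFourier he G) = partialFourier he (conjOp e o G) := by
  ext Y
  rcases o with i | i
  · rw [partialFourier_apply, ← coord_mul_pf he, ← partialFourier_apply he]
    exact coordMul_apply i _ Y
  · have h : HasFDerivAt (partialFourier he G)
        (∑ i, (EuclideanSpace.proj i : EuclideanSpace ℝ ι →L[ℝ] ℝ).smulRight
          (pf e (conjOp e (Sum.inr i) G) Y)) Y := by
      have := hasFDerivAt_pf he G Y
      rwa [← (exists_partialFourier he G).choose_spec] at this
    rw [partialFourier_apply]
    refine (pderiv_eq_of_hasFDerivAt h i).trans ?_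
    simp

theorem pf_smul (e : κ → ι) (c : ℂ) (G : Sch ι) (Y : EuclideanSpace ℝ ι) :
    pf e (c • G) Y = c * pf e G Y := by
  rw [pf, pf, ← integral_const_mul]
  congr 1
  ext v
  simp [pfIntegrand]
  ring

/-! ### Partial Fourier transforms of test functions -/

/-- The sign convention of `pf` makes both exchanges `∂ ↦ i x` and `x ↦ i ∂` carry the same
unimodular factor, which disappears in the norm. -/
theorem norm_word_partialFourier {e : κ → ι} (he : Function.Injective e) (w : List (ι ⊕ ι))
    (G : Sch ι) (Y : EuclideanSpace ℝ ι) : ‖word w (partialFourier he G) Y‖ =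
      ‖pf e (word (w.map (swapLetter e)) G) Y‖ := by
  induction w generalizing G with
  | nil => rw [word_nil, List.map_nil, word_nil, partialFourier_apply]
  | cons o w ih =>
    rw [word_cons, op_partialFourier, ih, List.map_cons, word_cons, conjOp, word_smul, pf_smul,
      norm_mul, norm_swapPhase, one_mul]

open Classical in
/-- The exponents `s`, replaced by `σ` along `e`. -/
noncomputable def swapExp {M : Type} (e : κ → ι) (s σ : ι → M) : ι → M :=
  fun i => if i ∈ Set.range e then σ i else s i

theorem mulCnt_map_swap (e : κ → ι) (w : List (ι ⊕ ι)) :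
    mulCnt (w.map (swapLetter e)) = swapExp e (mulCnt w) (derCnt w) := by
  induction w with
  | nil => ext i; simp [swapExp]
  | cons o w ih =>
    rcases o with i | i <;> by_cases hi : i ∈ Set.range e
    · have : swapLetter e (Sum.inl i) = Sum.inr i := by
        simp only [swapLetter, Sum.elim_inl, if_pos hi]
      rw [List.map_cons, this, mulCnt_cons_inr, ih, mulCnt_cons_inl, derCnt_cons_inl]
      ext j
      by_cases hj : j ∈ Set.range e
      · simp only [swapExp, if_pos hj]
      · have : j ≠ i := fun h => hj (h ▸ hi)
        simp only [swapExp, if_neg hj, Pi.add_apply, Pi.single_eq_of_ne this, add_zero]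
    · have : swapLetter e (Sum.inl i) = Sum.inl i := by
        simp only [swapLetter, Sum.elim_inl, if_neg hi]
      rw [List.map_cons, this, mulCnt_cons_inl, ih, mulCnt_cons_inl, derCnt_cons_inl]
      ext j
      by_cases hj : j ∈ Set.range e
      · have : j ≠ i := fun h => hi (h ▸ hj)
        simp only [swapExp, if_pos hj, Pi.add_apply, Pi.single_eq_of_ne this, add_zero]
      · simp only [swapExp, if_neg hj, Pi.add_apply]
    · have : swapLetter e (Sum.inr i) = Sum.inl i := by
        simp only [swapLetter, Sum.elim_inr, if_pos hi]
      rw [List.map_cons, this, mulCnt_cons_inl, ih, mulCnt_cons_inr, derCnt_cons_inr]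
      ext j
      by_cases hj : j ∈ Set.range e
      · simp only [swapExp, if_pos hj, Pi.add_apply]
      · have : j ≠ i := fun h => hj (h ▸ hi)
        simp only [swapExp, if_neg hj, Pi.add_apply, Pi.single_eq_of_ne this, add_zero]
    · have : swapLetter e (Sum.inr i) = Sum.inr i := by
        simp only [swapLetter, Sum.elim_inr, if_neg hi]
      rw [List.map_cons, this, mulCnt_cons_inr, ih, mulCnt_cons_inr, derCnt_cons_inr]
      ext j
      by_cases hj : j ∈ Set.range e
      · have : j ≠ i := fun h => hi (h ▸ hj)
        simp only [swapExp, if_pos hj, Pi.add_apply, Pi.single_eq_of_ne this, add_zero]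
      · simp only [swapExp, if_neg hj]

theorem derCnt_eq_mulCnt (w : List (ι ⊕ ι)) : derCnt w = mulCnt (w.map Sum.swap) := by
  induction w with
  | nil => simp
  | cons o w ih =>
    rcases o with i | i
    · rw [derCnt_cons_inl, List.map_cons, Sum.swap_inl, mulCnt_cons_inr, ih]
    · rw [derCnt_cons_inr, List.map_cons, Sum.swap_inr, mulCnt_cons_inl, ih]

theorem mulCnt_eq_derCnt (w : List (ι ⊕ ι)) : mulCnt w = derCnt (w.map Sum.swap) := by
  rw [derCnt_eq_mulCnt, List.map_map]
  simp

theorem derCnt_map_swap (e : κ → ι) (w : List (ι ⊕ ι)) :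
    derCnt (w.map (swapLetter e)) = swapExp e (derCnt w) (mulCnt w) := by
  have h : (w.map (swapLetter e)).map Sum.swap = (w.map Sum.swap).map (swapLetter e) := by
    rw [List.map_map, List.map_map]
    congr 1
    ext o
    rcases o with i | i <;> by_cases hi : i ∈ Set.range e <;>
      simp only [Function.comp_apply, swapLetter, Sum.elim_inl, Sum.elim_inr, if_pos, if_neg, hi,
        Sum.swap_inl, Sum.swap_inr, not_false_eq_true]
  rw [derCnt_eq_mulCnt, h, mulCnt_map_swap, ← derCnt_eq_mulCnt, ← mulCnt_eq_derCnt]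

theorem facPow_swap (e : κ → ι) (s σ : ι → ℝ) (A N : ι → ℕ) :
    facPow s (swapExp e A N) * facPow σ (swapExp e N A) =
      facPow (swapExp e s σ) A * facPow (swapExp e σ s) N := by
  unfold facPow
  rw [← Finset.prod_mul_distrib, ← Finset.prod_mul_distrib]
  refine Finset.prod_congr rfl fun i _ => ?_
  by_cases hi : i ∈ Set.range e
  · simp only [swapExp, if_pos hi]; ring
  · simp only [swapExp, if_neg hi]

theorem mulCnt_replicate (r : ℕ) (i : ι) :
    mulCnt (List.replicate r (Sum.inl i : ι ⊕ ι)) = Pi.single i r := by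
  induction r with
  | zero => simp
  | succ r ih => rw [List.replicate_succ, mulCnt_cons_inl, ih, ← Pi.single_add]

theorem derCnt_replicate (r : ℕ) (i : ι) :
    derCnt (List.replicate r (Sum.inl i : ι ⊕ ι)) = 0 := by
  induction r with
  | zero => simp
  | succ r ih => rw [List.replicate_succ, derCnt_cons_inl, ih]

theorem word_replicate_apply (r : ℕ) (i : ι) (F : Sch ι) (X : EuclideanSpace ℝ ι) :
    word (List.replicate r (Sum.inl i)) F X = (X i : ℂ) ^ r * F X := by
  induction r generalizing F with
  | zero => simp
  | succ r ih =>
    rw [List.replicate_succ, word_cons, ih]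
    have : op (Sum.inl i) F X = X i * F X := coordMul_apply i F X
    rw [this, pow_succ]; ring

/-- Bounds for words with an additional power of `1 + ‖X‖`. -/
theorem word_shift_bound {s σ : ι → ℝ} (hs : ∀ i, 0 ≤ s i) (hσ : ∀ i, 0 ≤ σ i)
    (hsσ : ∀ i, 1 ≤ s i + σ i) {h : ℝ} (hh : 1 ≤ h) (r : ℕ) :
    ∃ K H : ℝ, 0 ≤ K ∧ 1 ≤ H ∧ ∀ (F : Sch ι) (C : ℝ), HasBound s σ h C F →
      ∀ (w : List (ι ⊕ ι)) (X : EuclideanSpace ℝ ι), (1 + ‖X‖) ^ r * ‖word w F X‖ ≤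
        K * C * H ^ w.length * (facPow s (mulCnt w) * facPow σ (derCnt w)) := by
  obtain ⟨M, hM, hMX⟩ := one_add_norm_pow_le (ι := ι) r
  set B : ℝ := (2 : ℝ) ^ (∑ i, s i) with hB
  have hB1 : 1 ≤ B := Real.one_le_rpow (by norm_num) (Finset.sum_nonneg fun i _ => hs i)
  set Q : ℝ := 2 * h * (2 : ℝ) ^ (∑ i, σ i) with hQ
  have hQ1 : 1 ≤ Q := by
    have : (1 : ℝ) ≤ (2 : ℝ) ^ (∑ i, σ i) :=
      Real.one_le_rpow (by norm_num) (Finset.sum_nonneg fun i _ => hσ i)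
    nlinarith
  have hQB : 1 ≤ Q * B := by nlinarith
  have hP : ∀ i : ι, 0 < facPow s (Pi.single i r) := fun i => facPow_pos _ _
  refine ⟨M * (1 + ∑ i : ι, (Q * B) ^ r * facPow s (Pi.single i r)), Q * B, ?_, hQB, ?_⟩
  · have : 0 ≤ ∑ i : ι, (Q * B) ^ r * facPow s (Pi.single i r) :=
      Finset.sum_nonneg fun i _ => mul_nonneg (by positivity) (hP i).le
    positivity
  intro F C hF w X
  have hC : 0 ≤ C := hF.nonneg
  set W := facPow s (mulCnt w) * facPow σ (derCnt w) with hW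
  have hW1 := facPow_pos s (mulCnt w)
  have hW2 := facPow_pos σ (derCnt w)
  have hW0 : 0 < W := mul_pos hW1 hW2
  have h1 : ‖word w F X‖ ≤ C * (Q * B) ^ w.length * W := by
    refine (word_bound hσ hsσ hh hF w X).trans ?_
    rw [← hQ]
    gcongr
    nlinarith
  have h2 : ∀ i, |X i| ^ r * ‖word w F X‖ ≤
      C * (Q * B) ^ r * facPow s (Pi.single i r) * ((Q * B) ^ w.length * W) := by
    intro i
    -- a factor `|X i| ^ r` is `r` additional letters
    have e1 := word_bound hσ hsσ hh hF (w ++ List.replicate r (Sum.inl i)) X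
    rw [word_append, word_replicate_apply, norm_mul, norm_pow, Complex.norm_real, Real.norm_eq_abs,
      mulCnt_append, derCnt_append, mulCnt_replicate, derCnt_replicate, add_zero,
      List.length_append, List.length_replicate, ← hQ] at e1
    refine e1.trans ?_
    have e2 := facPow_add_le hs (mulCnt w) (Pi.single i r)
    have e3 : ∑ j, (mulCnt w j + (Pi.single i r : ι → ℕ) j) ≤ w.length + r := by
      rw [Finset.sum_add_distrib, Finset.sum_pi_single', if_pos (Finset.mem_univ i)]
      have := sum_mulCnt_add_derCnt w
      rw [Finset.sum_add_distrib] at this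
      omega
    have e4 : facPow s (mulCnt w + Pi.single i r) ≤
        B ^ (w.length + r) * (facPow s (mulCnt w) * facPow s (Pi.single i r)) := by
      refine e2.trans ?_
      have := hP i
      exact mul_le_mul_of_nonneg_right (pow_le_pow_right₀ hB1 e3) (by positivity)
    calc C * Q ^ (w.length + r) * (facPow s (mulCnt w + Pi.single i r) * facPow σ (derCnt w))
        ≤ C * Q ^ (w.length + r) * (B ^ (w.length + r) *
          (facPow s (mulCnt w) * facPow s (Pi.single i r)) * facPow σ (derCnt w)) := by gcongr
      _ = _ := by rw [hW, mul_pow, mul_pow]; ring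
  calc (1 + ‖X‖) ^ r * ‖word w F X‖ ≤ (M * (1 + ∑ i, |X i| ^ r)) * ‖word w F X‖ := by
        gcongr
        exact hMX X
    _ = M * (‖word w F X‖ + ∑ i, |X i| ^ r * ‖word w F X‖) := by
        rw [mul_assoc, add_mul, one_mul, Finset.sum_mul]
    _ ≤ M * (C * (Q * B) ^ w.length * W + ∑ i : ι,
        C * (Q * B) ^ r * facPow s (Pi.single i r) * ((Q * B) ^ w.length * W)) :=
        mul_le_mul_of_nonneg_left (add_le_add h1 (Finset.sum_le_sum fun i _ => h2 i)) hM.le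
    _ = _ := by
        rw [← Finset.sum_mul]
        simp only [mul_assoc C, ← Finset.mul_sum]
        ring

theorem exists_cnt_eq (α : ι → ℕ) : ∃ p : List ι, cnt p = α := by
  refine ⟨(Finsupp.toMultiset (Finsupp.equivFunOnFinite.symm α)).toList, funext fun i => ?_⟩
  rw [cnt, ← Multiset.coe_count, Multiset.coe_toList, Finsupp.count_toMultiset]
  rfl

theorem word_map_inr (l : List ι) (F : Sch ι) :
    word (l.map Sum.inr) F = derivs l.reverse F := by
  induction l generalizing F with
  | nil => rfl
  | cons i l ih =>
    rw [List.map_cons, word_cons, ih, List.reverse_cons, derivs_append]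
    rfl

theorem word_map_inl (p : List ι) (F : Sch ι) :
    word (p.map Sum.inl) F = muls p.reverse F := by
  induction p generalizing F with
  | nil => rfl
  | cons i p ih =>
    rw [List.map_cons, word_cons, ih, List.reverse_cons, muls, muls, List.foldr_append]
    rfl

theorem mulCnt_map_inl (p : List ι) : mulCnt (p.map Sum.inl) = cnt p := by
  induction p with
  | nil => simp
  | cons i p ih => rw [List.map_cons, mulCnt_cons_inl, ih, cnt_cons]

theorem derCnt_map_inl (p : List ι) : derCnt (p.map Sum.inl) = 0 := by
  induction p with
  | nil => simp
  | cons i p ih => rw [List.map_cons, derCnt_cons_inl, ih]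

theorem mulCnt_map_inr (p : List ι) : mulCnt (p.map Sum.inr) = 0 := by
  rw [mulCnt_eq_derCnt, List.map_map]
  exact derCnt_map_inl p

theorem derCnt_map_inr (p : List ι) : derCnt (p.map Sum.inr) = cnt p := by
  rw [derCnt_eq_mulCnt, List.map_map]
  exact mulCnt_map_inl p

theorem cnt_reverse (l : List ι) : cnt l.reverse = cnt l := by
  ext i; simp [cnt]

/-- Bounds for all words imply the Gelfand-Shilov bounds. -/
theorem hasBound_of_word {s σ : ι → ℝ} {H C : ℝ} {G : Sch ι}
    (hG : ∀ (w : List (ι ⊕ ι)) (X : EuclideanSpace ℝ ι),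
      ‖word w G X‖ ≤ C * H ^ w.length * (facPow s (mulCnt w) * facPow σ (derCnt w))) :
    HasBound s σ H C G := by
  rw [hasBound_iff]
  intro α l X
  obtain ⟨p, rfl⟩ := exists_cnt_eq α
  have h := hG (l.reverse.map Sum.inr ++ p.reverse.map Sum.inl) X
  rw [word_append, word_map_inr, word_map_inl, List.reverse_reverse, List.reverse_reverse,
    muls_apply, norm_mul, Complex.norm_real, Real.norm_eq_abs, mulCnt_append, derCnt_append,
    mulCnt_map_inl, mulCnt_map_inr, derCnt_map_inl, derCnt_map_inr, cnt_reverse, cnt_reverse,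
    zero_add, add_zero] at h
  refine h.trans (le_of_eq ?_)
  rw [sum_cnt]
  simp [add_comm]

/-- The partial Fourier transform exchanges decay and regularity along `e`. -/
theorem partialFourier_bound {e : κ → ι} (he : Function.Injective e) {s σ : ι → ℝ}
    (hs : ∀ i, 0 ≤ s i) (hσ : ∀ i, 0 ≤ σ i) (hsσ : ∀ i, 1 ≤ s i + σ i) {h : ℝ} (hh : 1 ≤ h) :
    ∃ K H : ℝ, 1 ≤ H ∧ ∀ (G : Sch ι) (C : ℝ), HasBound s σ h C G →
      HasBound (swapExp e s σ) (swapExp e σ s) H (K * C) (partialFourier he G) := by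
  obtain ⟨K', hK', hpf⟩ := exists_norm_pf_le he
  obtain ⟨K, H, hK, hH, hb⟩ := word_shift_bound hs hσ hsσ hh
    (Module.finrank ℝ (EuclideanSpace ℝ κ) + 1)
  refine ⟨K' * K, H, hH, fun G C hG => hasBound_of_word fun w Y => ?_⟩
  rw [norm_word_partialFourier]
  have h := hpf (word (w.map (swapLetter e)) G) _ (hb G C hG (w.map (swapLetter e))) Y
  rw [mulCnt_map_swap, derCnt_map_swap, facPow_swap, List.length_map] at h
  refine h.trans (le_of_eq ?_)
  ring

theorem partialFourier_mem {e : κ → ι} (he : Function.Injective e) {s σ : ι → ℝ}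
    (hs : ∀ i, 0 ≤ s i) (hσ : ∀ i, 0 ≤ σ i) (hsσ : ∀ i, 1 ≤ s i + σ i) {G : Sch ι}
    (hG : (G : EuclideanSpace ℝ ι → ℂ) ∈ testSpace s σ) :
    (partialFourier he G : EuclideanSpace ℝ ι → ℂ) ∈
      testSpace (swapExp e s σ) (swapExp e σ s) := by
  obtain ⟨h, C, hh, hG⟩ := exists_hasBound_one_le hG
  obtain ⟨K, H, hH, hb⟩ := partialFourier_bound he hs hσ hsσ hh
  exact ⟨H, _, by linarith, hb G C hG⟩

/-! ### Fourier inversion along some of the coordinates -/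

/-- The restriction of a Schwartz function to a plane parallel to the coordinates `e`. -/
noncomputable def slice {e : κ → ι} (he : Function.Injective e) (Y : EuclideanSpace ℝ ι)
    (G : Sch ι) : Sch κ :=
  SchwartzMap.compCLMOfAntilipschitz ℂ (K := ‖res e‖₊) (g := upd e Y)
    ((Function.HasTemperateGrowth.const _).add (emb e).hasTemperateGrowth)
    ((res e).lipschitz.to_rightInverse fun v => res_upd he Y v) G

@[simp] theorem slice_apply {e : κ → ι} (he : Function.Injective e) (Y : EuclideanSpace ℝ ι)
    (G : Sch ι) (v : EuclideanSpace ℝ κ) : slice he Y G v = G (upd e Y v) := rfl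

/-- The comparison with the Fourier transform of Mathlib, which has `2π` in the exponent. -/
theorem pf_upd {e : κ → ι} (he : Function.Injective e) (Y : EuclideanSpace ℝ ι)
    (G : Sch ι) (v : EuclideanSpace ℝ κ) :
    pf e G (upd e Y v) = (𝓕⁻ (slice he Y G)) ((2 * Real.pi)⁻¹ • v) := by
  rw [SchwartzMap.fourierInv_coe, Real.fourierInv_eq']
  unfold pf
  congr 1
  ext w
  rw [pfIntegrand, upd_upd he, res_upd he, slice_apply, smul_eq_mul, inner_smul_right]
  congr 2
  rw [← mul_assoc, mul_inv_cancel₀ (by positivity), one_mul, mul_comm]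

/-- Fourier inversion along `e`. -/
theorem integral_exp_mul_pf_upd {e : κ → ι} (he : Function.Injective e) (Y : EuclideanSpace ℝ ι)
    (G : Sch ι) (η : EuclideanSpace ℝ κ) :
    ∫ v, Complex.exp (Complex.I * ((inner ℝ v η : ℝ) : ℂ)) * pf e G (upd e Y v) =
      ((2 * Real.pi) ^ Fintype.card κ : ℝ) * G (upd e Y (-η)) := by
  have h1 : ∀ v : EuclideanSpace ℝ κ,
      Complex.exp (Complex.I * ((inner ℝ v η : ℝ) : ℂ)) * pf e G (upd e Y v) =
      (fun u : EuclideanSpace ℝ κ => Complex.exp (Complex.I * ((2 * Real.pi * inner ℝ u η : ℝ) : ℂ)) *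
        (𝓕⁻ (slice he Y G)) u) ((2 * Real.pi)⁻¹ • v) := by
    intro v
    simp only [pf_upd he, inner_smul_left]
    congr 4
    simp only [conj_trivial]
    rw [← mul_assoc, mul_inv_cancel₀ (by positivity), one_mul]
  rw [integral_congr_ae (Filter.Eventually.of_forall h1)]
  refine (Measure.integral_comp_inv_smul_of_nonneg volume
    (fun u : EuclideanSpace ℝ κ => Complex.exp (Complex.I * ((2 * Real.pi * inner ℝ u η : ℝ) : ℂ)) *
        (𝓕⁻ (slice he Y G)) u) (R := 2 * Real.pi) (by positivity)).trans ?_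
  rw [finrank_euclideanSpace]
  have h2 : ∫ u : EuclideanSpace ℝ κ,
      Complex.exp (Complex.I * ((2 * Real.pi * inner ℝ u η : ℝ) : ℂ)) * (𝓕⁻ (slice he Y G)) u =
      𝓕⁻ (𝓕⁻ (slice he Y G)) η := by
    rw [SchwartzMap.fourierInv_coe (𝓕⁻ (slice he Y G)), Real.fourierInv_eq']
    congr 1
    ext u
    rw [smul_eq_mul, mul_comm Complex.I]
  have h3 : 𝓕⁻ (𝓕⁻ (slice he Y G)) η = slice he Y G (-η) := by
    have h : 𝓕 (𝓕⁻ (slice he Y G) : Sch κ) = slice he Y G :=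
      FourierTransform.fourier_fourierInv_eq _
    conv_rhs => rw [← h]
    rw [SchwartzMap.fourierInv_coe (𝓕⁻ (slice he Y G)), Real.fourierInv_eq_fourier_neg,
      SchwartzMap.fourier_coe]
  rw [h2, h3, slice_apply, Complex.real_smul]

theorem partialFourier_partialFourier {e : κ → ι} (he : Function.Injective e) (G : Sch ι)
    (Y : EuclideanSpace ℝ ι) : partialFourier he (partialFourier he G) Y =
      ((2 * Real.pi) ^ Fintype.card κ : ℝ) * G (upd e Y (-res e Y)) := by
  rw [← integral_exp_mul_pf_upd he, partialFourier_apply, pf]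
  congr 1
  ext v
  rw [pfIntegrand, partialFourier_apply]

/-! ### Linear changes of variables in integrals -/

/-- A linear change of variables multiplies all integrals by the same constant. -/
theorem exists_integral_comp_equiv {V W : Type*} [NormedAddCommGroup V] [NormedSpace ℝ V]
    [FiniteDimensional ℝ V] [MeasurableSpace V] [BorelSpace V] [NormedAddCommGroup W]
    [NormedSpace ℝ W] [FiniteDimensional ℝ W] [MeasurableSpace W] [BorelSpace W]
    (μ : Measure V) [μ.IsAddHaarMeasure] (ν : Measure W) [ν.IsAddHaarMeasure] (L : V ≃L[ℝ] W) :
    ∃ c : ℝ, 0 < c ∧ (∀ f : W → ℂ, ∫ x, f (L x) ∂μ = c * ∫ y, f y ∂ν) ∧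
      ∀ f : W → ℂ, Integrable f ν → Integrable (fun x => f (L x)) μ := by
  have hL : MeasurableEmbedding L := L.toHomeomorph.measurableEmbedding
  have hmap : (μ.map L).IsAddHaarMeasure := L.isAddHaarMeasure_map μ
  obtain ⟨c, hc, hs⟩ : ∃ c : NNReal, 0 < c ∧ μ.map L = c • ν :=
    ⟨_, Measure.addHaarScalarFactor_pos_of_isAddHaarMeasure (μ.map L) ν,
      Measure.isAddLeftInvariant_eq_smul (μ.map L) ν⟩
  refine ⟨c, ?_, fun f => ?_, fun f hf => ?_⟩
  · exact_mod_cast hc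
  · rw [← hL.integral_map, hs, integral_smul_nnreal_measure]
    rfl
  · have : Integrable f (μ.map L) := by
      rw [hs]
      exact hf.smul_measure_nnreal
    exact (hL.integrable_map_iff).1 this

/-! ### The transposed kernel map and the exponential multiplier -/

/-- The coordinates of the block with number `j`. -/
def blockIdx (d : ℕ) (j : Fin 3) : Fin d → Fin 3 × Fin d := fun k => (j, k)

theorem blockIdx_injective (j : Fin 3) : Function.Injective (blockIdx d j) :=
  fun _ _ h => (Prod.ext_iff.1 h).2

theorem res_blockIdx (j : Fin 3) (X : Vec3 d) : res (blockIdx d j) X = block X j := rfl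

@[simp] theorem block_triple_zero (x y z : Vec d) : block (triple x y z) 0 = x := rfl
@[simp] theorem block_triple_one (x y z : Vec d) : block (triple x y z) 1 = y := rfl
@[simp] theorem block_triple_two (x y z : Vec d) : block (triple x y z) 2 = z := rfl

theorem block_add (X Y : Vec3 d) (j : Fin 3) : block (X + Y) j = block X j + block Y j := rfl
theorem block_smul (c : ℝ) (X : Vec3 d) (j : Fin 3) : block (c • X) j = c • block X j := rfl

theorem ext_block {X Y : Vec3 d} (h0 : block X 0 = block Y 0) (h1 : block X 1 = block Y 1)
    (h2 : block X 2 = block Y 2) : X = Y := by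
  ext ⟨j, k⟩
  fin_cases j
  · exact congrArg (fun v : Vec d => v k) h0
  · exact congrArg (fun v : Vec d => v k) h1
  · exact congrArg (fun v : Vec d => v k) h2

@[simp] theorem triple_block (X : Vec3 d) : triple (block X 0) (block X 1) (block X 2) = X :=
  ext_block rfl rfl rfl

theorem triple_add (x y z x' y' z' : Vec d) :
    triple x y z + triple x' y' z' = triple (x + x') (y + y') (z + z') :=
  ext_block rfl rfl rfl

theorem triple_smul (c : ℝ) (x y z : Vec d) :
    c • triple x y z = triple (c • x) (c • y) (c • z) :=
  ext_block rfl rfl rfl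

theorem inner_eq_blocks (X Y : Vec3 d) : inner ℝ X Y =
    inner ℝ (block X 0) (block Y 0) + inner ℝ (block X 1) (block Y 1) +
      inner ℝ (block X 2) (block Y 2) := by
  simp only [PiLp.inner_apply, Fintype.sum_prod_type, Fin.sum_univ_three]
  rfl

theorem upd_blockIdx_one (X : Vec3 d) (v : Vec d) :
    upd (blockIdx d 1) X v = triple (block X 0) v (block X 2) := by
  ext ⟨j, k⟩
  by_cases hj : j = 1
  · subst hj
    exact upd_apply_self (blockIdx_injective 1) X v k
  · rw [upd_apply_of_notMem]
    · fin_cases j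
      · rfl
      · exact absurd rfl hj
      · rfl
    · rintro ⟨k', h⟩
      exact hj (Prod.ext_iff.1 h).1.symm

theorem upd_blockIdx_two (X : Vec3 d) (v : Vec d) :
    upd (blockIdx d 2) X v = triple (block X 0) (block X 1) v := by
  ext ⟨j, k⟩
  by_cases hj : j = 2
  · subst hj
    exact upd_apply_self (blockIdx_injective 2) X v k
  · rw [upd_apply_of_notMem]
    · fin_cases j
      · rfl
      · rfl
      · exact absurd rfl hj
    · rintro ⟨k', h⟩
      exact hj (Prod.ext_iff.1 h).1.symm

/-- The linear change of variables `(u, v, w) ↦ (x, x - v, x - w)` with `x = u + r v + t w`. -/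
noncomputable def shear (d : ℕ) (r t : ℝ) : Vec3 d ≃L[ℝ] Vec3 d :=
  LinearEquiv.toContinuousLinearEquiv
    { toFun := fun X => triple (block X 0 + r • block X 1 + t • block X 2)
        (block X 0 + r • block X 1 + t • block X 2 - block X 1)
        (block X 0 + r • block X 1 + t • block X 2 - block X 2)
      map_add' := fun X Y => by
        simp only [triple_add, block_add, smul_add]
        congr 1 <;> abel
      map_smul' := fun c X => by
        simp only [RingHom.id_apply, triple_smul, block_smul, smul_sub, smul_add,
          smul_comm c r, smul_comm c t]
      invFun := fun X => triple
        (block X 0 - r • (block X 0 - block X 1) - t • (block X 0 - block X 2))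
        (block X 0 - block X 1) (block X 0 - block X 2)
      left_inv := fun X => by
        refine ext_block ?_ ?_ ?_ <;>
          simp only [block_triple_zero, block_triple_one, block_triple_two, sub_sub_cancel]
        module
      right_inv := fun X => by
        refine ext_block ?_ ?_ ?_ <;>
          simp only [block_triple_zero, block_triple_one, block_triple_two] <;> module }

theorem shear_apply (r t : ℝ) (X : Vec3 d) : shear d r t X =
    triple (block X 0 + r • block X 1 + t • block X 2)
      (block X 0 + r • block X 1 + t • block X 2 - block X 1)
      (block X 0 + r • block X 1 + t • block X 2 - block X 2) := rfl

/-- The composition of a Schwartz function with a linear automorphism. -/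
noncomputable def compEquiv (L : EuclideanSpace ℝ ι ≃L[ℝ] EuclideanSpace ℝ ι) (F : Sch ι) :
    Sch ι :=
  SchwartzMap.compCLMOfContinuousLinearEquiv ℂ L F

@[simp] theorem compEquiv_apply (L : EuclideanSpace ℝ ι ≃L[ℝ] EuclideanSpace ℝ ι) (F : Sch ι)
    (X : EuclideanSpace ℝ ι) : compEquiv L F X = F (L X) := rfl

/-- The partial Fourier transform in the last two blocks. -/
noncomputable def pf₂ (G : Sch (Fin 3 × Fin d)) : Sch (Fin 3 × Fin d) :=
  partialFourier (blockIdx_injective 1) (partialFourier (blockIdx_injective 2) G)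

/-- The map `kernelTranspose r t` on Schwartz functions, as a composition of operators on
Schwartz functions. -/
noncomputable def wigner (r t : ℝ) (Φ : Sch (Fin 3 × Fin d)) : Sch (Fin 3 × Fin d) :=
  (((2 * Real.pi) ^ (2 * d) : ℝ) : ℂ)⁻¹ • pf₂ (compEquiv (shear d r t) Φ)

theorem coe_wigner (r t : ℝ) (Φ : Sch (Fin 3 × Fin d)) :
    ⇑(wigner r t Φ) = kernelTranspose r t Φ := by
  ext Y
  rw [wigner, smul_apply, smul_eq_mul, kernelTranspose, pf₂, partialFourier_apply, pf]
  congr 2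
  ext v
  rw [pfIntegrand, partialFourier_apply, pf, ← integral_const_mul]
  congr 1
  ext w
  rw [pfIntegrand, ← mul_assoc, ← Complex.exp_add, upd_blockIdx_one, upd_blockIdx_two,
    res_blockIdx, res_blockIdx, compEquiv_apply, shear_apply, Complex.ofReal_add, mul_add]
  rfl

theorem partialFourier_smul {e : κ → ι} (he : Function.Injective e) (c : ℂ) (G : Sch ι) :
    partialFourier he (c • G) = c • partialFourier he G := by
  ext Y
  rw [partialFourier_apply, smul_apply, partialFourier_apply, pf, pf, smul_eq_mul,
    ← integral_const_mul]
  congr 1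
  ext v
  simp only [pfIntegrand, smul_apply, smul_eq_mul]
  ring

/-- The reflection in the coordinates along `e`. -/
noncomputable def reflect {e : κ → ι} (he : Function.Injective e) :
    EuclideanSpace ℝ ι ≃L[ℝ] EuclideanSpace ℝ ι :=
  LinearEquiv.toContinuousLinearEquiv
    { toFun := fun Y => upd e Y (-res e Y)
      map_add' := fun X Y => by
        simp only [upd, map_add, map_neg]
        abel
      map_smul' := fun c X => by
        simp only [upd, map_smul, map_neg, RingHom.id_apply]
        module
      invFun := fun Y => upd e Y (-res e Y)
      left_inv := fun Y => by simp only [res_upd he, upd_upd he, neg_neg, upd_res]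
      right_inv := fun Y => by simp only [res_upd he, upd_upd he, neg_neg, upd_res] }

theorem partialFourier_surjective {e : κ → ι} (he : Function.Injective e) :
    Function.Surjective (partialFourier he) := by
  intro G
  refine ⟨(((2 * Real.pi) ^ Fintype.card κ : ℝ) : ℂ)⁻¹ •
    partialFourier he (compEquiv (reflect he) G), ?_⟩
  have h0 : (((2 * Real.pi) ^ Fintype.card κ : ℝ) : ℂ) ≠ 0 := by
    rw [Complex.ofReal_ne_zero]; positivity
  ext Y
  rw [partialFourier_smul, smul_apply, partialFourier_partialFourier, smul_eq_mul,
    inv_mul_cancel_left₀ h0, compEquiv_apply]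
  exact congrArg G ((reflect he).symm_apply_apply Y)

theorem compEquiv_surjective (L : EuclideanSpace ℝ ι ≃L[ℝ] EuclideanSpace ℝ ι) :
    Function.Surjective (compEquiv L) := fun G =>
  ⟨compEquiv L.symm G, by ext X; simp⟩

theorem wigner_surjective (r t : ℝ) : Function.Surjective (wigner (d := d) r t) := by
  intro G
  have h0 : (((2 * Real.pi) ^ (2 * d) : ℝ) : ℂ) ≠ 0 := by
    rw [Complex.ofReal_ne_zero]; positivity
  obtain ⟨G₁, h₁⟩ := partialFourier_surjective (blockIdx_injective 1)
    ((((2 * Real.pi) ^ (2 * d) : ℝ) : ℂ) • G)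
  obtain ⟨G₂, h₂⟩ := partialFourier_surjective (blockIdx_injective 2) G₁
  obtain ⟨Φ, h₃⟩ := compEquiv_surjective (shear d r t) G₂
  exact ⟨Φ, by rw [wigner, pf₂, h₃, h₂, h₁, inv_smul_smul₀ h0]⟩

/-- The identification `(u, η, ξ) ↦ (u, ξ, η)`.  The order of the factors is that of the iterated
integral in `exists_integral_triple`. -/
noncomputable def tripleEquiv (d : ℕ) : (Vec d × Vec d × Vec d) ≃L[ℝ] Vec3 d :=
  LinearEquiv.toContinuousLinearEquiv
    { toFun := fun p => triple p.1 p.2.2 p.2.1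
      map_add' := fun _ _ => (triple_add _ _ _ _ _ _).symm
      map_smul' := fun _ _ => (triple_smul _ _ _ _).symm
      invFun := fun X => (block X 0, block X 2, block X 1)
      left_inv := fun _ => rfl
      right_inv := fun X => triple_block X }

/-- Fubini's theorem for the three blocks, up to the constant that compares the Haar measures. -/
theorem exists_integral_triple (d : ℕ) : ∃ c : ℝ, 0 < c ∧ ∀ f : Vec3 d → ℂ, Integrable f →
    c * ∫ X, f X = ∫ u, ∫ η, ∫ ξ, f (triple u ξ η) := by
  have : ((volume : Measure (Vec d)).prod (volume : Measure (Vec d))).IsAddHaarMeasure :=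
    Measure.prod.instIsAddHaarMeasure _ _
  have : ((volume : Measure (Vec d)).prod
      ((volume : Measure (Vec d)).prod (volume : Measure (Vec d)))).IsAddHaarMeasure :=
    Measure.prod.instIsAddHaarMeasure _ _
  obtain ⟨c, hc, hint, hi⟩ := exists_integral_comp_equiv
    ((volume : Measure (Vec d)).prod ((volume : Measure (Vec d)).prod (volume : Measure (Vec d))))
    (volume : Measure (Vec3 d)) (tripleEquiv d)
  refine ⟨c, hc, fun f hf => ?_⟩
  have h := hi f hf
  rw [← hint, integral_prod _ h]
  refine integral_congr_ae ?_
  filter_upwards [h.prod_right_ae] with u hu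
  rw [integral_prod _ hu]
  rfl

theorem integral_exp_mul_pf₂ (G : Sch (Fin 3 × Fin d)) (u ξ η : Vec d) :
    ∫ y, ∫ x, Complex.exp (Complex.I * ((inner ℝ x ξ + inner ℝ y η : ℝ) : ℂ)) *
      pf₂ G (triple u x y) =
      ((2 * Real.pi) ^ (2 * d) : ℝ) * G (triple u (-ξ) (-η)) := by
  have h1 : ∀ y, ∫ x, Complex.exp (Complex.I * ((inner ℝ x ξ + inner ℝ y η : ℝ) : ℂ)) *
      pf₂ G (triple u x y) = ((2 * Real.pi) ^ d : ℝ) *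
        (Complex.exp (Complex.I * ((inner ℝ y η : ℝ) : ℂ)) *
          pf (blockIdx d 2) G (upd (blockIdx d 2) (triple u (-ξ) 0) y)) := by
    intro y
    have h := integral_exp_mul_pf_upd (blockIdx_injective 1) (triple u 0 y)
      (partialFourier (blockIdx_injective 2) G) ξ
    simp only [upd_blockIdx_one, block_triple_zero, block_triple_two, Fintype.card_fin,
      partialFourier_apply] at h
    simp only [upd_blockIdx_two, block_triple_zero, block_triple_one]
    rw [mul_left_comm, ← h, ← integral_const_mul]
    congr 1
    ext x
    rw [← mul_assoc, ← Complex.exp_add, Complex.ofReal_add, mul_add, add_comm, pf₂,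
      partialFourier_apply]
  simp only [h1]
  rw [integral_const_mul, integral_exp_mul_pf_upd (blockIdx_injective 2), upd_blockIdx_two,
    ← mul_assoc, Fintype.card_fin, ← Complex.ofReal_mul, ← pow_add, ← two_mul]
  rfl

/-- The multiplier of the exponential operator. -/
noncomputable def expSymbol (r t : ℝ) (Y : Vec3 d) : ℂ :=
  Complex.exp (Complex.I * (((2 * Real.pi) ^ 2 *
      inner ℝ (r • block Y 1 + t • block Y 2) (block Y 0) : ℝ) : ℂ))

/-- Fourier inversion in the last two blocks: the full Fourier transform of `pf₂ G` is a partial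
Fourier transform of `G` in the first block. -/
theorem exists_fourier_pf₂ (d : ℕ) : ∃ c : ℂ, c ≠ 0 ∧ ∀ (G : Sch (Fin 3 × Fin d)) (Y : Vec3 d),
    c * (𝓕 (pf₂ G : Vec3 d → ℂ)) Y = ∫ u : Vec d,
      Complex.exp (-(Complex.I * ((2 * Real.pi * inner ℝ u (block Y 0) : ℝ) : ℂ))) *
        G (triple u ((2 * Real.pi) • block Y 1) ((2 * Real.pi) • block Y 2)) := by
  obtain ⟨c, hc, h⟩ := exists_integral_triple d
  have h0 : (((2 * Real.pi) ^ (2 * d) : ℝ) : ℂ) ≠ 0 := by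
    rw [Complex.ofReal_ne_zero]; positivity
  have hc' : (c : ℂ) ≠ 0 := by exact_mod_cast hc.ne'
  refine ⟨(((2 * Real.pi) ^ (2 * d) : ℝ) : ℂ)⁻¹ * c, mul_ne_zero (inv_ne_zero h0) hc',
    fun G Y => ?_⟩
  rw [Real.fourier_eq', mul_assoc, h, inv_mul_eq_iff_eq_mul₀ h0, ← integral_const_mul]
  · congr 1
    ext u
    have := integral_exp_mul_pf₂ G u (-((2 * Real.pi) • block Y 1)) (-((2 * Real.pi) • block Y 2))
    rw [neg_neg, neg_neg] at this
    rw [mul_left_comm, ← this, ← integral_const_mul]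
    congr 1
    ext η
    rw [← integral_const_mul]
    congr 1
    ext ξ
    rw [← mul_assoc, ← Complex.exp_add, inner_eq_blocks, smul_eq_mul]
    congr 2
    simp only [block_triple_zero, block_triple_one, block_triple_two, inner_neg_right,
      inner_smul_right]
    push_cast
    ring
  · refine ((pf₂ G).integrable (μ := volume)).bdd_mul (c := 1) ?_ ?_
    · fun_prop
    · refine Filter.Eventually.of_forall fun X => ?_
      rw [Complex.norm_exp_ofReal_mul_I]

/-- In `exists_fourier_pf₂`, a change of `(r, t)` is the translation of `u` by
`2π (r v + t w)`, where `v` and `w` are the last two blocks of `Y`; it produces the multiplier. -/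
theorem fourier_wigner (r t : ℝ) (Φ : Sch (Fin 3 × Fin d)) (Y : Vec3 d) :
    (𝓕 (wigner r t Φ : Vec3 d → ℂ)) Y = expSymbol r t Y * (𝓕 (wigner 0 0 Φ : Vec3 d → ℂ)) Y := by
  obtain ⟨c, hc, h⟩ := exists_fourier_pf₂ d
  have key : (𝓕 (pf₂ (compEquiv (shear d r t) Φ) : Vec3 d → ℂ)) Y =
      expSymbol r t Y * (𝓕 (pf₂ (compEquiv (shear d 0 0) Φ) : Vec3 d → ℂ)) Y := by
    refine mul_left_cancel₀ hc ?_
    have hshift := integral_add_right_eq_self (μ := volume) (fun u : Vec d =>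
      Complex.exp (-(Complex.I * ((2 * Real.pi * inner ℝ u (block Y 0) : ℝ) : ℂ))) *
        compEquiv (shear d 0 0) Φ
          (triple u ((2 * Real.pi) • block Y 1) ((2 * Real.pi) • block Y 2)))
      ((2 * Real.pi) • (r • block Y 1 + t • block Y 2))
    rw [mul_left_comm, h, h, ← hshift, ← integral_const_mul]
    congr 1
    ext u
    rw [← mul_assoc, expSymbol, ← Complex.exp_add]
    congr 1
    · congr 1
      rw [inner_add_left (𝕜 := ℝ) u, inner_smul_left, conj_trivial]
      push_cast
      ring
    · rw [compEquiv_apply, compEquiv_apply]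
      congr 1
      refine ext_block ?_ ?_ ?_ <;>
        simp only [shear_apply, block_triple_zero, block_triple_one, block_triple_two] <;> module
  have h2 : ∀ r t, ∀ X, (𝓕 (wigner r t Φ : Vec3 d → ℂ)) X = (((2 * Real.pi) ^ (2 * d) : ℝ) : ℂ)⁻¹ *
      (𝓕 (pf₂ (compEquiv (shear d r t) Φ) : Vec3 d → ℂ)) X := by
    intro r t X
    rw [← SchwartzMap.fourier_coe, wigner, FourierTransform.fourier_smul, smul_apply,
      SchwartzMap.fourier_coe, smul_eq_mul]
  rw [h2, h2, key, mul_left_comm]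

/-- The exponential operator carries the map with parameters `(0, 0)` to the one with `(r, t)`. -/
theorem expOp_wigner (r t : ℝ) (Φ : Sch (Fin 3 × Fin d)) :
    expOp r t (wigner 0 0 Φ : Vec3 d → ℂ) = kernelTranspose r t Φ := by
  have h : (fun Y : Vec3 d => expSymbol r t Y * (𝓕 (wigner 0 0 Φ : Vec3 d → ℂ)) Y) =
      ⇑(𝓕 (wigner r t Φ) : Sch (Fin 3 × Fin d)) := by
    ext Y
    rw [← fourier_wigner, SchwartzMap.fourier_coe]
  rw [← coe_wigner]
  change 𝓕⁻ (fun Y : Vec3 d => expSymbol r t Y * (𝓕 (wigner 0 0 Φ : Vec3 d → ℂ)) Y) = _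
  rw [h, ← SchwartzMap.fourierInv_coe]
  congr 1
  exact FourierTransform.fourierInv_fourier_eq _

/-- The substitution `φ = wigner 0 0 Φ`, in which `Φ` and `φ` run through all Schwartz functions. -/
theorem sameKernel_iff_sameExp {s σ : Fin 3 → ℝ} (r₁ t₁ r₂ t₂ : ℝ) (a b : SymbolDist d s σ) :
    SameKernel r₁ t₁ r₂ t₂ a b ↔ SameExp r₁ t₁ r₂ t₂ a b := by
  constructor
  · intro h φ h₁ h₂
    obtain ⟨Φ, rfl⟩ := wigner_surjective 0 0 φ
    rw [expOp_wigner] at h₁ h₂ ⊢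
    rw [expOp_wigner]
    exact h Φ h₁ h₂
  · intro h Φ h₁ h₂
    have := h (wigner 0 0 Φ)
    simp only [expOp_wigner] at this
    exact this h₁ h₂

variable {J K : Type} [Fintype J] [DecidableEq J] [Fintype K] [DecidableEq K]

/-! ### Linear changes of variables -/

/-- The number of multiplications in a word. -/
def mulNum (w : List (ι ⊕ ι)) : ℕ := ∑ i, mulCnt w i

/-- The number of derivatives in a word. -/
def derNum (w : List (ι ⊕ ι)) : ℕ := ∑ i, derCnt w i

theorem word_sum {A : Type} (w : List (ι ⊕ ι)) (S : Finset A) (F : A → Sch ι) :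
    word w (∑ a ∈ S, F a) = ∑ a ∈ S, word w (F a) := by
  classical
  induction S using Finset.induction_on with
  | empty =>
    have := word_smul w 0 (0 : Sch ι)
    simpa using this
  | insert a S ha ih => rw [Finset.sum_insert ha, Finset.sum_insert ha, word_add, ih]

/-- The coefficients of the letters after a linear change of variables: the entries of the inverse
matrix for multiplications, and those of the transpose of the matrix for derivatives. -/
noncomputable def letterCoeff (L : EuclideanSpace ℝ ι ≃L[ℝ] EuclideanSpace ℝ ι) :
    ι ⊕ ι → ι → ℝ :=
  Sum.elim (fun i j => L.symm (EuclideanSpace.single j 1) i)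
    (fun i j => L (EuclideanSpace.single i 1) j)

/-- The kind of a letter (multiplication or derivative), with a new coordinate. -/
def relabel (o : ι ⊕ ι) (j : ι) : ι ⊕ ι := Sum.elim (fun _ => Sum.inl j) (fun _ => Sum.inr j) o

theorem op_compEquiv (L : EuclideanSpace ℝ ι ≃L[ℝ] EuclideanSpace ℝ ι) (o : ι ⊕ ι) (F : Sch ι) :
    op o (compEquiv L F) =
      compEquiv L (∑ j, (letterCoeff L o j : ℂ) • op (relabel o j) F) := by
  ext X
  rw [compEquiv_apply, sum_apply]
  simp only [smul_apply, smul_eq_mul]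
  rcases o with i | i
  · simp only [op, Sum.elim_inl, coordMul_apply, letterCoeff, relabel, compEquiv_apply]
    simp only [← mul_assoc, ← Finset.sum_mul]
    congr 1
    have h : X = L.symm (L X) := (L.symm_apply_apply X).symm
    have h2 : L.symm (L X) = ∑ j, (L X) j • L.symm (EuclideanSpace.single j 1) := by
      conv_lhs => rw [eq_sum_single (L X)]
      rw [map_sum]
      simp only [map_smul]
    conv_lhs => rw [h, h2]
    simp only [WithLp.ofLp_sum, Finset.sum_apply, PiLp.smul_apply, smul_eq_mul]
    push_cast
    exact Finset.sum_congr rfl fun j _ => mul_comm _ _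
  · simp only [op, Sum.elim_inr, letterCoeff, relabel]
    have h := (hasFDerivAt_sch F (L X)).comp X L.hasFDerivAt
    rw [pderiv_apply]
    have h2 : (compEquiv L F : EuclideanSpace ℝ ι → ℂ) = F ∘ L := rfl
    rw [h2, h.fderiv]
    simp

/-- Every letter becomes a combination of letters of the same kind, so that bounds which depend only
on the numbers of multiplications and of derivatives are preserved. -/
theorem word_compEquiv_bound (L : EuclideanSpace ℝ ι ≃L[ℝ] EuclideanSpace ℝ ι) :
    ∃ M : ℝ, 1 ≤ M ∧ ∀ (w : List (ι ⊕ ι)) (F : Sch ι) (D : ℕ → ℕ → ℝ),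
      (∀ w' X, ‖word w' F X‖ ≤ D (mulNum w') (derNum w')) →
      ∀ X, ‖word w (compEquiv L F) X‖ ≤ M ^ w.length * D (mulNum w) (derNum w) := by
  -- the sum over all letters is a crude bound for the coefficients that replace one letter
  refine ⟨1 + ∑ o, ∑ j, |letterCoeff L o j|, ?_, ?_⟩
  · have : 0 ≤ ∑ o, ∑ j, |letterCoeff L o j| := by positivity
    linarith
  intro w
  set M := 1 + ∑ o, ∑ j, |letterCoeff L o j| with hM
  induction w with
  | nil =>
    intro F D hD X
    simpa using hD [] (L X)
  | cons o w ih =>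
    intro F D hD X
    rw [word_cons, op_compEquiv, List.length_cons, pow_succ, mul_assoc]
    have hmul : ∀ (w' : List (ι ⊕ ι)) j, mulNum (relabel o j :: w') = mulNum [o] + mulNum w' ∧
        derNum (relabel o j :: w') = derNum [o] + derNum w' := by
      intro w' j
      rcases o with i | i <;>
        simp [relabel, mulNum, derNum, mulCnt_cons_inl, mulCnt_cons_inr, derCnt_cons_inl,
          derCnt_cons_inr, Finset.sum_add_distrib, add_comm]
    have hmul' : mulNum (o :: w) = mulNum [o] + mulNum w ∧
        derNum (o :: w) = derNum [o] + derNum w := by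
      rcases o with i | i <;>
        simp [mulNum, derNum, mulCnt_cons_inl, mulCnt_cons_inr, derCnt_cons_inl,
          derCnt_cons_inr, Finset.sum_add_distrib, add_comm]
    rw [hmul'.1, hmul'.2]
    -- the function to which the remaining word is applied obeys bounds of the same form
    refine ih _ (fun m n => M * D (mulNum [o] + m) (derNum [o] + n)) (fun w' Y => ?_) X
    rw [word_sum, sum_apply]
    have hD0 : 0 ≤ D (mulNum [o] + mulNum w') (derNum [o] + derNum w') := by
      rcases o with i | i
      · rw [← (hmul w' i).1, ← (hmul w' i).2]
        exact (norm_nonneg _).trans (hD _ 0)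
      · rw [← (hmul w' i).1, ← (hmul w' i).2]
        exact (norm_nonneg _).trans (hD _ 0)
    calc ‖∑ j, word w' ((letterCoeff L o j : ℂ) • op (relabel o j) F) Y‖
        ≤ ∑ j, |letterCoeff L o j| * D (mulNum [o] + mulNum w') (derNum [o] + derNum w') := by
          refine (norm_sum_le _ _).trans (Finset.sum_le_sum fun j _ => ?_)
          rw [word_smul, smul_apply, norm_smul, Complex.norm_real, Real.norm_eq_abs]
          gcongr
          rw [← (hmul w' j).1, ← (hmul w' j).2]
          exact hD (relabel o j :: w') Y
      _ ≤ M * D (mulNum [o] + mulNum w') (derNum [o] + derNum w') := by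
          rw [← Finset.sum_mul]
          gcongr
          rw [hM]
          have := Finset.single_le_sum (f := fun o => ∑ j, |letterCoeff L o j|)
            (fun o _ => by positivity) (Finset.mem_univ o)
          linarith

theorem prod_factorial_le (α : ι → ℕ) :
    ∏ i, ((α i).factorial : ℝ) ≤ (∑ i, α i).factorial := by
  exact_mod_cast Nat.le_of_dvd (Nat.factorial_pos _) (Nat.prod_factorial_dvd_factorial_sum _ _)

theorem factorial_sum_le (α : ι → ℕ) : ((∑ i, α i).factorial : ℝ) ≤
    (2 ^ Fintype.card ι) ^ (∑ i, α i) * ∏ i, ((α i).factorial : ℝ) := by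
  have h : ∀ S : Finset ι, ((∑ i ∈ S, α i).factorial : ℝ) ≤
      (2 ^ S.card) ^ (∑ i, α i) * ∏ i ∈ S, ((α i).factorial : ℝ) := by
    intro S
    induction S using Finset.induction_on with
    | empty => simp
    | insert a S ha ih =>
      rw [Finset.sum_insert ha, Finset.prod_insert ha, Finset.card_insert_of_notMem ha]
      have h1 : α a + ∑ i ∈ S, α i ≤ ∑ i, α i := by
        rw [← Finset.sum_insert ha]
        exact Finset.sum_le_sum_of_subset (Finset.subset_univ _)
      calc ((α a + ∑ i ∈ S, α i).factorial : ℝ)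
          ≤ 2 ^ (α a + ∑ i ∈ S, α i) * ((α a).factorial * (∑ i ∈ S, α i).factorial) :=
            factorial_add_le _ _
        _ ≤ 2 ^ (∑ i, α i) * ((α a).factorial *
            ((2 ^ S.card) ^ (∑ i, α i) * ∏ i ∈ S, ((α i).factorial : ℝ))) := by
            gcongr
            norm_num
        _ = _ := by rw [pow_succ, mul_pow]; ring
  exact h Finset.univ

theorem facPow_const (s : ℝ) (α : ι → ℕ) :
    facPow (fun _ => s) α = (∏ i, ((α i).factorial : ℝ)) ^ s := by
  rw [facPow, Real.finsetProd_rpow _ _ fun i _ => by positivity]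

/-- The isotropic spaces are invariant under linear changes of variables: their weights are
comparable with functions of the orders `|α|` and `|β|` only. -/
theorem compEquiv_mem (L : EuclideanSpace ℝ ι ≃L[ℝ] EuclideanSpace ℝ ι) {s σ : ℝ} (hs : 0 ≤ s)
    (hσ : 0 ≤ σ) (hsσ : 1 ≤ s + σ) {F : Sch ι}
    (hF : (F : EuclideanSpace ℝ ι → ℂ) ∈ testSpace (fun _ => s) (fun _ => σ)) :
    (compEquiv L F : EuclideanSpace ℝ ι → ℂ) ∈ testSpace (fun _ => s) (fun _ => σ) := by
  obtain ⟨h, C, hh, hF⟩ := exists_hasBound_one_le hF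
  have hC := hF.nonneg
  obtain ⟨M, hM, hw⟩ := word_compEquiv_bound L
  set H : ℝ := 2 * h * (2 : ℝ) ^ (∑ _i : ι, σ) with hH
  set N : ℝ := 2 ^ Fintype.card ι with hN
  have hN1 : 1 ≤ N := one_le_pow₀ (by norm_num)
  have hlen : ∀ w : List (ι ⊕ ι), w.length = mulNum w + derNum w := fun w => by
    rw [← sum_mulCnt_add_derCnt, Finset.sum_add_distrib]; rfl
  set D : ℕ → ℕ → ℝ := fun m n => C * H ^ (m + n) *
      ((m.factorial : ℝ) ^ s * (n.factorial : ℝ) ^ σ) with hD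
  have h1 : ∀ w X, ‖word w F X‖ ≤ D (mulNum w) (derNum w) := by
    intro w X
    refine (word_bound (fun _ => hσ) (fun _ => hsσ) hh hF w X).trans ?_
    simp only [hD]
    rw [facPow_const, facPow_const, ← hlen]
    gcongr
    · exact prod_factorial_le _
    · exact prod_factorial_le _
  refine ⟨M * H * N ^ s * N ^ σ, C, by positivity, hasBound_of_word fun w X => ?_⟩
  refine (hw w F D h1 X).trans ?_
  simp only [hD]
  rw [facPow_const, facPow_const, ← hlen]
  have e1 : ∀ (u : ℝ) (hu : 0 ≤ u) (α : ι → ℕ), ((∑ i, α i).factorial : ℝ) ^ u ≤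
      (N ^ u) ^ (∑ i, α i) * (∏ i, ((α i).factorial : ℝ)) ^ u := by
    intro u hu α
    refine (Real.rpow_le_rpow (by positivity) (factorial_sum_le α) hu).trans (le_of_eq ?_)
    rw [Real.mul_rpow (by positivity) (by positivity), ← hN, ← Real.rpow_natCast,
      ← Real.rpow_natCast, ← Real.rpow_mul (by positivity), ← Real.rpow_mul (by positivity),
      mul_comm u]
  have e2 : ∀ (u : ℝ) (hu : 0 ≤ u) (n : ℕ), n ≤ w.length → (N ^ u) ^ n ≤ (N ^ u) ^ w.length :=
    fun u hu n hn => pow_le_pow_right₀ (Real.one_le_rpow hN1 hu) hn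
  calc M ^ w.length * (C * H ^ w.length *
        (((mulNum w).factorial : ℝ) ^ s * ((derNum w).factorial : ℝ) ^ σ))
      ≤ M ^ w.length * (C * H ^ w.length *
        (((N ^ s) ^ w.length * (∏ i, ((mulCnt w i).factorial : ℝ)) ^ s) *
          ((N ^ σ) ^ w.length * (∏ i, ((derCnt w i).factorial : ℝ)) ^ σ))) := by
        have a1 := (e1 s hs (mulCnt w)).trans (mul_le_mul_of_nonneg_right
          (e2 s hs (mulNum w) (by rw [hlen]; omega)) (by positivity))
        have a2 := (e1 σ hσ (derCnt w)).trans (mul_le_mul_of_nonneg_right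
          (e2 σ hσ (derNum w) (by rw [hlen]; omega)) (by positivity))
        gcongr
        · exact a1
        · exact a2
    _ = _ := by rw [mul_pow, mul_pow, mul_pow]; ring

/-! ### Tensor products -/

/-- The coordinates that belong to the block `j`. -/
def fiberIdx (E : ι ≃ J × K) (j : J) : K → ι := fun k => E.symm (j, k)

/-- The tensor product of functions `f j` of several blocks of variables, which are indexed by `J`
and have the coordinates `K`. -/
noncomputable def tensor (E : ι ≃ J × K) (f : J → EuclideanSpace ℝ K → ℂ) :
    EuclideanSpace ℝ ι → ℂ := fun X => ∏ j, f j (res (fiberIdx E j) X)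

/-- The entries of `l` that belong to the block `j`, as indices within this block. -/
def fiberList (E : ι ≃ J × K) (j : J) (l : List ι) : List K :=
  l.filterMap fun i => if (E i).1 = j then some (E i).2 else none

theorem fiberList_cons (E : ι ≃ J × K) (j : J) (i : ι) (l : List ι) : fiberList E j (i :: l) =
    if (E i).1 = j then (E i).2 :: fiberList E j l else fiberList E j l := by
  by_cases h : (E i).1 = j
  · rw [if_pos h, fiberList, List.filterMap_cons_some (b := (E i).2) (by simp [h])]; rfl
  · rw [if_neg h, fiberList, List.filterMap_cons_none (by simp [h])]; rfl

theorem cnt_fiberList (E : ι ≃ J × K) (j : J) (l : List ι) (k : K) :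
    cnt (fiberList E j l) k = cnt l (E.symm (j, k)) := by
  induction l with
  | nil => simp [fiberList]
  | cons i l ih =>
    rw [fiberList_cons, cnt_cons]
    have h : E.symm (j, k) = i ↔ j = (E i).1 ∧ k = (E i).2 := by
      rw [Equiv.symm_apply_eq, Prod.ext_iff]
    by_cases h1 : (E i).1 = j
    · rw [if_pos h1, cnt_cons, Pi.add_apply, Pi.add_apply, ih, Pi.single_apply, Pi.single_apply]
      simp only [h, h1, true_and]
    · rw [if_neg h1, Pi.add_apply, ih, Pi.single_apply, if_neg fun h' => h1 (h.1 h').1.symm,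
        add_zero]

theorem prod_eq_prod_fiber {M : Type} [CommMonoid M] (E : ι ≃ J × K) (f : ι → M) :
    ∏ i, f i = ∏ j, ∏ k, f (E.symm (j, k)) := by
  rw [← Fintype.prod_prod_type', ← E.symm.prod_comp]

theorem sum_eq_sum_fiber {M : Type} [AddCommMonoid M] (E : ι ≃ J × K) (f : ι → M) :
    ∑ i, f i = ∑ j, ∑ k, f (E.symm (j, k)) := by
  rw [← Fintype.sum_prod_type', ← E.symm.sum_comp]

theorem length_eq_sum_fiber (E : ι ≃ J × K) (l : List ι) :
    l.length = ∑ j, (fiberList E j l).length := by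
  simp only [← sum_cnt]
  rw [sum_eq_sum_fiber E]
  simp only [cnt_fiberList]

theorem isDerivFamily_tensor (E : ι ≃ J × K) (f : J → Sch K) :
    IsDerivFamily fun l => tensor E fun j => derivs (fiberList E j l) (f j) := by
  intro l X
  have h : ∀ j ∈ (Finset.univ : Finset J), HasFDerivAt
      (fun X => derivs (fiberList E j l) (f j) (res (fiberIdx E j) X)) _ X := fun j _ =>
    (hasFDerivAt_sch (derivs (fiberList E j l) (f j)) (res (fiberIdx E j) X)).comp X
      (res (fiberIdx E j)).hasFDerivAt
  refine (HasFDerivAt.finsetProd h).congr_fderiv ?_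
  ext V
  simp only [sum_apply, smul_apply,
    ContinuousLinearMap.comp_apply, ContinuousLinearMap.smulRight_apply, PiLp.proj_apply]
  rw [sum_eq_sum_fiber E]
  refine Finset.sum_congr rfl fun j _ => ?_
  rw [Finset.smul_sum]
  refine Finset.sum_congr rfl fun k _ => ?_
  simp only [tensor]
  rw [← Finset.mul_prod_erase _ _ (Finset.mem_univ j), fiberList_cons]
  simp only [Equiv.apply_symm_apply, if_true, derivs_cons]
  have h1 : ∏ x ∈ Finset.univ.erase j, (derivs (fiberList E x (E.symm (j, k) :: l)) (f x))
      (res (fiberIdx E x) X) =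
      ∏ x ∈ Finset.univ.erase j, (derivs (fiberList E x l) (f x)) (res (fiberIdx E x) X) := by
    refine Finset.prod_congr rfl fun x hx => ?_
    rw [fiberList_cons, Equiv.apply_symm_apply, if_neg (Finset.ne_of_mem_erase hx).symm]
  rw [h1, smul_comm, smul_eq_mul, mul_comm, res_apply]
  rfl

theorem hasBound_tensor (E : ι ≃ J × K) {f : J → Sch K} {s σ : J → K → ℝ} {h : ℝ} {C : J → ℝ}
    (hf : ∀ j, HasBound (s j) (σ j) h (C j) (f j)) :
    HasBound (fun i => s (E i).1 (E i).2) (fun i => σ (E i).1 (E i).2) h (∏ j, C j)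
      (tensor E fun j => f j) := by
  refine hasBound_of_family (isDerivFamily_tensor E f) fun α l X => ?_
  have hC : ∀ j, 0 ≤ C j := fun j => (hf j).nonneg
  have e1 : ∏ i, X i ^ α i = ∏ j, ∏ k, (res (fiberIdx E j) X) k ^ α (E.symm (j, k)) :=
    prod_eq_prod_fiber E _
  have e2 : ∀ (s : J → K → ℝ) (β : ι → ℕ), facPow (fun i => s (E i).1 (E i).2) β =
      ∏ j, facPow (s j) fun k => β (E.symm (j, k)) := by
    intro s β
    rw [facPow, prod_eq_prod_fiber E]
    simp only [Equiv.apply_symm_apply]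
    rfl
  rw [e1, tensor, norm_prod, Finset.abs_prod, ← Finset.prod_mul_distrib, e2, e2,
    length_eq_sum_fiber E, sum_eq_sum_fiber E, ← Finset.sum_add_distrib,
    ← Finset.prod_pow_eq_pow_sum, ← Finset.prod_mul_distrib, ← Finset.prod_mul_distrib,
    ← Finset.prod_mul_distrib]
  refine Finset.prod_le_prod (fun j _ => by positivity) fun j _ => ?_
  have := hasBound_iff.1 (hf j) (fun k => α (E.symm (j, k))) (fiberList E j l)
    (res (fiberIdx E j) X)
  have e3 : cnt (fiberList E j l) = fun k => cnt l (E.symm (j, k)) :=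
    funext fun k => cnt_fiberList E j l k
  rwa [e3] at this

theorem tensor_mem (E : ι ≃ J × K) {f : J → EuclideanSpace ℝ K → ℂ} {s σ : J → K → ℝ}
    (hf : ∀ j, f j ∈ testSpace (s j) (σ j)) :
    tensor E f ∈ testSpace (fun i => s (E i).1 (E i).2) (fun i => σ (E i).1 (E i).2) := by
  choose h C h0 hb using hf
  choose F hF using fun j => (hb j).exists_sch
  obtain rfl : (fun j => ⇑(F j)) = f := funext hF
  have h1 : ∀ j, h j ≤ 1 + ∑ j, h j := fun j => by
    have := Finset.single_le_sum (fun j _ => (h0 j).le) (Finset.mem_univ j)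
    linarith
  have h2 : 0 < 1 + ∑ j, h j := by
    have := Finset.sum_nonneg fun j (_ : j ∈ Finset.univ) => (h0 j).le
    linarith
  exact ⟨_, _, h2, hasBound_tensor E fun j => (hb j).mono (h0 j) (h1 j)⟩

theorem tensor_three (f : Fin 3 → Vec d → ℂ) (X : Vec3 d) :
    tensor (Equiv.refl (Fin 3 × Fin d)) f X =
      f 0 (block X 0) * f 1 (block X 1) * f 2 (block X 2) := by
  rw [tensor, Fin.prod_univ_three]
  rfl

theorem mem_range_blockIdx (i j : Fin 3) (k : Fin d) : (j, k) ∈ Set.range (blockIdx d i) ↔ j = i :=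
  ⟨fun ⟨_, h⟩ => (Prod.ext_iff.1 h).1.symm, fun h => ⟨k, by rw [h]; rfl⟩⟩

/-- The isotropic space with the smallest exponents is invariant under `shear`, and the partial
Fourier transforms map it into the test space of the symbols. -/
theorem wigner_mem {s σ : Fin 3 → ℝ} (hs : ∀ j, 0 < s j) (hσ : ∀ j, 0 < σ j)
    (hsσ : ∀ i j, 1 ≤ s i + σ j) (r t : ℝ) {Φ : Sch (Fin 3 × Fin d)}
    (hΦ : (Φ : Vec3 d → ℂ) ∈ testSpace (fun _ => ⨅ j, s j) (fun _ => ⨅ j, σ j)) :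
    (wigner r t Φ : Vec3 d → ℂ) ∈ SymbolTest d s σ := by
  obtain ⟨i₀, hi⟩ := exists_eq_ciInf_of_finite (f := s)
  obtain ⟨j₀, hj⟩ := exists_eq_ciInf_of_finite (f := σ)
  have his : ∀ i, s i₀ ≤ s i := fun i => hi ▸ ciInf_le (Set.finite_range s).bddBelow i
  have hjs : ∀ i, σ j₀ ≤ σ i := fun i => hj ▸ ciInf_le (Set.finite_range σ).bddBelow i
  rw [← hi, ← hj] at hΦ
  have h1 := compEquiv_mem (shear d r t) (hs i₀).le (hσ j₀).le (hsσ i₀ j₀) hΦ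
  have h2 := partialFourier_mem (blockIdx_injective 2) (fun _ => (hs i₀).le) (fun _ => (hσ j₀).le)
    (fun _ => hsσ i₀ j₀) h1
  have hcase : ∀ (e : Fin d → Fin 3 × Fin d) (u v : ℝ) (P : ℝ → Prop), P u → P v →
      ∀ p, P (swapExp e (fun _ => u) (fun _ => v) p) := by
    intro e u v P hu hv p
    unfold swapExp
    split_ifs
    · exact hv
    · exact hu
  have h3 := partialFourier_mem (blockIdx_injective 1)
    (hcase _ _ _ _ (hs i₀).le (hσ j₀).le) (hcase _ _ _ _ (hσ j₀).le (hs i₀).le) (fun p => ?_) h2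
  · refine testSpace_mono ?_ ?_ (Submodule.smul_mem _ _ h3)
    · rintro ⟨j, k⟩
      simp only [swapExp, mem_range_blockIdx, symbolDecay]
      fin_cases j <;> simp [his, hjs]
    · rintro ⟨j, k⟩
      simp only [swapExp, mem_range_blockIdx, symbolReg]
      fin_cases j <;> simp [his, hjs]
  · have := hsσ i₀ j₀
    unfold swapExp
    split_ifs <;> linarith

/-! ### Continuous linear forms on the test spaces -/

/-- `U` restricts to a linear form on the test space that is bounded on the Banach space of every
step.  The values of `U` outside the test space are arbitrary. -/
structure IsForm (s σ : ι → ℝ) (U : Sch ι → ℂ) : Prop where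
  add : ∀ F G : Sch ι, (F : EuclideanSpace ℝ ι → ℂ) ∈ testSpace s σ →
    (G : EuclideanSpace ℝ ι → ℂ) ∈ testSpace s σ → U (F + G) = U F + U G
  smul : ∀ (c : ℂ) (F : Sch ι), (F : EuclideanSpace ℝ ι → ℂ) ∈ testSpace s σ → U (c • F) = c * U F
  bounded : ∀ h : ℝ, 0 < h → ∃ K : ℝ, 0 ≤ K ∧ ∀ (C : ℝ) (F : Sch ι), HasBound s σ h C F →
    ‖U F‖ ≤ K * C

theorem hasBound_zero (s σ : ι → ℝ) (h : ℝ) :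
    HasBound s σ h 0 ((0 : Sch ι) : EuclideanSpace ℝ ι → ℂ) := by
  rw [hasBound_iff]
  intro α l X
  have : derivs l (0 : Sch ι) = 0 := by simpa using derivs_smul l (0 : ℂ) (0 : Sch ι)
  simp [this]

/-- The Schwartz functions in the Banach space of step `H`. -/
def stepSpace (s σ : ι → ℝ) (H : ℝ) : Submodule ℂ (Sch ι) where
  carrier := {F | ∃ C : ℝ, HasBound s σ H C F}
  zero_mem' := ⟨0, hasBound_zero s σ H⟩
  add_mem' := fun ⟨_, hF⟩ ⟨_, hG⟩ => ⟨_, hF.add hG⟩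
  smul_mem' := fun c _ ⟨_, hF⟩ => ⟨_, hF.const_smul c⟩

/-- The weight, in the norm of step `H`, of the monomial `X ^ α` and the derivative along `l`. -/
noncomputable def stepWeight (s σ : ι → ℝ) (H : ℝ) (α : ι → ℕ) (l : List ι) : ℝ :=
  H ^ ((∑ i, α i) + l.length) * (facPow s α * facPow σ (cnt l))

theorem stepWeight_pos (s σ : ι → ℝ) {H : ℝ} (hH : 0 < H) (α : ι → ℕ) (l : List ι) :
    0 < stepWeight s σ H α l :=
  mul_pos (pow_pos hH _) (mul_pos (facPow_pos _ _) (facPow_pos _ _))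

/-- The positions `(α, l, X)` of the values `X ^ α * ∂ ^ l F (X)` that enter the norm of step
`H`. -/
abbrev JetIndex (ι : Type) : Type := (ι → ℕ) × List ι × EuclideanSpace ℝ ι

/-- The normalized value of `X ^ α * ∂ ^ l F (X)`. -/
noncomputable def jetFun (s σ : ι → ℝ) (H : ℝ) (F : Sch ι) (t : JetIndex ι) : ℂ :=
  ((∏ i, t.2.2 i ^ t.1 i : ℝ) : ℂ) * derivs t.2.1 F t.2.2 * ((stepWeight s σ H t.1 t.2.1)⁻¹ : ℝ)

theorem norm_jetFun_le_iff {s σ : ι → ℝ} {H : ℝ} (hH : 0 < H) {C : ℝ} {F : Sch ι} :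
    (∀ t, ‖jetFun s σ H F t‖ ≤ C) ↔ HasBound s σ H C F := by
  rw [hasBound_iff]
  have key : ∀ (α : ι → ℕ) (l : List ι) (X : EuclideanSpace ℝ ι),
      ‖jetFun s σ H F (α, l, X)‖ ≤ C ↔ |∏ i, X i ^ α i| * ‖derivs l F X‖ ≤
        C * H ^ ((∑ i, α i) + l.length) * (facPow s α * facPow σ (cnt l)) := by
    intro α l X
    have hw := stepWeight_pos s σ hH α l
    rw [jetFun, norm_mul, norm_mul, Complex.norm_real, Complex.norm_real, Real.norm_eq_abs,
      Real.norm_eq_abs, abs_of_pos (inv_pos.2 hw), ← div_eq_mul_inv, div_le_iff₀ hw, mul_assoc C]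
    rfl
  exact ⟨fun h α l X => (key α l X).1 (h _), fun h ⟨α, l, X⟩ => (key α l X).2 (h α l X)⟩

/-- The isometric embedding of the Banach space of step `H` into a space of bounded families.  The
latter is complete, so that Bochner integrals are available there. -/
noncomputable def jet (s σ : ι → ℝ) {H : ℝ} (hH : 0 < H) :
    stepSpace s σ H →ₗ[ℂ] lp (fun _ : JetIndex ι => ℂ) ∞ where
  toFun F := ⟨jetFun s σ H F, memℓp_infty (by
    obtain ⟨C, hC⟩ := F.2
    exact ⟨C, by rintro _ ⟨t, rfl⟩; exact (norm_jetFun_le_iff hH).2 hC t⟩)⟩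
  map_add' F G := by
    ext t
    simp only [jetFun, Submodule.coe_add, derivs_add, add_apply, lp.coeFn_add, Pi.add_apply]
    ring
  map_smul' c F := by
    ext t
    simp only [jetFun, Submodule.coe_smul, derivs_smul, smul_apply, lp.coeFn_smul, Pi.smul_apply,
      RingHom.id_apply, smul_eq_mul]
    ring

theorem jet_apply (s σ : ι → ℝ) {H : ℝ} (hH : 0 < H) (F : stepSpace s σ H) (t : JetIndex ι) :
    (jet s σ hH F : JetIndex ι → ℂ) t = jetFun s σ H F t := rfl

theorem hasBound_norm_jet {s σ : ι → ℝ} {H : ℝ} (hH : 0 < H) (F : stepSpace s σ H) :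
    HasBound s σ H ‖jet s σ hH F‖ ((F : Sch ι) : EuclideanSpace ℝ ι → ℂ) :=
  (norm_jetFun_le_iff hH).1 fun t => lp.norm_apply_le_norm ENNReal.top_ne_zero (jet s σ hH F) t

theorem norm_jet_le {s σ : ι → ℝ} {H : ℝ} (hH : 0 < H) {F : stepSpace s σ H} {C : ℝ}
    (hF : HasBound s σ H C ((F : Sch ι) : EuclideanSpace ℝ ι → ℂ)) : ‖jet s σ hH F‖ ≤ C :=
  lp.norm_le_of_forall_le hF.nonneg fun t => (norm_jetFun_le_iff hH).2 hF t

theorem jet_injective {s σ : ι → ℝ} {H : ℝ} (hH : 0 < H) : Function.Injective (jet s σ hH) := by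
  rw [injective_iff_map_eq_zero]
  intro F hF
  have h := hasBound_norm_jet hH F
  rw [hF, norm_zero, hasBound_iff] at h
  ext X
  have := h 0 [] X
  simpa using this

/-- By the Hahn-Banach theorem, a continuous linear form extends from the image of `jet` to the
space of bounded families. -/
theorem IsForm.exists_extension {s σ : ι → ℝ} {U : Sch ι → ℂ} (hU : IsForm s σ U) {H : ℝ}
    (hH : 0 < H) : ∃ A : lp (fun _ : JetIndex ι => ℂ) ∞ →L[ℂ] ℂ,
      ∀ F : stepSpace s σ H, A (jet s σ hH F) = U F := by
  obtain ⟨K, -, hK⟩ := hU.bounded H hH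
  have hmem : ∀ F : stepSpace s σ H, ((F : Sch ι) : EuclideanSpace ℝ ι → ℂ) ∈ testSpace s σ :=
    fun F => ⟨H, F.2.choose, hH, F.2.choose_spec⟩
  let U' : stepSpace s σ H →ₗ[ℂ] ℂ :=
    { toFun := fun F => U F
      map_add' := fun F G => hU.add F G (hmem F) (hmem G)
      map_smul' := fun c F => hU.smul c F (hmem F) }
  let e := LinearEquiv.ofInjective (jet s σ hH) (jet_injective hH)
  let f : StrongDual ℂ (LinearMap.range (jet s σ hH)) :=
    (U'.comp e.symm.toLinearMap).mkContinuous K fun y => by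
      obtain ⟨F, rfl⟩ := e.surjective y
      simp only [LinearMap.comp_apply, LinearEquiv.coe_coe, LinearEquiv.symm_apply_apply]
      exact hK _ F (hasBound_norm_jet hH F)
  obtain ⟨A, hA, -⟩ := exists_extension_norm_eq _ f
  refine ⟨A, fun F => ?_⟩
  have h1 := hA (e F)
  have h2 : f (e F) = U F := by
    change U' (e.symm (e F)) = U F
    rw [LinearEquiv.symm_apply_apply]
    rfl
  rw [← h2, ← h1]
  rfl

/-- The evaluation of a bounded family at an index. -/
noncomputable def lpEval {T : Type} (t : T) : lp (fun _ : T => ℂ) ∞ →L[ℂ] ℂ :=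
  LinearMap.mkContinuous
    { toFun := fun f => f t
      map_add' := fun _ _ => rfl
      map_smul' := fun _ _ => rfl } 1 fun f => by
    rw [one_mul]
    exact lp.norm_apply_le_norm ENNReal.top_ne_zero f t

theorem lpEval_apply {T : Type} (t : T) (f : lp (fun _ : T => ℂ) ∞) : lpEval t f = f t := rfl

/-! ### Translations -/

/-- The translate `X ↦ G (X - Y)`. -/
noncomputable def translate (Y : EuclideanSpace ℝ ι) (G : Sch ι) : Sch ι :=
  SchwartzMap.compCLMOfAntilipschitz ℂ (K := 1) (g := fun X => X - Y)
    (by fun_prop) (AntilipschitzWith.of_le_mul_dist fun X Z => by simp) G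

@[simp] theorem translate_apply (Y : EuclideanSpace ℝ ι) (G : Sch ι) (X : EuclideanSpace ℝ ι) :
    translate Y G X = G (X - Y) := rfl

theorem pderiv_translate (i : ι) (Y : EuclideanSpace ℝ ι) (G : Sch ι) :
    pderiv i (translate Y G) = translate Y (pderiv i G) := by
  ext X
  have h := (hasFDerivAt_sch G (X - Y)).comp X ((hasFDerivAt_id X).sub_const Y)
  rw [pderiv_eq_of_hasFDerivAt (F := translate Y G) h]
  simp

theorem derivs_translate (l : List ι) (Y : EuclideanSpace ℝ ι) (G : Sch ι) :
    derivs l (translate Y G) = translate Y (derivs l G) := by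
  induction l with
  | nil => rfl
  | cons i l ih => rw [derivs_cons, derivs_cons, ih, pderiv_translate]

/-- Bounds for a translate, when `Z` comes with a weight `c` that pays for monomials in `Z`.  Each
factor `|X i|` is at most twice the larger one of `|X i - Z i|` and `|Z i|`. -/
theorem translate_bound {s σ : ι → ℝ} {h C : ℝ} {G : Sch ι} (hs : ∀ i, 0 ≤ s i) (hh : 1 ≤ h)
    (hG : HasBound s σ h C G) {Z : EuclideanSpace ℝ ι} {c B : ℝ} (hc : 0 ≤ c) (hB : 0 ≤ B)
    (hZ : ∀ β : ι → ℕ, c * ∏ i, |Z i| ^ β i ≤ B * h ^ (∑ i, β i) * facPow s β)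
    (α : ι → ℕ) (l : List ι) (X : EuclideanSpace ℝ ι) :
    c * (|∏ i, X i ^ α i| * ‖derivs l G (X - Z)‖) ≤
      B * C * (2 * h) ^ ((∑ i, α i) + l.length) * (facPow s α * facPow σ (cnt l)) := by
  have hC := hG.nonneg
  classical
  -- `α₁` collects the factors that go to `X - Z`, and `α₂` those that go to `Z`
  set α₁ : ι → ℕ := fun i => if |Z i| ≤ |X i - Z i| then α i else 0 with hα₁
  set α₂ : ι → ℕ := fun i => if |Z i| ≤ |X i - Z i| then 0 else α i with hα₂
  have hα : ∀ i, α i = α₁ i + α₂ i := fun i => by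
    simp only [hα₁, hα₂]; split_ifs <;> simp
  have hα' : α = α₁ + α₂ := funext hα
  have hsum : ∑ i, α i = ∑ i, α₁ i + ∑ i, α₂ i := by
    rw [← Finset.sum_add_distrib]; exact Finset.sum_congr rfl fun i _ => hα i
  have h1 : |∏ i, X i ^ α i| ≤
      2 ^ (∑ i, α i) * ((∏ i, |Z i| ^ α₂ i) * |∏ i, (X - Z) i ^ α₁ i|) := by
    rw [Finset.abs_prod, Finset.abs_prod, ← Finset.prod_mul_distrib, ← Finset.prod_pow_eq_pow_sum,
      ← Finset.prod_mul_distrib]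
    refine Finset.prod_le_prod (fun i _ => abs_nonneg _) fun i _ => ?_
    have ht : |X i| ≤ |X i - Z i| + |Z i| := by
      have := abs_add_le (X i - Z i) (Z i)
      rwa [sub_add_cancel] at this
    simp only [abs_pow, hα₁, hα₂, PiLp.sub_apply]
    split_ifs with hle
    · rw [pow_zero, one_mul, ← mul_pow]
      gcongr
      linarith
    · rw [pow_zero, mul_one, ← mul_pow]
      gcongr
      linarith
  have h2 := hasBound_iff.1 hG α₁ l (X - Z)
  have h3 := hZ α₂
  have h4 := facPow_mul_le hs α₁ α₂
  rw [← hα'] at h4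
  have p1 := facPow_pos s α₁
  have p2 := facPow_pos s α₂
  have p3 := facPow_pos σ (cnt l)
  have p4 := facPow_pos s α
  calc c * (|∏ i, X i ^ α i| * ‖derivs l G (X - Z)‖)
      ≤ c * ((2 ^ (∑ i, α i) * ((∏ i, |Z i| ^ α₂ i) * |∏ i, (X - Z) i ^ α₁ i|)) *
          ‖derivs l G (X - Z)‖) := by gcongr
    _ = 2 ^ (∑ i, α i) * ((c * ∏ i, |Z i| ^ α₂ i) *
          (|∏ i, (X - Z) i ^ α₁ i| * ‖derivs l G (X - Z)‖)) := by ring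
    _ ≤ 2 ^ ((∑ i, α i) + l.length) * ((B * h ^ (∑ i, α₂ i) * facPow s α₂) *
          (C * h ^ ((∑ i, α₁ i) + l.length) * (facPow s α₁ * facPow σ (cnt l)))) := by
        have hP : 0 ≤ ∏ i, |Z i| ^ α₂ i := Finset.prod_nonneg fun i _ => by positivity
        gcongr
        · norm_num
        · omega
    _ = B * C * (2 * h) ^ ((∑ i, α i) + l.length) *
          ((facPow s α₁ * facPow s α₂) * facPow σ (cnt l)) := by
        rw [hsum, mul_pow]
        ring
    _ ≤ _ := by gcongr

/-- The power series of `exp (R ^ (1 / s))`, raised to the power `s`. -/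
theorem pow_le_exp_mul_factorial {R s : ℝ} (hR : 0 ≤ R) (hs : 0 < s) (n : ℕ) :
    R ^ n ≤ Real.exp (s * R ^ s⁻¹) * (n.factorial : ℝ) ^ s := by
  have h1 : (R ^ s⁻¹) ^ n ≤ Real.exp (R ^ s⁻¹) * n.factorial := by
    have := Real.pow_div_factorial_le_exp (R ^ s⁻¹) (by positivity) n
    rwa [div_le_iff₀ (by positivity)] at this
  have h2 := Real.rpow_le_rpow (by positivity) h1 hs.le
  rw [Real.mul_rpow (by positivity) (by positivity), ← Real.exp_mul, ← Real.rpow_natCast,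
    ← Real.rpow_mul (by positivity), ← Real.rpow_mul hR] at h2
  have e : s⁻¹ * n * s = n := by field_simp
  rw [← mul_assoc, e, Real.rpow_natCast, mul_comm _ s] at h2
  exact h2

/-- On bounded sets, monomials are bounded by the weights, without a loss in the step. -/
theorem exists_prod_pow_le {s : ι → ℝ} (hs : ∀ i, 0 < s i) (R : ℝ) :
    ∃ B : ℝ, 0 ≤ B ∧ ∀ Z : EuclideanSpace ℝ ι, ‖Z‖ ≤ R → ∀ β : ι → ℕ,
      ∏ i, |Z i| ^ β i ≤ B * facPow s β := by
  refine ⟨∏ i, Real.exp (s i * R ^ (s i)⁻¹), by positivity, fun Z hZ β => ?_⟩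
  rw [facPow, ← Finset.prod_mul_distrib]
  refine Finset.prod_le_prod (fun i _ => by positivity) fun i _ => ?_
  have h1 : |Z i| ≤ R := (abs_le_norm_coord Z i).trans hZ
  have h0 : 0 ≤ R := (abs_nonneg _).trans h1
  exact (pow_le_pow_left₀ (abs_nonneg _) h1 _).trans (pow_le_exp_mul_factorial h0 (hs i) _)

theorem translate_mem_bound {s σ : ι → ℝ} {h C : ℝ} {G : Sch ι} (hs : ∀ i, 0 < s i) (hh : 1 ≤ h)
    (hG : HasBound s σ h C G) (R : ℝ) : ∃ B : ℝ, 0 ≤ B ∧ ∀ Z : EuclideanSpace ℝ ι, ‖Z‖ ≤ R →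
      HasBound s σ (2 * h) (B * C) (translate Z G) := by
  obtain ⟨B, hB, hBZ⟩ := exists_prod_pow_le hs R
  refine ⟨B, hB, fun Z hZ => ?_⟩
  rw [hasBound_iff]
  intro α l X
  have h1 := translate_bound (fun i => (hs i).le) hh hG (Z := Z) zero_le_one hB (fun β => ?_) α l X
  · rwa [one_mul, ← translate_apply, ← derivs_translate] at h1
  · rw [one_mul]
    refine (hBZ Z hZ β).trans ?_
    have := facPow_pos s β
    rw [mul_right_comm]
    exact le_mul_of_one_le_right (by positivity) (one_le_pow₀ hh)

theorem translate_mem {s σ : ι → ℝ} (hs : ∀ i, 0 < s i) {G : Sch ι}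
    (hG : (G : EuclideanSpace ℝ ι → ℂ) ∈ testSpace s σ) (Z : EuclideanSpace ℝ ι) :
    (translate Z G : EuclideanSpace ℝ ι → ℂ) ∈ testSpace s σ := by
  obtain ⟨h, C, hh, hG⟩ := exists_hasBound_one_le hG
  obtain ⟨B, -, hB⟩ := translate_mem_bound hs hh hG ‖Z‖
  exact ⟨_, _, by linarith, hB Z le_rfl⟩

/-- Translation is locally Lipschitz continuous, with values in a Banach space of larger step. -/
theorem translate_sub_bound {s σ : ι → ℝ} {h C : ℝ} {G : Sch ι} (hs : ∀ i, 0 < s i)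
    (hσ : ∀ i, 0 ≤ σ i) (hh : 1 ≤ h) (hG : HasBound s σ h C G) (R : ℝ) :
    ∃ B : ℝ, 0 ≤ B ∧ ∀ Y Z : EuclideanSpace ℝ ι, ‖Y‖ ≤ R → ‖Z‖ ≤ R →
      HasBound s σ (2 * h * (2 : ℝ) ^ (∑ i, σ i)) (B * ‖Y - Z‖)
        (translate Y G - translate Z G) := by
  obtain ⟨B, hB, hBZ⟩ := translate_mem_bound hs hh hG R
  have hC := hG.nonneg
  set T : ℝ := (2 : ℝ) ^ (∑ i, σ i) with hT
  have hT1 : 1 ≤ T := Real.one_le_rpow (by norm_num) (Finset.sum_nonneg fun i _ => hσ i)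
  refine ⟨Fintype.card ι * (B * C * (2 * h * T)), by positivity, fun Y Z hY hZ => ?_⟩
  have key : ∀ (α : ι → ℕ) (l : List ι) (X : EuclideanSpace ℝ ι),
      |∏ i, X i ^ α i| * ‖derivs l (translate Y G - translate Z G) X‖ ≤
        (Fintype.card ι * (B * C * (2 * h * T))) * ‖Y - Z‖ * (2 * h * T) ^ ((∑ i, α i) + l.length) *
          (facPow s α * facPow σ (cnt l)) := by
    intro α l X
    set W : ℝ := facPow s α * facPow σ (cnt l) with hW
    have hW0 : 0 < W := mul_pos (facPow_pos _ _) (facPow_pos _ _)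
    set P : ℝ := ∏ i, X i ^ α i with hP
    -- the derivative of the translate with respect to the translation vector
    have hder : ∀ V : EuclideanSpace ℝ ι, HasFDerivAt (fun V => (P : ℂ) * derivs l G (X - V))
        (-∑ i, (EuclideanSpace.proj i : EuclideanSpace ℝ ι →L[ℝ] ℝ).smulRight
          ((P : ℂ) * derivs (i :: l) G (X - V))) V := by
      intro V
      have h1 := ((hasFDerivAt_sch (derivs l G) (X - V)).comp V
        ((hasFDerivAt_id V).const_sub X)).const_mul (P : ℂ)
      refine h1.congr_fderiv ?_
      ext U
      simp [derivs_cons, Finset.mul_sum]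
      refine Finset.sum_congr rfl fun i _ => ?_
      ring
    have hbd : ∀ V : EuclideanSpace ℝ ι, ‖V‖ ≤ R →
        ‖-∑ i, (EuclideanSpace.proj i : EuclideanSpace ℝ ι →L[ℝ] ℝ).smulRight
          ((P : ℂ) * derivs (i :: l) G (X - V))‖ ≤
        Fintype.card ι * (B * C * (2 * h * T)) * ((2 * h * T) ^ ((∑ i, α i) + l.length) * W) := by
      intro V hV
      rw [norm_neg]
      refine (norm_sum_le _ _).trans ?_
      have h2 : ∀ i ∈ (Finset.univ : Finset ι),
          ‖(EuclideanSpace.proj i : EuclideanSpace ℝ ι →L[ℝ] ℝ).smulRight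
            ((P : ℂ) * derivs (i :: l) G (X - V))‖ ≤
            (B * C * (2 * h * T)) * ((2 * h * T) ^ ((∑ i, α i) + l.length) * W) := by
        intro i _
        have hpr : ‖(EuclideanSpace.proj i : EuclideanSpace ℝ ι →L[ℝ] ℝ)‖ ≤ 1 :=
          ContinuousLinearMap.opNorm_le_bound _ zero_le_one fun U => by
            rw [one_mul]; exact abs_le_norm_coord U i
        rw [ContinuousLinearMap.norm_smulRight_apply, norm_mul, Complex.norm_real,
          Real.norm_eq_abs]
        have h3 := hasBound_iff.1 (hBZ V hV) α (i :: l) X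
        rw [derivs_translate, translate_apply] at h3
        have h4 := facPow_add_le hσ (cnt l) (Pi.single i 1)
        have h5 : facPow σ (Pi.single i 1) = 1 := by
          unfold facPow
          refine Finset.prod_eq_one fun j _ => ?_
          by_cases hj : j = i
          · subst hj; simp
          · simp [hj]
        have h6 : ∑ j, (cnt l j + (Pi.single i 1 : ι → ℕ) j) = l.length + 1 := by
          rw [Finset.sum_add_distrib, sum_cnt]; simp
        rw [h5, h6, mul_one, ← hT, ← cnt_cons] at h4
        have p1 := facPow_pos s α
        have p2 := facPow_pos σ (cnt l)
        calc _ ≤ 1 * (|P| * ‖derivs (i :: l) G (X - V)‖) := by gcongr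
          _ ≤ B * C * (2 * h) ^ ((∑ i, α i) + (i :: l).length) *
                (facPow s α * (T ^ (l.length + 1) * facPow σ (cnt l))) := by
              rw [one_mul]
              refine h3.trans ?_
              gcongr
          _ ≤ B * C * (2 * h) ^ ((∑ i, α i) + (i :: l).length) *
                (facPow s α * (T ^ ((∑ i, α i) + (i :: l).length) * facPow σ (cnt l))) := by
              have h7 : T ^ (l.length + 1) ≤ T ^ ((∑ i, α i) + (i :: l).length) :=
                pow_le_pow_right₀ hT1 (by rw [List.length_cons]; omega)
              exact mul_le_mul_of_nonneg_left (mul_le_mul_of_nonneg_left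
                (mul_le_mul_of_nonneg_right h7 p2.le) p1.le) (by positivity)
          _ = _ := by
              rw [List.length_cons, mul_pow _ T, hW]
              ring
      refine (Finset.sum_le_sum h2).trans (le_of_eq ?_)
      rw [Finset.sum_const, Finset.card_univ, nsmul_eq_mul]
      ring
    -- the mean value inequality on a ball, for fixed `α`, `l` and `X`
    have hmv := Convex.norm_image_sub_le_of_norm_hasFDerivWithin_le
      (fun V _ => (hder V).hasFDerivWithinAt) (fun V hV => hbd V (by simpa using hV))
      (convex_closedBall (0 : EuclideanSpace ℝ ι) R) (x := Z) (y := Y) (by simpa using hZ) (by simpa using hY)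
    have hd : derivs l (translate Y G - translate Z G) X =
        derivs l G (X - Y) - derivs l G (X - Z) := by
      rw [sub_eq_add_neg, ← neg_one_smul ℂ, derivs_add, derivs_smul, derivs_translate,
        derivs_translate]
      simp [sub_eq_add_neg]
    rw [hd, ← Real.norm_eq_abs, ← Complex.norm_real, ← norm_mul, mul_sub]
    refine hmv.trans (le_of_eq ?_)
    ring
  exact hasBound_iff.2 key

/-! ### Convolutions -/

theorem isDerivFamily_conv (F G : Sch ι) :
    IsDerivFamily fun l X => ∫ Y, F Y * derivs l G (X - Y) := by
  intro l X
  have hF : Integrable F := F.integrable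
  have hcont : ∀ (G : Sch ι) X, Continuous fun Y => F Y * G (X - Y) := fun G X => by
    have h1 := F.continuous
    have h2 := G.continuous
    fun_prop
  have hint : ∀ (G : Sch ι) X, Integrable fun Y => F Y * G (X - Y) := by
    intro G X
    obtain ⟨D, -, hD⟩ := exists_decay G 0
    refine hF.mul_bdd (c := D) ?_ (Filter.Eventually.of_forall fun Y => by simpa using hD (X - Y))
    have h2 := G.continuous
    exact Continuous.aestronglyMeasurable (by fun_prop)
  have e1 : (∑ i, coordForm i (∫ Y, F Y * derivs (i :: l) G (X - Y))) =
      ∫ Y, ∑ i, coordForm i (F Y * derivs (i :: l) G (X - Y)) := by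
    rw [integral_finsetSum _ fun i _ => (coordForm i).integrable_comp (hint _ X)]
    refine Finset.sum_congr rfl fun i _ => ?_
    exact ((coordForm i).integral_comp_comm (hint _ X)).symm
  change HasFDerivAt (fun X => ∫ Y, F Y * derivs l G (X - Y))
    (∑ i, coordForm i (∫ Y, F Y * derivs (i :: l) G (X - Y))) X
  rw [e1]
  choose D hD0 hD using fun i => exists_decay (derivs (i :: l) G) 0
  have hcont2 : Continuous (fun Y => ∑ i, coordForm i (F Y * derivs (i :: l) G (X - Y))) :=
    continuous_finsetSum _ fun i _ => (coordForm i).continuous.comp (hcont _ X)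
  exact hasFDerivAt_integral_of_dominated_of_fderiv_le (s := Set.univ)
    (F' := fun X Y => ∑ i, coordForm i (F Y * derivs (i :: l) G (X - Y)))
    (bound := fun Y => ‖F Y‖ *
      ∑ i, ‖(coordForm i : ℂ →L[ℝ] (EuclideanSpace ℝ ι →L[ℝ] ℂ))‖ * D i) Filter.univ_mem
    (Filter.Eventually.of_forall fun X => (hcont _ X).aestronglyMeasurable)
    (hint _ X) hcont2.aestronglyMeasurable
    (Filter.Eventually.of_forall fun Y X _ => by
      refine (norm_sum_le _ _).trans ?_
      rw [Finset.mul_sum]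
      refine Finset.sum_le_sum fun i _ => ((coordForm i).le_opNorm _).trans ?_
      rw [norm_mul, mul_left_comm]
      have := hD i (X - Y)
      rw [pow_zero, one_mul] at this
      gcongr)
    (hF.norm.mul_const _)
    (Filter.Eventually.of_forall fun Y X _ => by
      have h1 := ((hasFDerivAt_sch (derivs l G) (X - Y)).comp X
        ((hasFDerivAt_id X).sub_const Y)).const_mul (F Y)
      refine h1.congr_fderiv ?_
      ext U
      simp [derivs_cons, Finset.mul_sum, coordForm]
      refine Finset.sum_congr rfl fun i _ => ?_
      ring)

theorem IsDerivFamily.derivs_eq {𝒢 : List ι → EuclideanSpace ℝ ι → ℂ} (h : IsDerivFamily 𝒢)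
    {Q : Sch ι} (hQ : ⇑Q = 𝒢 []) (l : List ι) : ⇑(derivs l Q) = 𝒢 l := by
  induction l with
  | nil => exact hQ
  | cons i l ih =>
    ext X
    rw [derivs_cons, pderiv_eq_of_hasFDerivAt (F := derivs l Q) (ih ▸ h l X)]
    simp

/-- The products of the values of a test function with the translates of another one are
integrable in the Banach space of a fixed step. -/
theorem exists_decay_translate {s σ : ι → ℝ} (hs : ∀ i, 0 < s i) {F : Sch ι}
    (hF : (F : EuclideanSpace ℝ ι → ℂ) ∈ testSpace s σ) {h C : ℝ} (hh : 1 ≤ h) {G : Sch ι}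
    (hG : HasBound s σ h C G) (r : ℕ) :
    ∃ H D : ℝ, 1 ≤ H ∧ 0 ≤ D ∧ ∀ (c : ℝ), 0 ≤ c → c ≤ 1 → ∀ Y : EuclideanSpace ℝ ι,
      ∀ (α : ι → ℕ) (l : List ι) (X : EuclideanSpace ℝ ι),
      (1 + ‖Y‖) ^ r * ‖F Y‖ * (|∏ i, X i ^ α i| * ‖derivs l G (X - c • Y)‖) ≤
        D * H ^ ((∑ i, α i) + l.length) * (facPow s α * facPow σ (cnt l)) := by
  obtain ⟨hF', CF, hF1, hFb⟩ := exists_hasBound_one_le hF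
  obtain ⟨K, H, hK, hH, hb⟩ := shift_bound (fun i => (hs i).le) hF' hF1 r
  have hCF := hFb.nonneg
  have hC := hG.nonneg
  refine ⟨2 * max h H, K * CF * C, by linarith [le_max_left h H], by positivity,
    fun c hc0 hc1 Y α l X => ?_⟩
  refine translate_bound (fun i => (hs i).le) (hh.trans (le_max_left h H))
    (hG.mono (by linarith) (le_max_left h H)) (by positivity) (by positivity) (fun β => ?_) α l X
  have h1 := hb σ F CF hFb β [] Y
  simp only [derivs_nil, List.length_nil, add_zero, cnt_nil, facPow_zero, mul_one] at h1
  have h2 : ∏ i, |(c • Y) i| ^ β i ≤ |∏ i, Y i ^ β i| := by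
    rw [Finset.abs_prod]
    refine Finset.prod_le_prod (fun i _ => by positivity) fun i _ => ?_
    rw [abs_pow, PiLp.smul_apply, smul_eq_mul, abs_mul, abs_of_nonneg hc0]
    gcongr
    exact mul_le_of_le_one_left (abs_nonneg _) hc1
  have p := facPow_pos s β
  calc (1 + ‖Y‖) ^ r * ‖F Y‖ * ∏ i, |(c • Y) i| ^ β i
      ≤ (1 + ‖Y‖) ^ r * ‖F Y‖ * |∏ i, Y i ^ β i| := by gcongr
    _ = (1 + ‖Y‖) ^ r * (|∏ i, Y i ^ β i| * ‖F Y‖) := by ring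
    _ ≤ _ := h1
    _ ≤ _ := by
      gcongr
      exact le_max_right h H

theorem IsForm.sub {s σ : ι → ℝ} {U : Sch ι → ℂ} (hU : IsForm s σ U) {F G : Sch ι}
    (hF : (F : EuclideanSpace ℝ ι → ℂ) ∈ testSpace s σ)
    (hG : (G : EuclideanSpace ℝ ι → ℂ) ∈ testSpace s σ) : U (F - G) = U F - U G := by
  have h1 : (((-1 : ℂ) • G : Sch ι) : EuclideanSpace ℝ ι → ℂ) ∈ testSpace s σ :=
    Submodule.smul_mem _ (-1 : ℂ) hG
  rw [sub_eq_add_neg, ← neg_one_smul ℂ, hU.add _ _ hF h1, hU.smul _ _ hG]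
  ring

/-- The values of a continuous linear form on the translates of a test function depend
continuously on the translation. -/
theorem IsForm.continuous_translate {s σ : ι → ℝ} {U : Sch ι → ℂ} (hU : IsForm s σ U)
    (hs : ∀ i, 0 < s i) (hσ : ∀ i, 0 ≤ σ i) {G : Sch ι}
    (hG : (G : EuclideanSpace ℝ ι → ℂ) ∈ testSpace s σ) :
    Continuous fun Y => U (translate Y G) := by
  obtain ⟨h, C, hh, hGb⟩ := exists_hasBound_one_le hG
  refine LocallyLipschitz.continuous fun Y₀ => ?_
  obtain ⟨B, hB, hBb⟩ := translate_sub_bound hs hσ hh hGb (‖Y₀‖ + 1)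
  obtain ⟨K, hK, hKb⟩ := hU.bounded (2 * h * (2 : ℝ) ^ (∑ i, σ i)) (by positivity)
  refine ⟨Real.toNNReal (K * B), Metric.closedBall Y₀ 1, Metric.closedBall_mem_nhds _ one_pos,
    LipschitzOnWith.of_dist_le_mul fun Y hY Z hZ => ?_⟩
  have hball : ∀ Y ∈ Metric.closedBall Y₀ 1, ‖Y‖ ≤ ‖Y₀‖ + 1 := fun Y hY =>
    norm_le_norm_add_const_of_dist_le (Metric.mem_closedBall.1 hY)
  rw [dist_eq_norm, dist_eq_norm, ← hU.sub (translate_mem hs hG Y) (translate_mem hs hG Z),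
    Real.coe_toNNReal _ (by positivity), mul_assoc]
  exact hKb _ _ (hBb Y Z (hball Y hY) (hball Z hZ))

/-- A continuous linear form can be interchanged with the integral that defines a convolution.  The
integral is a Bochner integral of bounded families, to which the form is extended. -/
theorem IsForm.exists_conv {s σ : ι → ℝ} {U : Sch ι → ℂ} (hU : IsForm s σ U)
    (hs : ∀ i, 0 < s i) (hσ : ∀ i, 0 ≤ σ i) {F G : Sch ι}
    (hF : (F : EuclideanSpace ℝ ι → ℂ) ∈ testSpace s σ)
    (hG : (G : EuclideanSpace ℝ ι → ℂ) ∈ testSpace s σ) :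
    ∃ Q : Sch ι, (∀ X, Q X = ∫ Y, F Y * G (X - Y)) ∧ U Q = ∫ Y, F Y * U (translate Y G) := by
  obtain ⟨h, C, hh, hGb⟩ := exists_hasBound_one_le hG
  obtain ⟨H₁, D, hH₁, hD, hDb⟩ := exists_decay_translate hs hF hh hGb
    (Module.finrank ℝ (EuclideanSpace ℝ ι) + 1)
  set T : ℝ := 2 * h * (2 : ℝ) ^ (∑ i, σ i) with hT
  have hhT : 2 * h ≤ T := by
    have : (1 : ℝ) ≤ (2 : ℝ) ^ (∑ i, σ i) :=
      Real.one_le_rpow (by norm_num) (Finset.sum_nonneg fun i _ => hσ i)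
    nlinarith
  set H := max H₁ T with hH
  have hH0 : 0 < H := lt_max_of_lt_left (by linarith)
  obtain ⟨A, hA⟩ := hU.exists_extension hH0
  have hmem : ∀ Y, translate Y G ∈ stepSpace s σ H := fun Y => by
    obtain ⟨B, -, hB⟩ := translate_mem_bound hs hh hGb ‖Y‖
    exact ⟨_, (hB Y le_rfl).mono (by linarith) (hhT.trans (le_max_right _ _))⟩
  set τ : EuclideanSpace ℝ ι → stepSpace s σ H := fun Y => ⟨translate Y G, hmem Y⟩ with hτ
  set v : EuclideanSpace ℝ ι → lp (fun _ : JetIndex ι => ℂ) ∞ :=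
    fun Y => F Y • jet s σ hH0 (τ Y) with hv
  have hcont : Continuous fun Y => jet s σ hH0 (τ Y) := by
    refine LocallyLipschitz.continuous fun Y₀ => ?_
    obtain ⟨B, hB, hBb⟩ := translate_sub_bound hs hσ hh hGb (‖Y₀‖ + 1)
    refine ⟨Real.toNNReal B, Metric.closedBall Y₀ 1, Metric.closedBall_mem_nhds _ one_pos,
      LipschitzOnWith.of_dist_le_mul fun Y hY Z hZ => ?_⟩
    have hball : ∀ Y ∈ Metric.closedBall Y₀ 1, ‖Y‖ ≤ ‖Y₀‖ + 1 := fun Y hY =>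
      norm_le_norm_add_const_of_dist_le (Metric.mem_closedBall.1 hY)
    rw [dist_eq_norm, dist_eq_norm, ← map_sub, Real.coe_toNNReal _ hB]
    exact norm_jet_le hH0 ((hBb Y Z (hball Y hY) (hball Z hZ)).mono (by positivity)
      (le_max_right _ _))
  -- the norm of the vector `v Y` is controlled by `exists_decay_translate`
  have hvint : Integrable v := by
    refine integrable_of_decay volume (D := D)
      (F.continuous.smul hcont).aestronglyMeasurable fun Y => ?_
    rw [hv, norm_smul, ← mul_assoc]
    rcases (norm_nonneg (F Y)).eq_or_lt with h0 | h0
    · rw [← h0]; simpa using hD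
    · have hp : 0 < (1 + ‖Y‖) ^ (Module.finrank ℝ (EuclideanSpace ℝ ι) + 1) * ‖F Y‖ := by
        positivity
      rw [mul_comm, ← le_div_iff₀ hp]
      refine norm_jet_le hH0 (hasBound_iff.2 fun α l X => ?_)
      have h1 := hDb 1 zero_le_one le_rfl Y α l X
      rw [one_smul, ← translate_apply, ← derivs_translate] at h1
      have p1 := facPow_pos s α
      have p2 := facPow_pos σ (cnt l)
      rw [div_mul_eq_mul_div, div_mul_eq_mul_div, le_div_iff₀ hp, mul_comm]
      refine h1.trans ?_
      gcongr
      exact le_max_left _ _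
  -- evaluations are continuous, so the integral is the family of the convolution
  have hcoord : ∀ t, (∫ Y, v Y : lp (fun _ : JetIndex ι => ℂ) ∞) t =
      ((∏ i, t.2.2 i ^ t.1 i : ℝ) : ℂ) * (∫ Y, F Y * derivs t.2.1 G (t.2.2 - Y)) *
        ((stepWeight s σ H t.1 t.2.1)⁻¹ : ℝ) := by
    intro t
    rw [← lpEval_apply, ← (lpEval t).integral_comp_comm hvint, ← integral_const_mul,
      ← integral_mul_const]
    congr 1
    ext Y
    rw [hv, map_smul, lpEval_apply, jet_apply, jetFun, smul_eq_mul]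
    simp only [hτ, derivs_translate, translate_apply]
    ring
  have hfam := isDerivFamily_conv F G
  have hQb : HasBound s σ H ‖∫ Y, v Y‖ (fun X => ∫ Y, F Y * derivs [] G (X - Y)) := by
    refine hasBound_of_family hfam fun α l X => ?_
    have h1 := lp.norm_apply_le_norm ENNReal.top_ne_zero (∫ Y, v Y) (α, l, X)
    have hw := stepWeight_pos s σ hH0 α l
    rw [hcoord, norm_mul, norm_mul, Complex.norm_real, Complex.norm_real, Real.norm_eq_abs,
      Real.norm_eq_abs, abs_of_pos (inv_pos.2 hw), ← div_eq_mul_inv, div_le_iff₀ hw] at h1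
    rw [mul_assoc ‖∫ Y, v Y‖]
    exact h1
  obtain ⟨Q, hQ⟩ := hQb.exists_sch
  refine ⟨Q, fun X => congrFun hQ X, ?_⟩
  have hQmem : Q ∈ stepSpace s σ H := ⟨_, by rw [hQ]; exact hQb⟩
  have hjet : jet s σ hH0 ⟨Q, hQmem⟩ = ∫ Y, v Y := by
    ext t
    rw [hcoord, jet_apply, jetFun, hfam.derivs_eq hQ]
  rw [← hA ⟨Q, hQmem⟩, hjet, ← A.integral_comp_comm hvint]
  congr 1
  ext Y
  rw [hv, map_smul, hA, smul_eq_mul]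

/-- Both ways to evaluate a continuous linear form on a convolution agree, as `F * G = G * F`. -/
theorem IsForm.integral_comm {s σ : ι → ℝ} {U : Sch ι → ℂ} (hU : IsForm s σ U)
    (hs : ∀ i, 0 < s i) (hσ : ∀ i, 0 ≤ σ i) {F G : Sch ι}
    (hF : (F : EuclideanSpace ℝ ι → ℂ) ∈ testSpace s σ)
    (hG : (G : EuclideanSpace ℝ ι → ℂ) ∈ testSpace s σ) :
    ∫ Y, F Y * U (translate Y G) = ∫ Y, G Y * U (translate Y F) := by
  obtain ⟨Q, hQ, h1⟩ := hU.exists_conv hs hσ hF hG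
  obtain ⟨Q', hQ', h2⟩ := hU.exists_conv hs hσ hG hF
  have : Q = Q' := by
    ext X
    rw [hQ, hQ', ← integral_sub_left_eq_self _ volume X]
    congr 1
    ext Y
    rw [sub_sub_cancel, mul_comm]
  rw [← h1, ← h2, this]

/-- The values on translates are dominated uniformly when the translations are scaled down. -/
theorem IsForm.exists_decay {s σ : ι → ℝ} {U : Sch ι → ℂ} (hU : IsForm s σ U)
    (hs : ∀ i, 0 < s i) {F G : Sch ι}
    (hF : (F : EuclideanSpace ℝ ι → ℂ) ∈ testSpace s σ)
    (hG : (G : EuclideanSpace ℝ ι → ℂ) ∈ testSpace s σ) (r : ℕ) :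
    ∃ D : ℝ, ∀ c : ℝ, 0 ≤ c → c ≤ 1 → ∀ Y,
      (1 + ‖Y‖) ^ r * (‖F Y‖ * ‖U (translate (c • Y) G)‖) ≤ D := by
  obtain ⟨h, C, hh, hGb⟩ := exists_hasBound_one_le hG
  obtain ⟨H, D, hH, hD, hDb⟩ := exists_decay_translate hs hF hh hGb r
  obtain ⟨K, hK, hKb⟩ := hU.bounded H (by linarith)
  refine ⟨K * D, fun c hc0 hc1 Y => ?_⟩
  rcases (norm_nonneg (F Y)).eq_or_lt with h0 | h0
  · rw [← h0]; simp; positivity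
  · have hp : 0 < (1 + ‖Y‖) ^ r * ‖F Y‖ := by positivity
    rw [← mul_assoc, mul_comm, ← le_div_iff₀ hp, mul_div_assoc]
    refine hKb _ _ (hasBound_iff.2 fun α l X => ?_)
    have h1 := hDb c hc0 hc1 Y α l X
    rw [← translate_apply, ← derivs_translate] at h1
    rw [div_mul_eq_mul_div, div_mul_eq_mul_div, le_div_iff₀ hp, mul_comm]
    exact h1

/-! ### Forms that agree on the translates and dilates of one function -/

/-- The dilation by `c ≠ 0`. -/
noncomputable def dilation (ι : Type) [Fintype ι] {c : ℝ} (hc : c ≠ 0) :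
    EuclideanSpace ℝ ι ≃L[ℝ] EuclideanSpace ℝ ι :=
  LinearEquiv.toContinuousLinearEquiv (LinearEquiv.smulOfNeZero ℝ (EuclideanSpace ℝ ι) c hc)

@[simp] theorem dilation_apply {c : ℝ} (hc : c ≠ 0) (X : EuclideanSpace ℝ ι) :
    dilation ι hc X = c • X := rfl

theorem translate_compEquiv (A : EuclideanSpace ℝ ι ≃L[ℝ] EuclideanSpace ℝ ι)
    (Z : EuclideanSpace ℝ ι) (F : Sch ι) :
    translate Z (compEquiv A F) = compEquiv A (translate (A Z) F) := by
  ext X; simp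

theorem translate_zero (F : Sch ι) : translate 0 F = F := by
  ext X; simp

/-- The mean values over smaller and smaller translations converge to the value of the form. -/
theorem IsForm.tendsto_integral_dilate {s σ : ι → ℝ} {U : Sch ι → ℂ} (hU : IsForm s σ U)
    (hs : ∀ i, 0 < s i) (hσ : ∀ i, 0 ≤ σ i) {F G : Sch ι}
    (hF : (F : EuclideanSpace ℝ ι → ℂ) ∈ testSpace s σ)
    (hG : (G : EuclideanSpace ℝ ι → ℂ) ∈ testSpace s σ) :
    Filter.Tendsto (fun n : ℕ => ∫ Y, F Y * U (translate (((n : ℝ) + 1)⁻¹ • Y) G)) Filter.atTop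
      (nhds ((∫ Y, F Y) * U G)) := by
  obtain ⟨D, hD⟩ := hU.exists_decay hs hF hG (Module.finrank ℝ (EuclideanSpace ℝ ι) + 1)
  have hcont := hU.continuous_translate hs hσ hG
  rw [← integral_mul_const]
  refine tendsto_integral_of_dominated_convergence
    (fun Y => D * ((1 + ‖Y‖) ^ (Module.finrank ℝ (EuclideanSpace ℝ ι) + 1))⁻¹) (fun n => ?_)
    ((integrable_decay volume).const_mul D)
    (fun n => Filter.Eventually.of_forall fun Y => ?_) (Filter.Eventually.of_forall fun Y => ?_)
  · exact (F.continuous.mul (hcont.comp (continuous_const_smul _))).aestronglyMeasurable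
  · rw [← div_eq_mul_inv, le_div_iff₀ (by positivity), mul_comm, norm_mul]
    refine hD _ (by positivity) (inv_le_one_of_one_le₀ ?_) Y
    have : (0 : ℝ) ≤ n := n.cast_nonneg
    linarith
  · have h1 : Filter.Tendsto (fun n : ℕ => ((n : ℝ) + 1)⁻¹ • Y) Filter.atTop (nhds 0) := by
      have := (tendsto_one_div_add_atTop_nhds_zero_nat (𝕜 := ℝ)).smul_const Y
      simpa using this
    have h2 := (hcont.tendsto 0).comp h1
    rw [translate_zero] at h2
    exact h2.const_mul _

/-- The exchange of `g` and `Φ` for a pulled back form.  Only the pullbacks of `g` and `Φ` have to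
lie in the test space. -/
theorem IsForm.integral_mul_translate {s σ : ι → ℝ} {U : Sch ι → ℂ} (hU : IsForm s σ U)
    (hs : ∀ i, 0 < s i) (hσ : ∀ i, 0 ≤ σ i) (A : EuclideanSpace ℝ ι ≃L[ℝ] EuclideanSpace ℝ ι)
    {Φ g : Sch ι} (hΦ : (compEquiv A Φ : EuclideanSpace ℝ ι → ℂ) ∈ testSpace s σ)
    (hg : (compEquiv A g : EuclideanSpace ℝ ι → ℂ) ∈ testSpace s σ) :
    ∫ Y, g Y * U (compEquiv A (translate Y Φ)) = ∫ Y, Φ Y * U (compEquiv A (translate Y g)) := by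
  obtain ⟨c, hc, h, -⟩ := exists_integral_comp_equiv volume volume A
  have hc' : (c : ℂ) ≠ 0 := by exact_mod_cast hc.ne'
  refine mul_left_cancel₀ hc' ?_
  rw [← h, ← h]
  have := hU.integral_comm hs hσ hg hΦ
  simpa only [translate_compEquiv, compEquiv_apply] using this

/-- If two pulled back forms agree on the translates and dilates of a function with non-zero
integral, then they agree wherever both are defined: such functions are approximate identities
for the convolution. -/
theorem eq_of_eq_on_translates {s₁ σ₁ s₂ σ₂ : ι → ℝ} {U₁ U₂ : Sch ι → ℂ} (hU₁ : IsForm s₁ σ₁ U₁)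
    (hU₂ : IsForm s₂ σ₂ U₂) (hs₁ : ∀ i, 0 < s₁ i) (hσ₁ : ∀ i, 0 ≤ σ₁ i) (hs₂ : ∀ i, 0 < s₂ i)
    (hσ₂ : ∀ i, 0 ≤ σ₂ i) (A₁ A₂ : EuclideanSpace ℝ ι ≃L[ℝ] EuclideanSpace ℝ ι) {g : Sch ι}
    (hg₁ : ∀ (c : ℝ) (hc : c ≠ 0),
      (compEquiv A₁ (compEquiv (dilation ι hc) g) : EuclideanSpace ℝ ι → ℂ) ∈ testSpace s₁ σ₁)
    (hg₂ : ∀ (c : ℝ) (hc : c ≠ 0),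
      (compEquiv A₂ (compEquiv (dilation ι hc) g) : EuclideanSpace ℝ ι → ℂ) ∈ testSpace s₂ σ₂)
    (hg : ∀ (c : ℝ) (hc : c ≠ 0) (Y : EuclideanSpace ℝ ι),
      U₁ (compEquiv A₁ (translate Y (compEquiv (dilation ι hc) g))) =
        U₂ (compEquiv A₂ (translate Y (compEquiv (dilation ι hc) g))))
    (hg0 : ∫ Y, g Y ≠ 0) {Φ : Sch ι}
    (hΦ₁ : (compEquiv A₁ Φ : EuclideanSpace ℝ ι → ℂ) ∈ testSpace s₁ σ₁)
    (hΦ₂ : (compEquiv A₂ Φ : EuclideanSpace ℝ ι → ℂ) ∈ testSpace s₂ σ₂) :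
    U₁ (compEquiv A₁ Φ) = U₂ (compEquiv A₂ Φ) := by
  have hone : compEquiv (dilation ι one_ne_zero) g = g := by ext X; simp
  -- the two smoothed values agree at every scale
  have h1 : ∀ n : ℕ, ∫ Y, g Y * U₁ (compEquiv A₁ (translate (((n : ℝ) + 1)⁻¹ • Y) Φ)) =
      ∫ Y, g Y * U₂ (compEquiv A₂ (translate (((n : ℝ) + 1)⁻¹ • Y) Φ)) := by
    intro n
    have hn : (n : ℝ) + 1 ≠ 0 := by positivity
    obtain ⟨c, hc, h, -⟩ := exists_integral_comp_equiv volume volume (dilation ι hn)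
    have hc' : (c : ℂ) ≠ 0 := by exact_mod_cast hc.ne'
    refine mul_left_cancel₀ hc' ?_
    rw [← h, ← h]
    simp only [dilation_apply, inv_smul_smul₀ hn]
    -- after the exchange, only translates of a dilate of `g` are left in the forms
    have e1 := hU₁.integral_mul_translate hs₁ hσ₁ A₁ hΦ₁ (hg₁ _ hn)
    have e2 := hU₂.integral_mul_translate hs₂ hσ₂ A₂ hΦ₂ (hg₂ _ hn)
    simp only [hg _ hn] at e1
    rw [← e2] at e1
    exact e1
  -- both sides converge as the scale tends to zero
  have key : ∀ {s σ : ι → ℝ} {U : Sch ι → ℂ} (_ : IsForm s σ U) (_ : ∀ i, 0 < s i)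
      (_ : ∀ i, 0 ≤ σ i) (A : EuclideanSpace ℝ ι ≃L[ℝ] EuclideanSpace ℝ ι)
      (_ : (compEquiv A g : EuclideanSpace ℝ ι → ℂ) ∈ testSpace s σ)
      (_ : (compEquiv A Φ : EuclideanSpace ℝ ι → ℂ) ∈ testSpace s σ),
      Filter.Tendsto (fun n : ℕ => ∫ Y, g Y * U (compEquiv A (translate (((n : ℝ) + 1)⁻¹ • Y) Φ)))
        Filter.atTop (nhds ((∫ Y, g Y) * U (compEquiv A Φ))) := by
    intro s σ U hU hs hσ A hgA hΦA
    obtain ⟨c, hc, h, -⟩ := exists_integral_comp_equiv volume volume A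
    have hc' : (c : ℂ) ≠ 0 := by exact_mod_cast hc.ne'
    have h2 := (hU.tendsto_integral_dilate hs hσ hgA hΦA).const_mul (c : ℂ)⁻¹
    have e : ∀ f : EuclideanSpace ℝ ι → ℂ, ∫ Y, f Y = (c : ℂ)⁻¹ * ∫ Z, f (A Z) := fun f => by
      rw [h, inv_mul_cancel_left₀ hc']
    rw [e g]
    simp only [e fun Y => g Y * U (compEquiv A (translate (_ • Y) Φ))]
    simpa only [translate_compEquiv, compEquiv_apply, map_smul, mul_assoc] using h2
  have t1 := key hU₁ hs₁ hσ₁ A₁ (hone ▸ hg₁ 1 one_ne_zero) hΦ₁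
  have t2 := key hU₂ hs₂ hσ₂ A₂ (hone ▸ hg₂ 1 one_ne_zero) hΦ₂
  simp only [h1] at t1
  exact mul_left_cancel₀ hg0 (tendsto_nhds_unique t1 t2)

/-! ### Symbols as forms on the space of kernels -/

theorem partialFourier_four {e : κ → ι} (he : Function.Injective e) (G : Sch ι) :
    partialFourier he (partialFourier he (partialFourier he (partialFourier he G))) =
      (((2 * Real.pi) ^ Fintype.card κ : ℝ) * ((2 * Real.pi) ^ Fintype.card κ : ℝ) : ℂ) • G := by
  ext Y
  rw [partialFourier_partialFourier, partialFourier_partialFourier, smul_apply, smul_eq_mul,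
    upd_upd he, res_upd he, neg_neg, upd_res, mul_assoc]

theorem partialFourier_add {e : κ → ι} (he : Function.Injective e) (F G : Sch ι) :
    partialFourier he (F + G) = partialFourier he F + partialFourier he G := by
  ext Y
  rw [add_apply, partialFourier_apply, partialFourier_apply, partialFourier_apply, pf, pf, pf,
    ← integral_add (integrable_pfIntegrand he F Y) (integrable_pfIntegrand he G Y)]
  congr 1
  ext v
  simp only [pfIntegrand, add_apply]
  ring

theorem swapExp_swapExp {M : Type} (e : κ → ι) (s σ : ι → M) :
    swapExp e (swapExp e s σ) (swapExp e σ s) = s := by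
  ext i
  simp only [swapExp]
  split_ifs <;> rfl

theorem swapExp_pred {M : Type} (e : κ → ι) {s σ : ι → M} {P : M → Prop} (hs : ∀ i, P (s i))
    (hσ : ∀ i, P (σ i)) (i : ι) : P (swapExp e s σ i) := by
  unfold swapExp
  split_ifs
  · exact hσ i
  · exact hs i

theorem one_le_swapExp_add (e : κ → ι) {s σ : ι → ℝ} (h : ∀ i, 1 ≤ s i + σ i) (i : ι) :
    1 ≤ swapExp e s σ i + swapExp e σ s i := by
  have := h i
  unfold swapExp
  split_ifs <;> linarith

/-- The converse direction holds because four Fourier transforms give a multiple of the identity. -/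
theorem partialFourier_mem_iff {e : κ → ι} (he : Function.Injective e) {s σ : ι → ℝ}
    (hs : ∀ i, 0 ≤ s i) (hσ : ∀ i, 0 ≤ σ i) (hsσ : ∀ i, 1 ≤ s i + σ i) {G : Sch ι} :
    (partialFourier he G : EuclideanSpace ℝ ι → ℂ) ∈ testSpace (swapExp e s σ) (swapExp e σ s) ↔
      (G : EuclideanSpace ℝ ι → ℂ) ∈ testSpace s σ := by
  refine ⟨fun h => ?_, partialFourier_mem he hs hσ hsσ⟩
  have h0 : (((2 * Real.pi) ^ Fintype.card κ : ℝ) * ((2 * Real.pi) ^ Fintype.card κ : ℝ) : ℂ) ≠ 0 := by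
    rw [← Complex.ofReal_mul, Complex.ofReal_ne_zero]; positivity
  have h1 := partialFourier_mem he (swapExp_pred e hs hσ) (swapExp_pred e hσ hs)
    (one_le_swapExp_add e hsσ) h
  rw [swapExp_swapExp, swapExp_swapExp] at h1
  have h2 := partialFourier_mem he hs hσ hsσ h1
  have h3 := partialFourier_mem he (swapExp_pred e hs hσ) (swapExp_pred e hσ hs)
    (one_le_swapExp_add e hsσ) h2
  rw [swapExp_swapExp, swapExp_swapExp, partialFourier_four] at h3
  exact (Submodule.smul_mem_iff _ h0).1 h3

theorem IsForm.comp_partialFourier {e : κ → ι} (he : Function.Injective e) {s σ : ι → ℝ}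
    (hs : ∀ i, 0 ≤ s i) (hσ : ∀ i, 0 ≤ σ i) (hsσ : ∀ i, 1 ≤ s i + σ i) {U : Sch ι → ℂ}
    (hU : IsForm (swapExp e s σ) (swapExp e σ s) U) :
    IsForm s σ fun G => U (partialFourier he G) where
  add F G hF hG := by
    rw [partialFourier_add]
    exact hU.add _ _ (partialFourier_mem he hs hσ hsσ hF) (partialFourier_mem he hs hσ hsσ hG)
  smul c F hF := by
    rw [partialFourier_smul]
    exact hU.smul _ _ (partialFourier_mem he hs hσ hsσ hF)
  bounded h h0 := by
    obtain ⟨K, H, hH, hb⟩ := partialFourier_bound he hs hσ hsσ (le_max_right h 1)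
    obtain ⟨K', hK', hb'⟩ := hU.bounded H (by linarith)
    refine ⟨K' * max K 0, by positivity, fun C F hF => ?_⟩
    have hC := hF.nonneg
    refine (hb' _ _ (hb F C (hF.mono h0 (le_max_left _ _)))).trans ?_
    rw [mul_assoc]
    gcongr
    exact le_max_left _ _

theorem Distribution.isForm {s σ : ι → ℝ} (a : Distribution s σ) :
    IsForm s σ fun F => a.pair F where
  add F G hF hG := by
    have h : ((F + G : Sch ι) : EuclideanSpace ℝ ι → ℂ) ∈ testSpace s σ :=
      Submodule.add_mem _ hF hG
    simp only [Distribution.pair, dif_pos hF, dif_pos hG, dif_pos h]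
    exact a.toLinearMap.map_add ⟨F, hF⟩ ⟨G, hG⟩
  smul c F hF := by
    have h : ((c • F : Sch ι) : EuclideanSpace ℝ ι → ℂ) ∈ testSpace s σ :=
      Submodule.smul_mem _ c hF
    simp only [Distribution.pair, dif_pos hF, dif_pos h]
    exact a.toLinearMap.map_smul c ⟨F, hF⟩
  bounded h h0 := by
    obtain ⟨K, hK⟩ := a.bounded h h0
    refine ⟨max K 0, le_max_right _ _, fun C F hF => ?_⟩
    have hmem : (F : EuclideanSpace ℝ ι → ℂ) ∈ testSpace s σ := ⟨h, C, h0, hF⟩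
    simp only [Distribution.pair, dif_pos hmem]
    refine (hK C ⟨F, hmem⟩ hF).trans ?_
    have := hF.nonneg
    gcongr
    exact le_max_left _ _

/-- Exponents on `ℝ³ᵈ` that depend on the block only. -/
def blockExp (d : ℕ) (s : Fin 3 → ℝ) : Fin 3 × Fin d → ℝ := fun p => s p.1

/-- The exponents of the symbols arise from those of the kernels by exchanging `s` and `σ` in the
last two blocks. -/
theorem symbolDecay_eq (s σ : Fin 3 → ℝ) : symbolDecay d s σ =
    swapExp (blockIdx d 1) (swapExp (blockIdx d 2) (blockExp d s) (blockExp d σ))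
      (swapExp (blockIdx d 2) (blockExp d σ) (blockExp d s)) := by
  ext ⟨j, k⟩
  simp only [swapExp, mem_range_blockIdx, symbolDecay, blockExp]
  fin_cases j <;> simp

theorem symbolReg_eq (s σ : Fin 3 → ℝ) : symbolReg d s σ =
    swapExp (blockIdx d 1) (swapExp (blockIdx d 2) (blockExp d σ) (blockExp d s))
      (swapExp (blockIdx d 2) (blockExp d s) (blockExp d σ)) := by
  ext ⟨j, k⟩
  simp only [swapExp, mem_range_blockIdx, symbolReg, blockExp]
  fin_cases j <;> simp

/-! ### Entire functions with decay along the real axis -/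

/-- `F` is entire, non-negative on the real axis, non-zero at the origin, and satisfies
`|F (x + i y)| ≤ C exp (-c |x| ^ p + b |y| ^ p)`. -/
structure IsEntireWindow (p : ℝ) (F : ℂ → ℂ) : Prop where
  differentiable : Differentiable ℂ F
  nonneg : ∀ x : ℝ, ∃ y : ℝ, 0 ≤ y ∧ F x = y
  ne_zero : F 0 ≠ 0
  bound : ∃ C c b : ℝ, 0 < C ∧ 0 < c ∧ 0 < b ∧ ∀ z : ℂ,
    ‖F z‖ ≤ C * Real.exp (-c * |z.re| ^ p + b * |z.im| ^ p)

theorem isEntireWindow_gaussian : IsEntireWindow 2 fun z => Complex.exp (-z ^ 2) where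
  differentiable := by fun_prop
  nonneg x := ⟨Real.exp (-x ^ 2), (Real.exp_pos _).le, by push_cast; rfl⟩
  ne_zero := Complex.exp_ne_zero _
  bound := by
    refine ⟨1, 1, 1, one_pos, one_pos, one_pos, fun z => ?_⟩
    rw [Complex.norm_exp, one_mul, Real.rpow_two, Real.rpow_two, sq_abs, sq_abs]
    refine le_of_eq ?_
    congr 1
    simp only [sq, Complex.neg_re, Complex.mul_re]
    ring

/-- The sum is at most a multiple of `|y| ^ p`, up to a bounded term: it is dominated by
`2 ^ ((p - 1) j) |y|` while `2 ^ j ≤ |y|`, and by `2 ^ ((p - 2) j) y ^ 2` afterwards. -/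
theorem sum_min_le {p : ℝ} (h1 : 1 < p) (h2 : p < 2) : ∃ B : ℝ, 0 ≤ B ∧ ∀ (N : ℕ) (y : ℝ),
    ∑ j ∈ Finset.range N, ((2 : ℝ) ^ p) ^ j * min |y / 2 ^ j| ((y / 2 ^ j) ^ 2) ≤
      B * |y| ^ p + B := by
  set Q : ℝ := (2 : ℝ) ^ p with hQ
  have hQ2 : 2 < Q := by
    have := Real.rpow_lt_rpow_of_exponent_lt (x := 2) (by norm_num) h1
    simpa using this
  have hQ4 : Q < 4 := by
    have := Real.rpow_lt_rpow_of_exponent_lt (x := 2) (by norm_num) h2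
    rw [Real.rpow_two] at this
    norm_num at this
    exact this
  set A : ℝ := (1 - Q / 4)⁻¹ with hA
  have hA0 : 0 < A := inv_pos.2 (by linarith)
  set D : ℝ := 2 / (Q - 2) with hD
  have hD0 : 0 < D := div_pos (by norm_num) (by linarith)
  have hDQ : 1 + D = Q * D / 2 := by rw [hD]; field_simp [show Q - 2 ≠ 0 by linarith]; ring
  set B : ℝ := Q * (A + D) with hB
  have hAB : A ≤ B := by nlinarith
  have hDB : D ≤ B := by nlinarith
  -- the bound for small `y`
  have hsmall : ∀ (N : ℕ) (y : ℝ),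
      ∑ j ∈ Finset.range N, Q ^ j * min |y / 2 ^ j| ((y / 2 ^ j) ^ 2) ≤ A * y ^ 2 := by
    intro N y
    calc ∑ j ∈ Finset.range N, Q ^ j * min |y / 2 ^ j| ((y / 2 ^ j) ^ 2)
        ≤ ∑ j ∈ Finset.range N, (Q / 4) ^ j * y ^ 2 := by
          refine Finset.sum_le_sum fun j _ => ?_
          refine (mul_le_mul_of_nonneg_left (min_le_right _ _) (by positivity)).trans (le_of_eq ?_)
          have : (4 : ℝ) ^ j = (2 ^ j) ^ 2 := by rw [← pow_mul, mul_comm, pow_mul]; norm_num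
          rw [div_pow, div_pow, this]
          ring
      _ = (∑ j ∈ Finset.range N, (Q / 4) ^ j) * y ^ 2 := by rw [Finset.sum_mul]
      _ ≤ A * y ^ 2 := by
          gcongr
          have hs := hasSum_geometric_of_lt_one (r := Q / 4) (by positivity) (by linarith)
          exact sum_le_hasSum _ (fun _ _ => by positivity) hs
  -- the terms with index `j + 1` are the terms of `y / 2`, up to the factor `Q`; in this induction,
  -- `-D |y|` absorbs the term with index `0`, because `1 + D = Q D / 2`
  have hlarge : ∀ (N : ℕ) (y : ℝ), 1 / 2 ≤ |y| →
      ∑ j ∈ Finset.range N, Q ^ j * min |y / 2 ^ j| ((y / 2 ^ j) ^ 2) ≤ B * |y| ^ p - D * |y| := by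
    have hmid : ∀ y : ℝ, 1 / 2 ≤ |y| → |y| ≤ 1 → A ≤ B * |y| ^ p - D * |y| := by
      intro y hy hy1
      have e1 : Q⁻¹ ≤ |y| ^ p := by
        have := Real.rpow_le_rpow (by norm_num) hy (by linarith : (0 : ℝ) ≤ p)
        rwa [one_div, Real.inv_rpow (by norm_num)] at this
      have e2 : B * Q⁻¹ ≤ B * |y| ^ p := mul_le_mul_of_nonneg_left e1 (by positivity)
      have e3 : B * Q⁻¹ = A + D := by rw [hB]; field_simp
      nlinarith
    intro N
    induction N with
    | zero =>
      intro y hy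
      rw [Finset.sum_range_zero]
      rcases le_total |y| 1 with hy1 | hy1
      · exact hA0.le.trans (hmid y hy hy1)
      · have e1 : |y| ≤ |y| ^ p := by
          simpa using Real.rpow_le_rpow_of_exponent_le hy1 h1.le
        nlinarith [abs_nonneg y]
    | succ N ih =>
      intro y hy
      rcases le_total |y| 1 with hy1 | hy1
      · refine (hsmall _ y).trans (le_trans ?_ (hmid y hy hy1))
        have : y ^ 2 ≤ 1 := by rw [← sq_abs]; exact pow_le_one₀ (abs_nonneg _) hy1
        nlinarith
      · rw [Finset.sum_range_succ']
        have h3 : |y / 2| = |y| / 2 := by rw [abs_div, abs_two]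
        have h4 := ih (y / 2) (by rw [h3]; linarith)
        have e1 : ∑ j ∈ Finset.range N, Q ^ (j + 1) * min |y / 2 ^ (j + 1)| ((y / 2 ^ (j + 1)) ^ 2) =
            Q * ∑ j ∈ Finset.range N, Q ^ j * min |y / 2 / 2 ^ j| ((y / 2 / 2 ^ j) ^ 2) := by
          rw [Finset.mul_sum]
          refine Finset.sum_congr rfl fun j _ => ?_
          rw [div_div, ← pow_succ', pow_succ']
          ring
        have e2 : min |y / 2 ^ 0| ((y / 2 ^ 0) ^ 2) ≤ |y| := by
          refine (min_le_left _ _).trans (le_of_eq ?_)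
          simp
        have e3 : |y / 2| ^ p = |y| ^ p / Q := by
          rw [h3, Real.div_rpow (abs_nonneg _) (by norm_num)]
        rw [e1, pow_zero, one_mul]
        rw [e3, h3] at h4
        have h5 := mul_le_mul_of_nonneg_left h4 (by linarith : (0 : ℝ) ≤ Q)
        have e4 : Q * (B * (|y| ^ p / Q) - D * (|y| / 2)) = B * |y| ^ p - Q * D / 2 * |y| := by
          field_simp
        rw [e4, ← hDQ] at h5
        linarith
  refine ⟨B, by positivity, fun N y => ?_⟩
  have hp : 0 ≤ |y| ^ p := by positivity
  rcases le_total (1 / 2) |y| with hy | hy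
  · refine (hlarge N y hy).trans ?_
    nlinarith [abs_nonneg y]
  · refine (hsmall N y).trans ?_
    have : y ^ 2 ≤ 1 := by rw [← sq_abs]; exact pow_le_one₀ (abs_nonneg _) (by linarith)
    nlinarith

theorem cosh_le_exp_min (v : ℝ) : Real.cosh v ≤ Real.exp (min |v| (v ^ 2)) := by
  rcases min_cases |v| (v ^ 2) with ⟨h, -⟩ | ⟨h, -⟩
  · rw [h, Real.cosh_eq]
    have h1 := Real.exp_le_exp.2 (le_abs_self v)
    have h2 := Real.exp_le_exp.2 (neg_le_abs v)
    linarith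
  · rw [h]
    refine (Real.cosh_le_exp_half_sq v).trans (Real.exp_le_exp.2 ?_)
    nlinarith [sq_nonneg v]

theorem norm_cos_sq (z : ℂ) : ‖Complex.cos z‖ ^ 2 = Real.cos z.re ^ 2 + Real.sinh z.im ^ 2 := by
  have h : Complex.cos z = ⟨Real.cos z.re * Real.cosh z.im, -(Real.sin z.re * Real.sinh z.im)⟩ := by
    conv_lhs => rw [← Complex.re_add_im z, Complex.cos_add_mul_I]
    apply Complex.ext <;> simp [← Complex.ofReal_cos, ← Complex.ofReal_sin, ← Complex.ofReal_cosh,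
      ← Complex.ofReal_sinh]
  rw [h, ← Complex.normSq_eq_norm_sq, Complex.normSq_mk]
  have h1 := Real.sin_sq_add_cos_sq z.re
  have h2 := Real.cosh_sq z.im
  have h3 : Real.sin z.re ^ 2 = 1 - Real.cos z.re ^ 2 := by linarith
  calc _ = Real.cos z.re ^ 2 * Real.cosh z.im ^ 2 + Real.sin z.re ^ 2 * Real.sinh z.im ^ 2 := by ring
    _ = _ := by rw [h2, h3]; ring

theorem norm_cos_sq_le (z : ℂ) : ‖Complex.cos z‖ ^ 2 ≤ Real.exp (2 * min |z.im| (z.im ^ 2)) := by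
  rw [norm_cos_sq]
  have h1 := Real.cosh_sq z.im
  have h2 := Real.cos_sq_le_one z.re
  have h3 := cosh_le_exp_min z.im
  have h4 := pow_le_pow_left₀ (Real.cosh_pos _).le h3 2
  rw [← Real.exp_nat_mul] at h4
  push_cast at h4
  linarith

/-- Near the real axis, and away from the multiples of `π`, the cosine is small. -/
theorem norm_cos_sq_le_of_mem {z : ℂ} (h1 : 1 / 2 ≤ |z.re|) (h2 : |z.re| ≤ 1)
    (h3 : |z.im| ≤ 1 / 4) : ‖Complex.cos z‖ ^ 2 ≤ 10 / 11 := by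
  rw [norm_cos_sq]
  have e1 : Real.cos z.re ^ 2 ≤ 7 / 9 := by
    have h4 : Real.cos |z.re| ≤ Real.cos (1 / 2) :=
      Real.cos_le_cos_of_nonneg_of_le_pi (by norm_num) (by linarith [Real.pi_gt_three]) h1
    rw [Real.cos_abs] at h4
    have h5 : 0 ≤ Real.cos z.re := Real.cos_nonneg_of_neg_pi_div_two_le_of_le
      (by linarith [neg_abs_le z.re, Real.pi_gt_three])
      (by linarith [le_abs_self z.re, Real.pi_gt_three])
    have h6 := Real.cos_sq (1 / 2)
    rw [show 2 * (1 / 2 : ℝ) = 1 by norm_num] at h6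
    have := Real.cos_one_le
    nlinarith
  have e2 : Real.sinh z.im ^ 2 ≤ 1 / 8 := by
    have h4 := Real.cosh_sq z.im
    have h5 := pow_le_pow_left₀ (Real.cosh_pos _).le (Real.cosh_le_exp_half_sq z.im) 2
    rw [← Real.exp_nat_mul] at h5
    have h6 : z.im ^ 2 ≤ 1 / 16 := by
      rw [← sq_abs]; nlinarith [abs_nonneg z.im]
    have h7 : Real.exp ((2 : ℕ) * (z.im ^ 2 / 2)) ≤ 1 + 1 / 8 := by
      have h8 : (2 : ℕ) * (z.im ^ 2 / 2) = z.im ^ 2 := by push_cast; ring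
      rw [h8]
      have h9 : |Real.exp (z.im ^ 2) - 1| ≤ 2 * |z.im ^ 2| :=
        Real.abs_exp_sub_one_le (by rw [abs_of_nonneg (sq_nonneg _)]; linarith)
      rw [abs_of_nonneg (sq_nonneg z.im)] at h9
      have := le_abs_self (Real.exp (z.im ^ 2) - 1)
      linarith
    linarith
  linarith

/-- The multiplicity of the factor with number `j`: `2 ^ (p j)`, rounded up. -/
noncomputable def dyadicNum (p : ℝ) (j : ℕ) : ℕ := ⌈((2 : ℝ) ^ p) ^ j⌉₊

theorem le_dyadicNum (p : ℝ) (j : ℕ) : ((2 : ℝ) ^ p) ^ j ≤ dyadicNum p j := Nat.le_ceil _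

theorem dyadicNum_le {p : ℝ} (hp : 0 ≤ p) (j : ℕ) :
    (dyadicNum p j : ℝ) ≤ 2 * ((2 : ℝ) ^ p) ^ j := by
  have h1 : (1 : ℝ) ≤ ((2 : ℝ) ^ p) ^ j := one_le_pow₀ (Real.one_le_rpow (by norm_num) hp)
  have h2 := Nat.ceil_lt_add_one (by linarith : 0 ≤ ((2 : ℝ) ^ p) ^ j)
  rw [dyadicNum]
  linarith

/-- The factors of the infinite product.  The square makes them non-negative on the real axis. -/
noncomputable def dyadicFactor (p : ℝ) (j : ℕ) (z : ℂ) : ℂ :=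
  (Complex.cos (z / 2 ^ j) ^ 2) ^ dyadicNum p j

theorem div_two_pow_re (z : ℂ) (j : ℕ) : (z / 2 ^ j).re = z.re / 2 ^ j := by
  rw [← Complex.div_ofReal_re]; push_cast; rfl

theorem div_two_pow_im (z : ℂ) (j : ℕ) : (z / 2 ^ j).im = z.im / 2 ^ j := by
  rw [← Complex.div_ofReal_im]; push_cast; rfl

theorem norm_dyadicFactor_le {p : ℝ} (hp : 0 ≤ p) (j : ℕ) (z : ℂ) : ‖dyadicFactor p j z‖ ≤
    Real.exp (4 * (((2 : ℝ) ^ p) ^ j * min |z.im / 2 ^ j| ((z.im / 2 ^ j) ^ 2))) := by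
  have hm : 0 ≤ min |z.im / 2 ^ j| ((z.im / 2 ^ j) ^ 2) := le_min (abs_nonneg _) (sq_nonneg _)
  rw [dyadicFactor, norm_pow, norm_pow]
  refine (pow_le_pow_left₀ (by positivity) (norm_cos_sq_le _) _).trans ?_
  rw [← Real.exp_nat_mul, div_two_pow_im, Real.exp_le_exp]
  have := mul_le_mul_of_nonneg_right (dyadicNum_le hp j) hm
  linarith

/-- The growth in the imaginary direction, and the gain from the one factor for which `z / 2 ^ J` is
in the region of `norm_cos_sq_le_of_mem`. -/
theorem norm_prod_dyadicFactor_le {p : ℝ} (h1 : 1 < p) (h2 : p < 2) :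
    ∃ B : ℝ, 0 ≤ B ∧ ∀ (N : ℕ) (z : ℂ),
      ‖∏ j ∈ Finset.range N, dyadicFactor p j z‖ ≤ Real.exp (B * |z.im| ^ p + B) ∧
      ∀ J < N, 1 / 2 ≤ |z.re| / 2 ^ J → |z.re| / 2 ^ J ≤ 1 → |z.im| ≤ |z.re| / 4 →
        ‖∏ j ∈ Finset.range N, dyadicFactor p j z‖ ≤
          (10 / 11 : ℝ) ^ (dyadicNum p J) * Real.exp (B * |z.im| ^ p + B) := by
  obtain ⟨B, hB, hsum⟩ := sum_min_le h1 h2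
  refine ⟨4 * B, by positivity, fun N z => ?_⟩
  set e : ℕ → ℝ := fun j =>
    Real.exp (4 * (((2 : ℝ) ^ p) ^ j * min |z.im / 2 ^ j| ((z.im / 2 ^ j) ^ 2))) with he
  have he1 : ∀ j, 1 ≤ e j := fun j => by
    have hm : 0 ≤ min |z.im / 2 ^ j| ((z.im / 2 ^ j) ^ 2) := le_min (abs_nonneg _) (sq_nonneg _)
    exact Real.one_le_exp (by positivity)
  have hprod : ∏ j ∈ Finset.range N, e j ≤ Real.exp (4 * B * |z.im| ^ p + 4 * B) := by
    rw [he, ← Real.exp_sum, ← Finset.mul_sum, Real.exp_le_exp]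
    have := hsum N z.im
    linarith
  constructor
  · rw [norm_prod]
    exact (Finset.prod_le_prod (fun _ _ => norm_nonneg _)
      fun j _ => norm_dyadicFactor_le (by linarith) j z).trans hprod
  · intro J hJ hr1 hr2 hi
    have hfac : ∀ j, ‖dyadicFactor p j z‖ ≤
        (if j = J then (10 / 11 : ℝ) ^ dyadicNum p J else 1) * e j := by
      intro j
      split_ifs with hj
      · subst hj
        refine le_trans ?_ (le_mul_of_one_le_right (by positivity) (he1 j))
        rw [dyadicFactor, norm_pow, norm_pow]
        have h2j : (0 : ℝ) < 2 ^ j := by positivity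
        refine pow_le_pow_left₀ (by positivity) (norm_cos_sq_le_of_mem ?_ ?_ ?_) _
        · rwa [div_two_pow_re, abs_div, abs_of_pos h2j]
        · rwa [div_two_pow_re, abs_div, abs_of_pos h2j]
        · rw [div_two_pow_im, abs_div, abs_of_pos h2j]
          have := div_le_div_of_nonneg_right hi h2j.le
          rw [div_right_comm] at this
          linarith
      · rw [one_mul]
        exact norm_dyadicFactor_le (by linarith) j z
    rw [norm_prod]
    refine (Finset.prod_le_prod (fun _ _ => norm_nonneg _) fun j _ => hfac j).trans ?_
    rw [Finset.prod_mul_distrib, Finset.prod_ite_eq' , if_pos (Finset.mem_range.2 hJ)]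
    exact mul_le_mul_of_nonneg_left hprod (by positivity)

theorem norm_sin_le {w : ℂ} (hw : ‖w‖ ≤ 1) : ‖Complex.sin w‖ ≤ 2 * ‖w‖ := by
  have h1 : Complex.sin w =
      ((Complex.exp (-w * Complex.I) - 1) - (Complex.exp (w * Complex.I) - 1)) * Complex.I / 2 := by
    rw [Complex.sin]; ring
  have h2 := Complex.norm_exp_sub_one_le (x := -w * Complex.I) (by simpa using hw)
  have h3 := Complex.norm_exp_sub_one_le (x := w * Complex.I) (by simpa using hw)
  rw [h1, norm_div, norm_mul, Complex.norm_I, mul_one, Complex.norm_ofNat,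
    div_le_iff₀ (by norm_num)]
  refine (norm_sub_le _ _).trans ?_
  simp only [norm_mul, norm_neg, Complex.norm_I, mul_one] at h2 h3
  linarith

theorem norm_one_add_pow_sub_one_le (u : ℂ) (n : ℕ) :
    ‖(1 + u) ^ n - 1‖ ≤ Real.exp (n * ‖u‖) - 1 := by
  have := (Finset.range n).norm_prod_one_add_sub_one_le fun _ => u
  simpa using this

theorem eventually_norm_dyadicFactor_sub_one_le {p : ℝ} (h0 : 0 ≤ p) (h2 : p < 2) (R : ℝ) :
    ∀ᶠ j : ℕ in Filter.atTop, ∀ z : ℂ, ‖z‖ ≤ R →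
      ‖dyadicFactor p j z - 1‖ ≤ 16 * R ^ 2 * ((2 : ℝ) ^ p / 4) ^ j := by
  have hQ4 : (2 : ℝ) ^ p < 4 := by
    have := Real.rpow_lt_rpow_of_exponent_lt (x := 2) (by norm_num) h2
    rw [Real.rpow_two] at this
    norm_num at this
    exact this
  have hQ0 : (0 : ℝ) < 2 ^ p := by positivity
  have t1 : Filter.Tendsto (fun j : ℕ => 8 * R ^ 2 * ((2 : ℝ) ^ p / 4) ^ j) Filter.atTop (nhds 0) := by
    simpa using (tendsto_pow_atTop_nhds_zero_of_lt_one (by positivity)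
      (by linarith : (2 : ℝ) ^ p / 4 < 1)).const_mul (8 * R ^ 2)
  have t2 : Filter.Tendsto (fun j : ℕ => R * (1 / 2 : ℝ) ^ j) Filter.atTop (nhds 0) := by
    simpa using (tendsto_pow_atTop_nhds_zero_of_lt_one (by norm_num)
      (by norm_num : (1 / 2 : ℝ) < 1)).const_mul R
  filter_upwards [t1.eventually_le_const one_pos, t2.eventually_le_const one_pos] with j hj1 hj2 z hz
  have hR : 0 ≤ R := (norm_nonneg _).trans hz
  have e0 : ‖z / 2 ^ j‖ = ‖z‖ / 2 ^ j := by simp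
  have e1 : ‖z / 2 ^ j‖ ≤ 1 := by
    rw [e0]
    refine le_trans ?_ hj2
    rw [one_div, inv_pow, ← div_eq_mul_inv]
    gcongr
  have e2 : dyadicFactor p j z = (1 + -Complex.sin (z / 2 ^ j) ^ 2) ^ dyadicNum p j := by
    rw [dyadicFactor]
    congr 1
    have := Complex.sin_sq_add_cos_sq (z / 2 ^ j)
    linear_combination this
  have e3 : (dyadicNum p j : ℝ) * ‖-Complex.sin (z / 2 ^ j) ^ 2‖ ≤
      8 * R ^ 2 * ((2 : ℝ) ^ p / 4) ^ j := by
    rw [norm_neg, norm_pow]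
    have h4 : (4 : ℝ) ^ j = (2 ^ j) ^ 2 := by rw [← pow_mul, mul_comm, pow_mul]; norm_num
    calc (dyadicNum p j : ℝ) * ‖Complex.sin (z / 2 ^ j)‖ ^ 2
        ≤ (2 * ((2 : ℝ) ^ p) ^ j) * (2 * (R / 2 ^ j)) ^ 2 := by
          have h5 := norm_sin_le e1
          rw [e0] at h5
          have h6 : ‖z‖ / 2 ^ j ≤ R / 2 ^ j := by gcongr
          have := dyadicNum_le h0 j
          gcongr
          linarith
      _ = _ := by rw [div_pow, h4, mul_pow, div_pow]; ring
  rw [e2]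
  refine (norm_one_add_pow_sub_one_le _ _).trans ?_
  set u := (dyadicNum p j : ℝ) * ‖-Complex.sin (z / 2 ^ j) ^ 2‖ with hu
  have hu0 : 0 ≤ u := by positivity
  have h9 : |Real.exp u - 1| ≤ 2 * |u| :=
    Real.abs_exp_sub_one_le (by rw [abs_of_nonneg hu0]; linarith)
  rw [abs_of_nonneg hu0] at h9
  have := le_abs_self (Real.exp u - 1)
  linarith

/-- The infinite product of the dyadic factors. -/
noncomputable def dyadicProd (p : ℝ) (z : ℂ) : ℂ := ∏' j, dyadicFactor p j z

theorem tendstoLocallyUniformlyOn_dyadicProd {p : ℝ} (h0 : 0 ≤ p) (h2 : p < 2) :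
    TendstoLocallyUniformlyOn (fun N z => ∏ j ∈ Finset.range N, dyadicFactor p j z) (dyadicProd p)
      Filter.atTop Set.univ := by
  have hQ4 : (2 : ℝ) ^ p < 4 := by
    have := Real.rpow_lt_rpow_of_exponent_lt (x := 2) (by norm_num) h2
    rw [Real.rpow_two] at this
    norm_num at this
    exact this
  refine HasProdLocallyUniformlyOn.tendstoLocallyUniformlyOn_finsetRange ?_
  refine hasProdLocallyUniformlyOn_of_forall_compact isOpen_univ fun K _ hK => ?_
  obtain ⟨R, hR⟩ := hK.isBounded.exists_norm_le
  have hsum : Summable fun j : ℕ => 16 * R ^ 2 * ((2 : ℝ) ^ p / 4) ^ j :=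
    (summable_geometric_of_lt_one (by positivity) (by linarith)).mul_left _
  have h := hsum.hasProdUniformlyOn_nat_one_add (f := fun j z => dyadicFactor p j z - 1) hK
    ((eventually_norm_dyadicFactor_sub_one_le h0 h2 R).mono fun j hj z hz => hj z (hR z hz))
    (fun j => by unfold dyadicFactor; fun_prop)
  simp only [add_sub_cancel] at h
  exact h

/-- The decay along the real axis comes from a single factor: if `2 ^ (J - 1) ≤ |x| ≤ 2 ^ J`
and `|y| ≤ |x| / 4`, then `|cos (z / 2 ^ J)| ^ 2 ≤ 10 / 11`, and the multiplicity is at least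
`2 ^ (p J) ≥ |x| ^ p`. -/
theorem isEntireWindow_dyadicProd {p : ℝ} (h1 : 1 < p) (h2 : p < 2) :
    IsEntireWindow p (dyadicProd p) where
  differentiable := by
    have h := (tendstoLocallyUniformlyOn_dyadicProd (by linarith) h2).differentiableOn
      (Filter.Eventually.of_forall fun N => ?_) isOpen_univ
    · exact differentiableOn_univ.1 h
    · unfold dyadicFactor
      fun_prop
  nonneg x := by
    have h := (tendstoLocallyUniformlyOn_dyadicProd (by linarith) h2).tendsto_at
      (Set.mem_univ (x : ℂ))
    have e : ∀ N : ℕ, ∏ j ∈ Finset.range N, dyadicFactor p j x =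
        ((∏ j ∈ Finset.range N, (Real.cos (x / 2 ^ j) ^ 2) ^ dyadicNum p j : ℝ) : ℂ) := fun N => by
      push_cast [dyadicFactor]; rfl
    simp only [e] at h
    have hre := (Complex.continuous_re.tendsto _).comp h
    have him := (Complex.continuous_im.tendsto _).comp h
    simp only [Function.comp_def, Complex.ofReal_re, Complex.ofReal_im] at hre him
    refine ⟨(dyadicProd p x).re, ge_of_tendsto' hre fun N => by positivity, ?_⟩
    exact Complex.ext rfl (by simpa using (tendsto_nhds_unique him tendsto_const_nhds))
  ne_zero := by
    have : dyadicProd p 0 = 1 := by simp [dyadicProd, dyadicFactor]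
    rw [this]; exact one_ne_zero
  bound := by
    obtain ⟨B, hB, hb⟩ := norm_prod_dyadicFactor_le h1 h2
    have hlim : ∀ z, Filter.Tendsto (fun N => ‖∏ j ∈ Finset.range N, dyadicFactor p j z‖)
        Filter.atTop (nhds ‖dyadicProd p z‖) := fun z =>
      ((tendstoLocallyUniformlyOn_dyadicProd (by linarith) h2).tendsto_at (Set.mem_univ z)).norm
    have hall : ∀ z, ‖dyadicProd p z‖ ≤ Real.exp (B * |z.im| ^ p + B) := fun z =>
      le_of_tendsto' (hlim z) fun N => (hb N z).1
    set c : ℝ := -Real.log (10 / 11) with hc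
    have hc0 : 0 < c := by
      rw [hc, neg_pos]; exact Real.log_neg (by norm_num) (by norm_num)
    have h4 : (4 : ℝ) ^ p ≥ 0 := by positivity
    refine ⟨Real.exp (B + c), c, B + c * 4 ^ p + 1, Real.exp_pos _, hc0, by positivity, fun z => ?_⟩
    have hp0 : 0 < p := by linarith
    have hy : 0 ≤ |z.im| ^ p := by positivity
    rw [← Real.exp_add]
    -- away from the cone `|y| ≤ |x| / 4`, the growth in `y` dominates `|x| ^ p`
    rcases le_total |z.im| (|z.re| / 4) with hi | hi
    · rcases le_total 1 |z.re| with hr | hr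
      · -- the factor whose scale is that of the real part is small
        obtain ⟨n, hn1, hn2⟩ := exists_nat_pow_near hr (by norm_num : (1 : ℝ) < 2)
        have h2n : (0 : ℝ) < 2 ^ (n + 1) := by positivity
        have hle : ‖dyadicProd p z‖ ≤
            (10 / 11 : ℝ) ^ (dyadicNum p (n + 1)) * Real.exp (B * |z.im| ^ p + B) := by
          refine le_of_tendsto (hlim z) ?_
          filter_upwards [Filter.eventually_gt_atTop (n + 1)] with N hN
          refine (hb N z).2 (n + 1) hN ?_ ?_ hi
          · rw [le_div_iff₀ h2n, pow_succ]; linarith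
          · rw [div_le_one h2n]; exact hn2.le
        have hpow : (10 / 11 : ℝ) ^ (dyadicNum p (n + 1)) ≤ Real.exp (-c * |z.re| ^ p) := by
          have e1 : (10 / 11 : ℝ) ^ (dyadicNum p (n + 1)) =
              Real.exp (-c * (dyadicNum p (n + 1) : ℝ)) := by
            rw [hc, neg_neg, mul_comm, Real.exp_nat_mul, Real.exp_log (by norm_num)]
          rw [e1, Real.exp_le_exp]
          have e2 : |z.re| ^ p ≤ dyadicNum p (n + 1) := by
            refine le_trans ?_ (le_dyadicNum p (n + 1))
            rw [← Real.rpow_natCast, ← Real.rpow_mul (by norm_num), mul_comm p,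
              Real.rpow_mul (by norm_num), Real.rpow_natCast]
            exact Real.rpow_le_rpow (abs_nonneg _) hn2.le hp0.le
          nlinarith
        refine hle.trans ((mul_le_mul_of_nonneg_right hpow (Real.exp_pos _).le).trans ?_)
        rw [← Real.exp_add, Real.exp_le_exp]
        nlinarith [mul_nonneg (mul_nonneg hc0.le h4) hy]
      · refine (hall z).trans (Real.exp_le_exp.2 ?_)
        have e1 : |z.re| ^ p ≤ 1 := Real.rpow_le_one (abs_nonneg _) hr hp0.le
        nlinarith [mul_nonneg (mul_nonneg hc0.le h4) hy]
    · refine (hall z).trans (Real.exp_le_exp.2 ?_)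
      have e1 : |z.re| ^ p ≤ 4 ^ p * |z.im| ^ p := by
        rw [← Real.mul_rpow (by norm_num) (abs_nonneg _)]
        exact Real.rpow_le_rpow (abs_nonneg _) (by linarith) hp0.le
      nlinarith [mul_le_mul_of_nonneg_left e1 hc0.le]

/-! ### Windows with non-zero integral -/

/-- Cauchy's estimate on the circle of radius `(k + 1) ^ s` gives the bounds of the space with
decay exponent `s` and regularity exponent `1 - s`. -/
theorem IsEntireWindow.exists_bound {s : ℝ} (hs : 0 < s) {F : ℂ → ℂ}
    (hF : IsEntireWindow s⁻¹ F) : ∃ C h : ℝ, 0 < h ∧ ∀ (a k : ℕ) (x : ℝ),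
      |x| ^ a * ‖iteratedDeriv k F x‖ ≤
        C * h ^ (a + k) * ((a.factorial : ℝ) ^ s * (k.factorial : ℝ) ^ (1 - s)) := by
  obtain ⟨C, c, b, hC, hc, hb, hbd⟩ := hF.bound
  set p := s⁻¹ with hp
  have hp0 : 0 < p := inv_pos.2 hs
  have h2p : (0 : ℝ) < 2 ^ p := by positivity
  obtain ⟨c', hc'⟩ : ∃ c', c' = c / 2 ^ p := ⟨_, rfl⟩
  have hc'0 : 0 < c' := hc' ▸ by positivity
  obtain ⟨q, hq⟩ : ∃ q, q = (c' / s) ^ s := ⟨_, rfl⟩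
  have hq0 : 0 < q := hq ▸ by positivity
  -- values on a circle around a real point
  have hsph : ∀ (x R : ℝ), 0 < R → ∀ z ∈ Metric.sphere (x : ℂ) R,
      ‖F z‖ ≤ C * (Real.exp (-(c' * |x| ^ p)) * Real.exp ((b + c) * R ^ p)) := by
    intro x R hR z hz
    rw [mem_sphere_iff_norm] at hz
    have hre : |z.re - x| ≤ R := by
      have := Complex.abs_re_le_norm (z - x)
      simpa [hz] using this
    have him : |z.im| ≤ R := by
      have := Complex.abs_im_le_norm (z - x)
      simpa [hz] using this
    have h1 : |x| ≤ 2 * max |z.re| R := by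
      have h3 : |x| ≤ |z.re| + |z.re - x| := by
        have := abs_sub z.re (z.re - x)
        simpa using this
      have := le_max_left |z.re| R
      have := le_max_right |z.re| R
      linarith
    have h2 : |x| ^ p ≤ 2 ^ p * (|z.re| ^ p + R ^ p) := by
      refine (Real.rpow_le_rpow (abs_nonneg _) h1 hp0.le).trans ?_
      rw [Real.mul_rpow (by norm_num) (by positivity)]
      gcongr
      rcases max_choice |z.re| R with h | h <;> rw [h]
      · have : 0 ≤ R ^ p := by positivity
        linarith
      · have : 0 ≤ |z.re| ^ p := by positivity
        linarith
    have h3 : c' * |x| ^ p ≤ c * (|z.re| ^ p + R ^ p) := by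
      rw [hc', div_mul_eq_mul_div, div_le_iff₀ h2p]
      calc c * |x| ^ p ≤ c * (2 ^ p * (|z.re| ^ p + R ^ p)) := by gcongr
        _ = _ := by ring
    have h4 : |z.im| ^ p ≤ R ^ p := Real.rpow_le_rpow (abs_nonneg _) him hp0.le
    refine (hbd z).trans ?_
    rw [← Real.exp_add]
    have h5 : b * |z.im| ^ p ≤ b * R ^ p := by gcongr
    refine mul_le_mul_of_nonneg_left (Real.exp_le_exp.2 ?_) hC.le
    linarith
  refine ⟨C * Real.exp (b + c), max (Real.exp (b + c)) q⁻¹, by positivity, fun a k x => ?_⟩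
  -- with this radius, `R ^ p = k + 1`, and `R ^ k ≥ k! ^ s`
  set R : ℝ := ((k : ℝ) + 1) ^ s with hR
  have hR0 : 0 < R := by positivity
  have hRp : R ^ p = k + 1 := by
    rw [hR, hp, ← Real.rpow_mul (by positivity), mul_inv_cancel₀ hs.ne', Real.rpow_one]
  have hcau := Complex.norm_iteratedDeriv_le_of_forall_mem_sphere_norm_le k hR0
    hF.differentiable.diffContOnCl (hsph x R hR0)
  have hk0 : (0 : ℝ) < k.factorial := by positivity
  have hRk : (k.factorial : ℝ) ^ s ≤ R ^ k := by
    have h1 : (k.factorial : ℝ) ≤ ((k : ℝ) + 1) ^ k := by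
      have h2 : k.factorial ≤ (k + 1) ^ k :=
        (Nat.factorial_le_pow k).trans (Nat.pow_le_pow_left k.le_succ k)
      exact_mod_cast h2
    refine (Real.rpow_le_rpow hk0.le h1 hs.le).trans (le_of_eq ?_)
    rw [hR, ← Real.rpow_natCast, ← Real.rpow_natCast, ← Real.rpow_mul (by positivity),
      ← Real.rpow_mul (by positivity), mul_comm]
  have hder : ‖iteratedDeriv k F x‖ ≤ C * (Real.exp (-(c' * |x| ^ p)) *
      Real.exp (b + c) ^ (k + 1)) * (k.factorial : ℝ) ^ (1 - s) := by
    refine hcau.trans ?_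
    rw [hRp, Real.rpow_sub hk0, Real.rpow_one, ← Real.exp_nat_mul, mul_comm ((k + 1 : ℕ) : ℝ),
      Nat.cast_succ, mul_div_assoc, mul_div_assoc', mul_comm (k.factorial : ℝ) _, mul_div_assoc]
    gcongr
  have hpow : |x| ^ a ≤ q⁻¹ ^ a * (Real.exp (c' * |x| ^ p) * (a.factorial : ℝ) ^ s) := by
    have h1 := pow_le_exp_mul_factorial (R := q * |x|) (by positivity) hs a
    have h2 : s * (q * |x|) ^ s⁻¹ = c' * |x| ^ p := by
      rw [Real.mul_rpow hq0.le (abs_nonneg _), hq, ← Real.rpow_mul (by positivity),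
        mul_inv_cancel₀ hs.ne', Real.rpow_one, ← mul_assoc, mul_div_cancel₀ _ hs.ne']
    rw [h2, mul_pow] at h1
    rw [inv_pow, inv_mul_eq_div, le_div_iff₀ (by positivity), mul_comm]
    exact h1
  calc |x| ^ a * ‖iteratedDeriv k F x‖
      ≤ q⁻¹ ^ a * (Real.exp (c' * |x| ^ p) * (a.factorial : ℝ) ^ s) *
        (C * (Real.exp (-(c' * |x| ^ p)) * Real.exp (b + c) ^ (k + 1)) *
          (k.factorial : ℝ) ^ (1 - s)) := by gcongr
    _ = C * Real.exp (b + c) * (q⁻¹ ^ a * Real.exp (b + c) ^ k) *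
        ((a.factorial : ℝ) ^ s * (k.factorial : ℝ) ^ (1 - s)) := by
      have : Real.exp (c' * |x| ^ p) * Real.exp (-(c' * |x| ^ p)) = 1 := by
        rw [← Real.exp_add, add_neg_cancel, Real.exp_zero]
      linear_combination (q⁻¹ ^ a * (a.factorial : ℝ) ^ s * C * Real.exp (b + c) ^ (k + 1) *
        (k.factorial : ℝ) ^ (1 - s)) * this
    _ ≤ _ := by
      rw [pow_add]
      gcongr
      · exact le_max_right _ _
      · exact le_max_left _ _

theorem IsEntireWindow.hasDerivAt_iteratedDeriv {p : ℝ} {F : ℂ → ℂ} (hF : IsEntireWindow p F)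
    (k : ℕ) (x : ℝ) :
    HasDerivAt (fun x : ℝ => iteratedDeriv k F x) (iteratedDeriv (k + 1) F x) x := by
  have h : Differentiable ℂ (iteratedDeriv k F) :=
    (hF.differentiable.contDiff (n := ω)).differentiable_iteratedDeriv k (by simp)
  rw [iteratedDeriv_succ]
  exact (h x).hasDerivAt.comp_ofReal

theorem IsEntireWindow.isDerivFamily {p : ℝ} {F : ℂ → ℂ} (hF : IsEntireWindow p F) :
    IsDerivFamily fun (l : List ι) X => ∏ i, iteratedDeriv (cnt l i) F (X i : ℝ) := by
  intro l X
  have h : ∀ i ∈ (Finset.univ : Finset ι), HasFDerivAt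
      (fun X : EuclideanSpace ℝ ι => iteratedDeriv (cnt l i) F (X i : ℝ)) _ X := fun i _ =>
    HasFDerivAt.comp (g := fun x : ℝ => iteratedDeriv (cnt l i) F x) X
      (hF.hasDerivAt_iteratedDeriv (cnt l i) (X i)).hasFDerivAt
      (EuclideanSpace.proj i : EuclideanSpace ℝ ι →L[ℝ] ℝ).hasFDerivAt
  refine (HasFDerivAt.finsetProd h).congr_fderiv ?_
  ext V
  simp only [sum_apply, smul_apply,
    ContinuousLinearMap.comp_apply, ContinuousLinearMap.smulRight_apply, PiLp.proj_apply]
  refine Finset.sum_congr rfl fun i _ => ?_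
  rw [← Finset.mul_prod_erase _ _ (Finset.mem_univ i)]
  have h1 : ∏ j ∈ Finset.univ.erase i, iteratedDeriv (cnt (i :: l) j) F (X j : ℝ) =
      ∏ j ∈ Finset.univ.erase i, iteratedDeriv (cnt l j) F (X j : ℝ) := by
    refine Finset.prod_congr rfl fun j hj => ?_
    rw [cnt_cons, Pi.add_apply, Pi.single_eq_of_ne (Finset.ne_of_mem_erase hj), add_zero]
  rw [h1, cnt_cons, Pi.add_apply, Pi.single_eq_same, smul_eq_mul, mul_comm]
  simp [mul_assoc, mul_comm, mul_left_comm]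

/-- The product `∏ F (X i)` is a test function. -/
theorem IsEntireWindow.exists_sch {s : ℝ} (hs : 0 < s) {F : ℂ → ℂ}
    (hF : IsEntireWindow s⁻¹ F) : ∃ Γ : Sch ι, (∀ X, Γ X = ∏ i, F (X i : ℝ)) ∧
      (Γ : EuclideanSpace ℝ ι → ℂ) ∈ testSpace (fun _ => s) (fun _ => 1 - s) := by
  obtain ⟨C, h, h0, hb⟩ := hF.exists_bound hs
  have hB : HasBound (fun _ : ι => s) (fun _ => 1 - s) h (∏ _i : ι, C)
      fun X => ∏ i, iteratedDeriv (cnt ([] : List ι) i) F (X i : ℝ) := by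
    refine hasBound_of_family (hF.isDerivFamily (ι := ι)) fun α l X => ?_
    rw [Finset.abs_prod, norm_prod, ← Finset.prod_mul_distrib, ← sum_cnt,
      ← Finset.sum_add_distrib, ← Finset.prod_pow_eq_pow_sum, facPow, facPow,
      ← Finset.prod_mul_distrib, ← Finset.prod_mul_distrib, ← Finset.prod_mul_distrib]
    refine Finset.prod_le_prod (fun i _ => by positivity) fun i _ => ?_
    rw [abs_pow]
    exact hb (α i) (cnt l i) (X i)
  simp only [cnt_nil, Pi.zero_apply, iteratedDeriv_zero] at hB
  obtain ⟨Γ, hΓ⟩ := hB.exists_sch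
  exact ⟨Γ, congrFun hΓ, hΓ ▸ ⟨_, _, h0, hB⟩⟩

theorem IsEntireWindow.integral_ne_zero {p : ℝ} {F : ℂ → ℂ} (hF : IsEntireWindow p F) {Γ : Sch ι}
    (hΓ : ∀ X, Γ X = ∏ i, F (X i : ℝ)) : ∫ X, Γ X ≠ 0 := by
  choose f hf0 hf using hF.nonneg
  have h1 : ∀ X, Γ X = ((∏ i, f (X i) : ℝ) : ℂ) := fun X => by
    rw [hΓ, Complex.ofReal_prod]
    exact Finset.prod_congr rfl fun i _ => hf _
  have hre : ∀ X, (Γ X).re = ∏ i, f (X i) := fun X => by rw [h1, Complex.ofReal_re]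
  have hint : Integrable fun X => (Γ X).re := Γ.integrable.re
  have hcont : Continuous fun X => (Γ X).re := Complex.continuous_re.comp Γ.continuous
  have hpos : 0 < ∫ X, (Γ X).re := by
    rw [integral_pos_iff_support_of_nonneg
      (fun X => by rw [hre]; exact Finset.prod_nonneg fun i _ => hf0 _) hint]
    refine hcont.isOpen_support.measure_pos volume ⟨0, ?_⟩
    rw [Function.mem_support]
    intro h
    have h2 : Γ 0 = 0 := by rw [h1, ← hre, h, Complex.ofReal_zero]
    rw [hΓ, Finset.prod_eq_zero_iff] at h2
    obtain ⟨i, -, hi⟩ := h2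
    exact hF.ne_zero (by simpa using hi)
  have h3 : ∫ X, Γ X = ((∫ X, (Γ X).re : ℝ) : ℂ) := by
    rw [← integral_complex_ofReal]
    exact integral_congr_ae (.of_forall fun X => by simp only [h1, Complex.ofReal_re])
  rw [h3]
  exact_mod_cast hpos.ne'

theorem exists_isEntireWindow {s : ℝ} (h1 : 1 / 2 ≤ s) (h2 : s < 1) :
    ∃ F, IsEntireWindow s⁻¹ F := by
  have hs : 0 < s := by linarith
  rcases h1.eq_or_lt with rfl | h1
  · exact ⟨_, by simpa using isEntireWindow_gaussian⟩
  · refine ⟨_, isEntireWindow_dyadicProd ((one_lt_inv₀ hs).2 h2) ?_⟩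
    rw [inv_lt_comm₀ hs two_pos]
    linarith

/-- The space with decay exponent `s` and regularity exponent `σ`, `s + σ ≥ 1`, contains a
function with non-zero integral.  When `s < 1 / 2`, it is the Fourier transform of a window
with the two exponents exchanged. -/
theorem exists_window (d : ℕ) {s σ : ℝ} (hs : 0 < s) (hσ : 0 < σ) (hsσ : 1 ≤ s + σ) :
    ∃ γ : Sch (Fin d), (γ : Vec d → ℂ) ∈ VecTest d s σ ∧ ∫ x, γ x ≠ 0 := by
  have key : ∀ s₀ : ℝ, 1 / 2 ≤ s₀ → s₀ < 1 → s₀ ≤ s → 1 - s₀ ≤ σ →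
      ∃ γ : Sch (Fin d), (γ : Vec d → ℂ) ∈ VecTest d s σ ∧ ∫ x, γ x ≠ 0 := by
    intro s₀ h1 h2 h3 h4
    obtain ⟨F, hF⟩ := exists_isEntireWindow h1 h2
    obtain ⟨Γ, hΓ, hmem⟩ := hF.exists_sch (ι := Fin d) (by linarith)
    exact ⟨Γ, testSpace_mono (fun _ => h3) (fun _ => h4) hmem, hF.integral_ne_zero hΓ⟩
  by_cases hσ2 : σ ≤ 1 / 2
  · exact key (1 - σ) (by linarith) (by linarith) (by linarith) (by linarith)
  by_cases hs2 : 1 / 2 ≤ s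
  · exact key (1 / 2) le_rfl (by norm_num) hs2 (by linarith)
  obtain ⟨F, hF⟩ := exists_isEntireWindow (s := 1 - s) (by linarith) (by linarith)
  obtain ⟨Γ, hΓ, hmem⟩ := hF.exists_sch (ι := Fin d) (by linarith)
  have hid : Function.Injective (id : Fin d → Fin d) := Function.injective_id
  refine ⟨partialFourier hid Γ, ?_, ?_⟩
  · have := partialFourier_mem hid (fun _ => by linarith) (fun _ => by linarith)
      (fun _ => by linarith) hmem
    refine testSpace_mono (fun i => ?_) (fun i => ?_) this <;>
      simp only [swapExp, Set.range_id, Set.mem_univ, if_true] <;> linarith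
  · have h := integral_exp_mul_pf_upd hid 0 Γ 0
    have hu : ∀ v : Vec d, upd id 0 v = v := fun v => by
      ext k; exact upd_apply_self hid 0 v k
    simp only [hu, inner_zero_right, Complex.ofReal_zero, mul_zero, Complex.exp_zero, one_mul,
      neg_zero] at h
    simp only [partialFourier_apply]
    rw [h, hΓ]
    refine mul_ne_zero (by exact_mod_cast (by positivity : (0:ℝ) < _).ne')
      (Finset.prod_ne_zero_iff.2 fun i _ => ?_)
    simpa using hF.ne_zero

/-! ### Operators that agree on test functions -/

theorem pf₂_mem_iff {s σ : Fin 3 → ℝ} (hs : ∀ j, 0 < s j) (hσ : ∀ j, 0 < σ j)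
    (hsσ : ∀ j, 1 ≤ s j + σ j) {G : Sch (Fin 3 × Fin d)} :
    (pf₂ G : Vec3 d → ℂ) ∈ SymbolTest d s σ ↔
      (G : Vec3 d → ℂ) ∈ testSpace (blockExp d s) (blockExp d σ) := by
  have h1 : ∀ p, 0 ≤ blockExp d s p := fun p => (hs p.1).le
  have h2 : ∀ p, 0 ≤ blockExp d σ p := fun p => (hσ p.1).le
  have h3 : ∀ p, 1 ≤ blockExp d s p + blockExp d σ p := fun p => hsσ p.1
  rw [SymbolTest, symbolDecay_eq, symbolReg_eq, pf₂, partialFourier_mem_iff (blockIdx_injective 1)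
    (swapExp_pred _ h1 h2) (swapExp_pred _ h2 h1) (one_le_swapExp_add _ h3),
    partialFourier_mem_iff (blockIdx_injective 2) h1 h2 h3]

theorem isForm_pair_pf₂ {s σ : Fin 3 → ℝ} (hs : ∀ j, 0 < s j) (hσ : ∀ j, 0 < σ j)
    (hsσ : ∀ j, 1 ≤ s j + σ j) (a : SymbolDist d s σ) :
    IsForm (blockExp d s) (blockExp d σ) fun G => a.pair (pf₂ G) := by
  have h1 : ∀ p, 0 ≤ blockExp d s p := fun p => (hs p.1).le
  have h2 : ∀ p, 0 ≤ blockExp d σ p := fun p => (hσ p.1).le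
  have h3 : ∀ p, 1 ≤ blockExp d s p + blockExp d σ p := fun p => hsσ p.1
  have h0 := a.isForm
  have h : IsForm
      (swapExp (blockIdx d 1) (swapExp (blockIdx d 2) (blockExp d s) (blockExp d σ))
        (swapExp (blockIdx d 2) (blockExp d σ) (blockExp d s)))
      (swapExp (blockIdx d 1) (swapExp (blockIdx d 2) (blockExp d σ) (blockExp d s))
        (swapExp (blockIdx d 2) (blockExp d s) (blockExp d σ))) fun F => a.pair F := by
    rw [← symbolDecay_eq, ← symbolReg_eq]
    exact h0
  exact (h.comp_partialFourier (blockIdx_injective 1) (swapExp_pred _ h1 h2)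
    (swapExp_pred _ h2 h1) (one_le_swapExp_add _ h3)).comp_partialFourier (blockIdx_injective 2)
      h1 h2 h3

/-- `pf₂` maps the space with exponents `(s_j, σ_j)` onto the test space of the symbols, so the
domain of a symbol is described on the side of the kernels. -/
theorem wigner_mem_iff {s σ : Fin 3 → ℝ} (hs : ∀ j, 0 < s j) (hσ : ∀ j, 0 < σ j)
    (hsσ : ∀ j, 1 ≤ s j + σ j) (r t : ℝ) {Φ : Sch (Fin 3 × Fin d)} :
    (wigner r t Φ : Vec3 d → ℂ) ∈ SymbolTest d s σ ↔
      (compEquiv (shear d r t) Φ : Vec3 d → ℂ) ∈ testSpace (blockExp d s) (blockExp d σ) := by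
  have h0 : (((2 * Real.pi) ^ (2 * d) : ℝ) : ℂ)⁻¹ ≠ 0 := by
    refine inv_ne_zero ?_
    rw [Complex.ofReal_ne_zero]; positivity
  rw [← pf₂_mem_iff hs hσ hsσ]
  exact Submodule.smul_mem_iff _ h0

theorem pair_wigner {s σ : Fin 3 → ℝ} (hs : ∀ j, 0 < s j) (hσ : ∀ j, 0 < σ j)
    (hsσ : ∀ j, 1 ≤ s j + σ j) (a : SymbolDist d s σ) (r t : ℝ) {Φ : Sch (Fin 3 × Fin d)}
    (hΦ : (wigner r t Φ : Vec3 d → ℂ) ∈ SymbolTest d s σ) : a.pair (wigner r t Φ) =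
      (((2 * Real.pi) ^ (2 * d) : ℝ) : ℂ)⁻¹ * a.pair (pf₂ (compEquiv (shear d r t) Φ)) :=
  a.isForm.smul _ _ ((pf₂_mem_iff hs hσ hsσ).2 ((wigner_mem_iff hs hσ hsσ r t).1 hΦ))

/-- The tensor product of three test functions, as a Schwartz function of the isotropic space. -/
theorem exists_sch_tensor {s σ : ℝ} {φ f g : Vec d → ℂ} (hφ : φ ∈ VecTest d s σ)
    (hf : f ∈ VecTest d s σ) (hg : g ∈ VecTest d s σ) : ∃ Φ : Sch (Fin 3 × Fin d),
      ⇑Φ = (fun X => φ (block X 0) * f (block X 1) * g (block X 2)) ∧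
      (Φ : Vec3 d → ℂ) ∈ testSpace (fun _ => s) (fun _ => σ) := by
  have h := tensor_mem (Equiv.refl (Fin 3 × Fin d)) (f := ![φ, f, g])
    (s := fun _ _ => s) (σ := fun _ _ => σ) (fun j => by fin_cases j <;> assumption)
  obtain ⟨H, C, h0, hb⟩ := h
  obtain ⟨Φ, hΦ⟩ := hb.exists_sch
  exact ⟨Φ, hΦ.trans (funext fun X => tensor_three _ X), H, C, h0, hΦ ▸ hb⟩

theorem integral_tensor_ne_zero {γ : Sch (Fin d)} (hγ : ∫ x, γ x ≠ 0) {Φ : Sch (Fin 3 × Fin d)}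
    (hΦ : ⇑Φ = (fun X => γ (block X 0) * γ (block X 1) * γ (block X 2))) : ∫ X, Φ X ≠ 0 := by
  obtain ⟨c, hc, h⟩ := exists_integral_triple d
  intro h0
  have h1 := h Φ Φ.integrable
  rw [h0, mul_zero] at h1
  simp only [hΦ, block_triple_zero, block_triple_one, block_triple_two, integral_mul_const,
    integral_const_mul] at h1
  exact mul_ne_zero (mul_ne_zero hγ hγ) hγ h1.symm

/-- If the bilinear operators agree on test functions, then their kernels agree.  The window `γ` is
used through its tensor product, whose dilates are the approximate identity. -/
theorem sameKernel_of_bilinearOp_eq {s σ : Fin 3 → ℝ} (hs : ∀ j, 0 < s j) (hσ : ∀ j, 0 < σ j)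
    (hsσ : ∀ i j, 1 ≤ s i + σ j) {γ : Sch (Fin d)}
    (hγ : (γ : Vec d → ℂ) ∈ VecTest d (⨅ j, s j) (⨅ j, σ j)) (hγ0 : ∫ x, γ x ≠ 0)
    (r₁ t₁ r₂ t₂ : ℝ) (a b : SymbolDist d s σ)
    (hab : ∀ f ∈ VecTest d (⨅ j, s j) (⨅ j, σ j), ∀ g ∈ VecTest d (⨅ j, s j) (⨅ j, σ j),
      ∀ φ ∈ VecTest d (⨅ j, s j) (⨅ j, σ j),
        bilinearOp r₁ t₁ a f g φ = bilinearOp r₂ t₂ b f g φ) :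
    SameKernel r₁ t₁ r₂ t₂ a b := by
  obtain ⟨i₀, hi⟩ := exists_eq_ciInf_of_finite (f := s)
  obtain ⟨j₀, hj⟩ := exists_eq_ciInf_of_finite (f := σ)
  have hs0 : 0 < ⨅ j, s j := hi ▸ hs i₀
  have hσ0 : 0 < ⨅ j, σ j := hj ▸ hσ j₀
  have h1 : 1 ≤ (⨅ j, s j) + ⨅ j, σ j := by rw [← hi, ← hj]; exact hsσ i₀ j₀
  have hd : ∀ j, 1 ≤ s j + σ j := fun j => hsσ j j
  have c0 : (((2 * Real.pi) ^ (2 * d) : ℝ) : ℂ)⁻¹ ≠ 0 := by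
    refine inv_ne_zero ?_
    rw [Complex.ofReal_ne_zero]; positivity
  obtain ⟨G, hG, hGmem⟩ := exists_sch_tensor hγ hγ hγ
  have hmem : ∀ (r t c : ℝ) (hc : c ≠ 0),
      (wigner r t (compEquiv (dilation _ hc) G) : Vec3 d → ℂ) ∈ SymbolTest d s σ := fun r t c hc =>
    wigner_mem hs hσ hsσ r t (compEquiv_mem _ hs0.le hσ0.le h1 hGmem)
  intro Φ hΦ₁ hΦ₂
  rw [← coe_wigner] at hΦ₁ hΦ₂ ⊢
  rw [← coe_wigner, pair_wigner hs hσ hd a r₁ t₁ hΦ₁, pair_wigner hs hσ hd b r₂ t₂ hΦ₂]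
  congr 1
  refine eq_of_eq_on_translates (isForm_pair_pf₂ hs hσ hd a) (isForm_pair_pf₂ hs hσ hd b)
    (fun p => hs p.1) (fun p => (hσ p.1).le) (fun p => hs p.1) (fun p => (hσ p.1).le)
    (shear d r₁ t₁) (shear d r₂ t₂) (g := G)
    (fun c hc => (wigner_mem_iff hs hσ hd r₁ t₁).1 (hmem r₁ t₁ c hc))
    (fun c hc => (wigner_mem_iff hs hσ hd r₂ t₂).1 (hmem r₂ t₂ c hc))
    (fun c hc Y => ?_) (integral_tensor_ne_zero hγ0 hG)
    ((wigner_mem_iff hs hσ hd r₁ t₁).1 hΦ₁) ((wigner_mem_iff hs hσ hd r₂ t₂).1 hΦ₂)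
  -- the translates of the dilates of a tensor product are tensor products
  set γ' : Fin 3 → Sch (Fin d) := fun j => translate (block Y j) (compEquiv (dilation _ hc) γ)
    with hγ'
  have hγ'mem : ∀ j, (γ' j : Vec d → ℂ) ∈ VecTest d (⨅ j, s j) (⨅ j, σ j) := fun j =>
    translate_mem (fun _ => hs0) (compEquiv_mem _ hs0.le hσ0.le h1 hγ) _
  set Ψ := translate Y (compEquiv (dilation _ hc) G) with hΨ
  have hΨt : ⇑Ψ = fun X => γ' 0 (block X 0) * γ' 1 (block X 1) * γ' 2 (block X 2) := by
    ext X
    simp only [hΨ, hγ', translate_apply, compEquiv_apply, hG]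
    rfl
  have hΨmem : (Ψ : Vec3 d → ℂ) ∈ testSpace (fun _ => ⨅ j, s j) (fun _ => ⨅ j, σ j) :=
    translate_mem (fun _ => hs0) (compEquiv_mem _ hs0.le hσ0.le h1 hGmem) _
  have h2 := hab (γ' 1) (hγ'mem 1) (γ' 2) (hγ'mem 2) (γ' 0) (hγ'mem 0)
  rw [bilinearOp, bilinearOp, ← hΨt, ← coe_wigner, ← coe_wigner,
    pair_wigner hs hσ hd a r₁ t₁ (wigner_mem hs hσ hsσ r₁ t₁ hΨmem),
    pair_wigner hs hσ hd b r₂ t₂ (wigner_mem hs hσ hsσ r₂ t₂ hΨmem)] at h2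
  exact mul_left_cancel₀ c0 h2

end GelfandShilov

open GelfandShilov in
theorem mainTheorem2 (d : ℕ) (s σ : Fin 3 → ℝ) (hs : ∀ j, 0 < s j) (hσ : ∀ j, 0 < σ j)
    (hsσ : ∀ j, 1 ≤ s j + σ j)
    (r₁ t₁ r₂ t₂ : ℝ)
    (hr₁ : r₁ ∈ Set.Icc (0 : ℝ) 1) (ht₁ : t₁ ∈ Set.Icc (0 : ℝ) 1) (hrt₁ : r₁ + t₁ ≤ 1)
    (hr₂ : r₂ ∈ Set.Icc (0 : ℝ) 1) (ht₂ : t₂ ∈ Set.Icc (0 : ℝ) 1) (hrt₂ : r₂ + t₂ ≤ 1)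
    (a b : SymbolDist d s σ) :
    (SameKernel r₁ t₁ r₂ t₂ a b ↔ SameExp r₁ t₁ r₂ t₂ a b) ∧
    ((∀ i j, 1 ≤ s i + σ j) →
      (∀ f ∈ VecTest d (⨅ j, s j) (⨅ j, σ j), ∀ g ∈ VecTest d (⨅ j, s j) (⨅ j, σ j),
        ∀ φ ∈ VecTest d (⨅ j, s j) (⨅ j, σ j),
          kernelTranspose r₁ t₁ (fun X => φ (block X 0) * f (block X 1) * g (block X 2))
            ∈ SymbolTest d s σ ∧
          kernelTranspose r₂ t₂ (fun X => φ (block X 0) * f (block X 1) * g (block X 2))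
            ∈ SymbolTest d s σ) ∧
      ((∀ f ∈ VecTest d (⨅ j, s j) (⨅ j, σ j), ∀ g ∈ VecTest d (⨅ j, s j) (⨅ j, σ j),
        ∀ φ ∈ VecTest d (⨅ j, s j) (⨅ j, σ j),
          bilinearOp r₁ t₁ a f g φ = bilinearOp r₂ t₂ b f g φ) ↔
        SameExp r₁ t₁ r₂ t₂ a b)) := by
  refine ⟨sameKernel_iff_sameExp r₁ t₁ r₂ t₂ a b, fun hall => ?_⟩
  have hmem : ∀ r t : ℝ, ∀ f ∈ VecTest d (⨅ j, s j) (⨅ j, σ j),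
      ∀ g ∈ VecTest d (⨅ j, s j) (⨅ j, σ j), ∀ φ ∈ VecTest d (⨅ j, s j) (⨅ j, σ j),
        kernelTranspose r t (fun X => φ (block X 0) * f (block X 1) * g (block X 2))
          ∈ SymbolTest d s σ := by
    intro r t f hf g hg φ hφ
    obtain ⟨Φ, hΦ, hΦmem⟩ := exists_sch_tensor hφ hf hg
    rw [← hΦ, ← coe_wigner]
    exact wigner_mem hs hσ hall r t hΦmem
  refine ⟨fun f hf g hg φ hφ => ⟨hmem r₁ t₁ f hf g hg φ hφ, hmem r₂ t₂ f hf g hg φ hφ⟩, ?_⟩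
  rw [← sameKernel_iff_sameExp]
  constructor
  · intro h
    obtain ⟨i₀, hi⟩ := exists_eq_ciInf_of_finite (f := s)
    obtain ⟨j₀, hj⟩ := exists_eq_ciInf_of_finite (f := σ)
    obtain ⟨γ, hγ, hγ0⟩ := exists_window d (hi ▸ hs i₀) (hj ▸ hσ j₀)
      (by rw [← hi, ← hj]; exact hall i₀ j₀)
    exact sameKernel_of_bilinearOp_eq hs hσ hall hγ hγ0 r₁ t₁ r₂ t₂ a b h
  · intro h f hf g hg φ hφ
    obtain ⟨Φ, hΦ, -⟩ := exists_sch_tensor hφ hf hg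
    have h₁ := hmem r₁ t₁ f hf g hg φ hφ
    have h₂ := hmem r₂ t₂ f hf g hg φ hφ
    rw [bilinearOp, bilinearOp]
    rw [← hΦ] at h₁ h₂ ⊢
    exact h Φ h₁ h₂
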